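/- Let $M$ be a smooth manifold without boundary (Hausdorff, second countable), $\mathcal F$ a smooth foliation of $M$, $g$ a bundle-like Riemannian metric on $M$, with induced holonomy-invariant metric $g_Q$ on the normal bundle $Q=TM/T\mathcal F$ and projection $\pi:TM\to Q$, and let $J$ be a smooth almost complex structure on $Q$, orthogonal for $g_Q$ and parallel for the transverse Levi-Civita connection $\nabla$ of $g_Q$ (so that $(M,\mathcal F,g,J)$ is a transverse Kähler foliation). Let $\kappa(X)=g_Q(\tau,\pi X)$, $\tau=\sum_i\pi(\nabla^M_{f_i}f_i)$ with $\{f_i\}$ a local orthonormal frame of $T\mathcal F$, be the mean curvature form, and let $\kappa_B$ be its basic part: a basic one-form such that $\int_M\langle\kappa-\kappa_B,\psi\rangle\,d\mathrm{vol}_g=0$ for all compactly supported basic one-forms $\psi$. On complex-valued basic forms put $$d_\kappa=d-\tfrac12\kappa_B\wedge,\qquad \delta_\kappa=\delta_B-\tfrac12\kappa_B^\sharp\lrcorner,\qquad \delta_B=-\sum_a E_a\lrcorner\nabla_{E_a}+\kappa_B^\sharp\lrcorner,\qquad \Delta_\kappa=d_\kappa\delta_\kappa+\delta_\kappa d_\kappa,$$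 where $\{E_a\}$ is a local orthonormal frame of $Q$, and on basic forms of type $(r,s)$ put $\bar\partial_\kappa\phi=\bar\partial_B\phi-\tfrac12\kappa_B^{0,1}\wedge\phi$, where $\bar\partial_B\phi$ is the component of type $(r,s+1)$ of $d\phi$ and $\kappa_B^{0,1}$ is the component of type $(0,1)$ of $\kappa_B$. Let $\phi$ be a basic form of type $(r,0)$. (1) Assume that $d\kappa_B=0$ or that $M$ is compact. If $\phi$ is $\bar\partial_\kappa$-holomorphic, i.e. $\bar\partial_\kappa\phi=0$, then $\phi$ is $\Delta_\kappa$-harmonic, i.e. $\Delta_\kappa\phi=0$. (2) If $M$ is compact and $\phi$ is $\Delta_\kappa$-harmonic, then $\phi$ is $\bar\partial_\kappa$-holomorphic. -/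

import Mathlib

open scoped Manifold ContDiff Topology
open MeasureTheory

noncomputable section

namespace TransverseKahler

/-- The model space `ℝᴺ`.  For a manifold `M` modelled on it, Mathlib's `TangentSpace (𝓡 N) x` is by
definition `Coord N`, tangent vectors being identified with their coordinates in the preferred chart
`extChartAt (𝓡 N) x` at their base point `x`.  Accordingly vector fields, covector fields and tensor
fields on `M` are written as functions on `M` with values in the tensors over `Coord N`. -/
abbrev Coord (N : ℕ) : Type := EuclideanSpace ℝ (Fin N)

/-- A (not necessarily smooth) differential form of degree `k` on `M` with values in `V`. -/
abbrev Form (N : ℕ) (M : Type*) (V : Type*) [NormedAddCommGroup V] [NormedSpace ℝ V] (k : ℕ) :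
    Type _ :=
  M → Coord N [⋀^Fin k]→L[ℝ] V

/-- A smooth Riemannian metric on `M`. -/
abbrev Metric (N : ℕ) (M : Type*) [TopologicalSpace M] [ChartedSpace (Coord N) M]
    [IsManifold (𝓡 N) ∞ M] : Type _ :=
  Bundle.ContMDiffRiemannianMetric (𝓡 N) ∞ (Coord N) (fun x : M => TangentSpace (𝓡 N) x)

section Coordinates

variable {N : ℕ} {M : Type*} [TopologicalSpace M] [ChartedSpace (Coord N) M]
  {V : Type*} [NormedAddCommGroup V] [NormedSpace ℝ V]

/-- The derivative at `y` of the inverse `y ↦ (extChartAt (𝓡 N) x).symm y` of the chart at `x`. -/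
def chartSymmDeriv (x : M) (y : Coord N) : Coord N →L[ℝ] Coord N :=
  mfderiv (𝓡 N) (𝓡 N) (extChartAt (𝓡 N) x).symm y

/-- The derivative of the chart at `x`, taken at the point with coordinates `y`. -/
def chartDeriv (x : M) (y : Coord N) : Coord N →L[ℝ] Coord N :=
  mfderiv (𝓡 N) (𝓡 N) (extChartAt (𝓡 N) x) ((extChartAt (𝓡 N) x).symm y)

/-- The coordinate expression of a differential form in the chart at `x`. -/
def coordForm {k : ℕ} (x : M) (φ : Form N M V k) (y : Coord N) : Coord N [⋀^Fin k]→L[ℝ] V :=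
  (φ ((extChartAt (𝓡 N) x).symm y)).compContinuousLinearMap (chartSymmDeriv x y)

/-- The coordinate expression of a field of bilinear forms in the chart at `x`. -/
def coordBilin (x : M) (B : M → Coord N →L[ℝ] Coord N →L[ℝ] ℝ) (y : Coord N) :
    Coord N →L[ℝ] Coord N →L[ℝ] ℝ :=
  (B ((extChartAt (𝓡 N) x).symm y)).bilinearComp (chartSymmDeriv x y) (chartSymmDeriv x y)

/-- The coordinate expression of a field of endomorphisms in the chart at `x`. -/
def coordEnd (x : M) (A : M → Coord N →L[ℝ] Coord N) (y : Coord N) : Coord N →L[ℝ] Coord N :=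
  chartDeriv x y ∘L A ((extChartAt (𝓡 N) x).symm y) ∘L chartSymmDeriv x y

/-- Smoothness of a differential form. -/
def IsSmoothForm {k : ℕ} (φ : Form N M V k) : Prop :=
  ∀ x : M, ContDiffOn ℝ ∞ (coordForm x φ) (extChartAt (𝓡 N) x).target

/-- Smoothness of a field of endomorphisms. -/
def IsSmoothEnd (A : M → Coord N →L[ℝ] Coord N) : Prop :=
  ∀ x : M, ContDiffOn ℝ ∞ (coordEnd x A) (extChartAt (𝓡 N) x).target

/-- The exterior derivative on `M`, computed at `x` in the chart at `x`. -/
def extD {k : ℕ} (φ : Form N M V k) : Form N M V (k + 1) := fun x =>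
  extDeriv (coordForm x φ) (extChartAt (𝓡 N) x x)

/-- For a field `B` of symmetric bilinear forms on `ℝᴺ`, the lowered Christoffel symbols
`½ (∂_u B(v, w) + ∂_v B(u, w) - ∂_w B(u, v))` at `y`, i.e. the right-hand side of the Koszul formula
for constant vector fields `u`, `v`, `w`. -/
def koszul (B : Coord N → Coord N →L[ℝ] Coord N →L[ℝ] ℝ) (y u : Coord N) :
    Coord N →L[ℝ] Coord N →L[ℝ] ℝ :=
  (1 / 2 : ℝ) • (fderiv ℝ B y u + (fderiv ℝ B y).flip u - ((fderiv ℝ B y).flip u).flip)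

/-- The vector field `V` on `M` is smooth. -/
def IsSmoothField [IsManifold (𝓡 N) ∞ M] (V : M → Coord N) : Prop :=
  ContMDiff (𝓡 N) (𝓡 N).tangent ∞ (fun x => (⟨x, V x⟩ : TangentBundle (𝓡 N) M))

/-- The Lie bracket `[V, W]` of vector fields on `M`. -/
def lieBracket (V W : M → Coord N) : M → Coord N :=
  VectorField.mlieBracket (𝓡 N) (M := M) V W

/-- The derivative `V f` of a function in the direction of a vector field. -/
def dirDeriv (V : M → Coord N) (f : M → ℝ) (x : M) : ℝ :=
  mfderiv (𝓡 N) 𝓘(ℝ, ℝ) f x (V x)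

end Coordinates

/-- A smooth foliation of `M` with leaves of dimension `p`, given by its tangent bundle: a smooth
involutive distribution of rank `p`. -/
structure Foliation (N p : ℕ) (M : Type*) [TopologicalSpace M] [ChartedSpace (Coord N) M]
    [IsManifold (𝓡 N) ∞ M] where
  /-- the tangent space of the leaf through `x` -/
  tangent : M → Submodule ℝ (Coord N)
  finrank_tangent : ∀ x, Module.finrank ℝ (tangent x) = p
  smooth : ∀ x, ∀ v ∈ tangent x, ∃ V : M → Coord N,
    IsSmoothField V ∧ (∀ y, V y ∈ tangent y) ∧ V x = v
  involutive : ∀ V W : M → Coord N, IsSmoothField V → IsSmoothField W →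
    (∀ y, V y ∈ tangent y) → (∀ y, W y ∈ tangent y) →
    ∀ y, lieBracket V W y ∈ tangent y

section Geometry

variable {N p : ℕ} {M : Type*} [TopologicalSpace M] [ChartedSpace (Coord N) M]
  [IsManifold (𝓡 N) ∞ M]

/-- The metric `g` as a field of bilinear forms. -/
def Metric.bilin (g : Metric N M) (x : M) : Coord N →L[ℝ] Coord N →L[ℝ] ℝ := g.inner x

theorem Metric.bilin_symm (g : Metric N M) (x : M) (v w : Coord N) :
    Metric.bilin g x v w = Metric.bilin g x w v := g.symm x v w

theorem Metric.bilin_pos (g : Metric N M) (x : M) (v : Coord N) (hv : v ≠ 0) :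
    0 < Metric.bilin g x v v := g.pos x v hv

/-- The vector `α♯` that is dual to the covector `α` at `x`. -/
def sharp (g : Metric N M) (x : M) : (Coord N →L[ℝ] ℝ) →L[ℝ] Coord N :=
  (Metric.bilin g x).inverse

/-- The orthogonal complement of the tangent space of the leaf.  It is identified with the fibre
at `x` of the normal bundle `Q = TM / TF`. -/
def normal (F : Foliation N p M) (g : Metric N M) (x : M) : Submodule ℝ (Coord N) where
  carrier := {v | ∀ u ∈ F.tangent x, Metric.bilin g x u v = 0}
  add_mem' := by
    intro a b ha hb u hu
    simp [ha u hu, hb u hu]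
  zero_mem' := by
    intro u _
    simp
  smul_mem' := by
    intro c a ha u hu
    simp [ha u hu]

theorem isCompl_normal (F : Foliation N p M) (g : Metric N M) (x : M) :
    IsCompl (normal F g x) (F.tangent x) := by
  let B : LinearMap.BilinForm ℝ (Coord N) :=
    LinearMap.mk₂ ℝ (fun v w => Metric.bilin g x v w) (by simp) (by simp) (by simp) (by simp)
  have hB : ∀ v w, B v w = Metric.bilin g x v w := fun v w => rfl
  have hrefl : B.IsRefl := fun v w h => by
    rw [hB] at h ⊢
    rw [Metric.bilin_symm, h]
  have hn : normal F g x = B.orthogonal (F.tangent x) := by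
    ext v
    rfl
  rw [hn]
  refine ((LinearMap.BilinForm.isCompl_orthogonal_iff_disjoint hrefl).2 ?_).symm
  rw [Submodule.disjoint_def]
  intro v hv hv'
  by_contra h0
  exact (Metric.bilin_pos g x v h0).ne' (hv' v hv)

/-- The projection `π : T_xM → Q_x`. -/
def proj (F : Foliation N p M) (g : Metric N M) (x : M) : Coord N →L[ℝ] Coord N :=
  LinearMap.toContinuousLinearMap
    ((normal F g x).projection (F.tangent x) (isCompl_normal F g x))

/-- The transverse metric `g_Q(π u, π v)`, as a (degenerate) metric on `TM`. -/
def transMetric (F : Foliation N p M) (g : Metric N M) (x : M) :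
    Coord N →L[ℝ] Coord N →L[ℝ] ℝ :=
  (Metric.bilin g x).bilinearComp (proj F g x) (proj F g x)

/-- `g` is bundle-like: the metric induced by `g` on the normal bundle is holonomy invariant, that
is, `L_V g_Q = 0` for all vector fields `V` tangent to the leaves. -/
def IsBundleLike (F : Foliation N p M) (g : Metric N M) : Prop :=
  ∀ V Y Z : M → Coord N, IsSmoothField V → IsSmoothField Y → IsSmoothField Z →
    (∀ x, V x ∈ F.tangent x) → ∀ x,
    dirDeriv V (fun y => transMetric F g y (Y y) (Z y)) x =
      transMetric F g x (lieBracket V Y x) (Z x) +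
        transMetric F g x (Y x) (lieBracket V Z x)

theorem exists_orthonormal_core {W : Type*} [AddCommGroup W] [Module ℝ W]
    (c : InnerProductSpace.Core ℝ W) [FiniteDimensional ℝ W] :
    ∃ b : Module.Basis (Fin (Module.finrank ℝ W)) ℝ W,
      ∀ i j, c.inner (b i) (b j) = if i = j then 1 else 0 := by
  let _ : NormedAddCommGroup W := c.toNormedAddCommGroup
  let _ : InnerProductSpace ℝ W := InnerProductSpace.ofCore c.toCore
  refine ⟨(stdOrthonormalBasis ℝ W).toBasis, fun i j => ?_⟩
  have h := orthonormal_iff_ite.1 (stdOrthonormalBasis ℝ W).orthonormal i j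
  rw [OrthonormalBasis.coe_toBasis]
  exact h

theorem exists_orthonormal (g : Metric N M) (x : M) (S : Submodule ℝ (Coord N)) :
    ∃ b : Module.Basis (Fin (Module.finrank ℝ S)) ℝ S,
      ∀ i j, Metric.bilin g x (b i) (b j) = if i = j then 1 else 0 :=
  exists_orthonormal_core (W := S)
    { inner := fun v w : S => Metric.bilin g x v w
      conj_inner_symm := fun v w => Metric.bilin_symm g x w v
      re_inner_nonneg := fun v => by
        rcases eq_or_ne v 0 with rfl | hv
        · simp
        · simpa using (Metric.bilin_pos g x v (by simpa using hv)).le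
      add_left := fun v w z => by simp
      smul_left := fun v w r => by simp
      definite := fun v h => by
        by_contra hv
        exact (Metric.bilin_pos g x v (by simpa using hv)).ne' h }

/-- A `g`-orthonormal basis of a subspace of the tangent space at `x`. -/
def onb (g : Metric N M) (x : M) (S : Submodule ℝ (Coord N)) :
    Module.Basis (Fin (Module.finrank ℝ S)) ℝ S :=
  (exists_orthonormal g x S).choose

/-! ### Connections -/

/-- The Christoffel symbols at `x`, in the chart at `x`, of the Levi-Civita connection `∇ᴹ` of `g`:
`leviCivita g x u v = ∇ᴹ_u v` for the vector field that has constant coordinates `v`. -/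
def leviCivita (g : Metric N M) (x : M) (u : Coord N) : Coord N →L[ℝ] Coord N :=
  sharp g x ∘L koszul (coordBilin x (Metric.bilin g)) (extChartAt (𝓡 N) x x) u

/-- The Christoffel symbols at `x`, in the chart at `x`, of the transverse Levi-Civita connection
`∇` on `Q` (torsion-free and metric for `g_Q`), from its Koszul formula
`2 g_Q(∇_u π v, π w) = u g_Q(v, w) + v g_Q(u, w) - w g_Q(u, v)` for vector fields with constant
coordinates: `transConn F g x u v = ∇_u (π v)`. -/
def transConn (F : Foliation N p M) (g : Metric N M) (x : M) (u : Coord N) :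
    Coord N →L[ℝ] Coord N :=
  proj F g x ∘L sharp g x ∘L koszul (coordBilin x (transMetric F g)) (extChartAt (𝓡 N) x x) u

/-- The mean curvature vector `τ = ∑ i, π (∇ᴹ_{f_i} f_i)` at `x`, where `f_i` is an orthonormal basis
of the tangent space of the leaf; each `f_i` is extended to a local field tangent to the leaves, the
tangential part of the field with constant coordinates. -/
def meanCurvatureVector (F : Foliation N p M) (g : Metric N M) (x : M) : Coord N :=
  ∑ i, proj F g x
    (fderiv ℝ (fun y => (onb g x (F.tangent x) i : Coord N) -
        coordEnd x (proj F g) y (onb g x (F.tangent x) i)) (extChartAt (𝓡 N) x x)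
        (onb g x (F.tangent x) i) +
      leviCivita g x (onb g x (F.tangent x) i) (onb g x (F.tangent x) i))

/-- The mean curvature form `κ(v) = g_Q(τ, π v)`. -/
def meanCurvatureForm (F : Foliation N p M) (g : Metric N M) (x : M) : Coord N →L[ℝ] ℝ :=
  Metric.bilin g x (meanCurvatureVector F g x) ∘L proj F g x

/-! ### Basic forms -/

/-- Basic forms: smooth forms `φ` with `v ⌟ φ = 0` and `v ⌟ dφ = 0` (equivalently `L_v φ = 0`) for
all `v` tangent to the leaves. -/
structure IsBasic {V : Type*} [NormedAddCommGroup V] [NormedSpace ℝ V] (F : Foliation N p M) {k : ℕ}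
    (φ : Form N M V k) : Prop where
  smooth : IsSmoothForm φ
  horizontal : ∀ x, ∀ w : Fin k → Coord N, (∃ i, w i ∈ F.tangent x) → φ x w = 0
  horizontal_extD : ∀ x, ∀ w : Fin (k + 1) → Coord N, (∃ i, w i ∈ F.tangent x) →
    extD φ x w = 0

/-- The covector field that corresponds to a real form of degree one. -/
def covector (α : Form N M ℝ 1) (x : M) : Coord N →L[ℝ] ℝ :=
  (ContinuousAlternatingMap.ofSubsingleton ℝ (Coord N) ℝ (0 : Fin 1)).symm (α x)

/-- The Riemannian measure of `g`: the measure that has density `√ det (g_ij)` with respect to the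
Lebesgue measure in each chart, obtained as the supremum of the measures so defined on the chart
domains. -/
def volumeMeasure [MeasurableSpace M] (g : Metric N M) : Measure M :=
  ⨆ x : M, Measure.map (extChartAt (𝓡 N) x).symm
    (((volume : Measure (Coord N)).restrict (extChartAt (𝓡 N) x).target).withDensity fun y =>
      ENNReal.ofReal (Real.sqrt (Matrix.det (Matrix.of fun i j : Fin N =>
        coordBilin x (Metric.bilin g) y (EuclideanSpace.single i 1) (EuclideanSpace.single j 1)))))

/-- `κB` is the basic part of the mean curvature form `κ`: it is a basic one-form and `κ - κB` is
`L²`-orthogonal to the (compactly supported) basic one-forms. -/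
structure IsBasicPart [MeasurableSpace M] (F : Foliation N p M) (g : Metric N M)
    (κB : Form N M ℝ 1) : Prop where
  basic : IsBasic F κB
  orthogonal : ∀ ψ : Form N M ℝ 1, IsBasic F ψ → HasCompactSupport ψ →
    ∫ x, (meanCurvatureForm F g x - covector κB x) (sharp g x (covector ψ x)) ∂(volumeMeasure g) = 0

/-! ### Multilinear algebra -/

theorem sum_update_comp_apply {k : ℕ} (A : Coord N →L[ℝ] Coord N)
    (α : Coord N [⋀^Fin k]→L[ℝ] ℂ) (v : Fin k → Coord N) :
    (∑ j : Fin k, α.toContinuousMultilinearMap.compContinuousLinearMap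
      (fun i => if i = j then A else ContinuousLinearMap.id ℝ (Coord N))) v =
      ∑ j, α (Function.update v j (A (v j))) := by
  rw [_root_.sum_apply]
  refine Finset.sum_congr rfl fun j _ => ?_
  rw [ContinuousMultilinearMap.compContinuousLinearMap_apply]
  change α _ = α _
  congr 1
  funext i
  by_cases h : i = j
  · subst h
    simp
  · simp [h]

/-- The action of an endomorphism `A` as a derivation on alternating forms:
`(v₁, …, v_k) ↦ ∑ j, α (v₁, …, A v_j, …, v_k)`. -/
def derivationAct {k : ℕ} (A : Coord N →L[ℝ] Coord N) (α : Coord N [⋀^Fin k]→L[ℝ] ℂ) :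
    Coord N [⋀^Fin k]→L[ℝ] ℂ where
  toContinuousMultilinearMap := ∑ j : Fin k, α.toContinuousMultilinearMap.compContinuousLinearMap
    (fun i => if i = j then A else ContinuousLinearMap.id ℝ (Coord N))
  map_eq_zero_of_eq' := by
    intro v i j hv hij
    change (∑ j : Fin k, α.toContinuousMultilinearMap.compContinuousLinearMap
      (fun i => if i = j then A else ContinuousLinearMap.id ℝ (Coord N))) v = 0
    rw [sum_update_comp_apply, Finset.sum_eq_add i j hij]
    · have h : Function.update v j (A (v j)) =
          Function.update v i (A (v i)) ∘ Equiv.swap i j := by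
        funext l
        rcases eq_or_ne l i with rfl | hi
        · simp [Function.update_of_ne hij, Function.update_of_ne hij.symm, hv]
        · rcases eq_or_ne l j with rfl | hj
          · simp [hv]
          · simp [Equiv.swap_apply_of_ne_of_ne hi hj, Function.update_of_ne hi,
              Function.update_of_ne hj]
      rw [h]
      have h' := α.toAlternatingMap.map_swap (Function.update v i (A (v i))) hij
      exact add_eq_zero_iff_neg_eq.2 h'.symm
    · intro l _ hl
      refine α.map_eq_zero_of_eq _ (i := i) (j := j) ?_ hij
      rw [Function.update_of_ne hl.1.symm, Function.update_of_ne hl.2.symm, hv]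
    · simp
    · simp

/-- The wedge product `θ ∧ α` with a one-form:
`(v₀, …, v_k) ↦ ∑ i, (-1)ⁱ θ(v_i) α(v₀, …, v_{i-1}, v_{i+1}, …, v_k)`. -/
def wedge {k : ℕ} (θ : Coord N →L[ℝ] ℂ) (α : Coord N [⋀^Fin k]→L[ℝ] ℂ) :
    Coord N [⋀^Fin (k + 1)]→L[ℝ] ℂ :=
  ContinuousAlternatingMap.alternatizeUncurryFin
    (((ContinuousLinearMap.lsmul ℝ ℂ :
      ℂ →L[ℝ] (Coord N [⋀^Fin k]→L[ℝ] ℂ) →L[ℝ] (Coord N [⋀^Fin k]→L[ℝ] ℂ)).flip α) ∘L θ)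

/-- The interior product `v ⌟ α = α(v, ·, …, ·)`. -/
def interior {k : ℕ} (v : Coord N) (α : Coord N [⋀^Fin (k + 1)]→L[ℝ] ℂ) :
    Coord N [⋀^Fin k]→L[ℝ] ℂ :=
  α.curryLeft v

/-! ### The twisted operators on complex-valued basic forms -/

/-- `∇_u φ` at `x` for the connection induced by `∇` on horizontal forms `φ`. -/
def covDeriv (F : Foliation N p M) (g : Metric N M) {k : ℕ} (φ : Form N M ℂ k) (x : M)
    (u : Coord N) : Coord N [⋀^Fin k]→L[ℝ] ℂ :=
  fderiv ℝ (coordForm x φ) (extChartAt (𝓡 N) x x) u - derivationAct (transConn F g x u) (φ x)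

/-- `δ_T φ = -∑ a, E_a ⌟ ∇_{E_a} φ`, where `E_a` is an orthonormal basis of `Q`. -/
def deltaT (F : Foliation N p M) (g : Metric N M) {k : ℕ} (φ : Form N M ℂ (k + 1)) :
    Form N M ℂ k := fun x =>
  -∑ a, interior (onb g x (normal F g x) a : Coord N)
    (covDeriv F g φ x (onb g x (normal F g x) a))

/-- `δ_B = δ_T + κB♯ ⌟`. -/
def deltaB (F : Foliation N p M) (g : Metric N M) (κB : Form N M ℝ 1) {k : ℕ}
    (φ : Form N M ℂ (k + 1)) : Form N M ℂ k := fun x =>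
  deltaT F g φ x + interior (sharp g x (covector κB x)) (φ x)

/-- `d_κ = d - ½ κB ∧`. -/
def dKappa (κB : Form N M ℝ 1) {k : ℕ} (φ : Form N M ℂ k) : Form N M ℂ (k + 1) := fun x =>
  extD φ x - (1 / 2 : ℝ) • wedge (Complex.ofRealCLM ∘L covector κB x) (φ x)

/-- `δ_κ = δ_B - ½ κB♯ ⌟`. -/
def deltaKappa (F : Foliation N p M) (g : Metric N M) (κB : Form N M ℝ 1) {k : ℕ}
    (φ : Form N M ℂ (k + 1)) : Form N M ℂ k := fun x =>
  deltaB F g κB φ x - (1 / 2 : ℝ) • interior (sharp g x (covector κB x)) (φ x)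

/-- The twisted basic Laplacian `Δ_κ = d_κ δ_κ + δ_κ d_κ` (with `δ_κ = 0` on functions). -/
def laplaceKappa (F : Foliation N p M) (g : Metric N M) (κB : Form N M ℝ 1) :
    ∀ {k : ℕ}, Form N M ℂ k → Form N M ℂ k
  | 0, φ => deltaKappa F g κB (dKappa κB φ)
  | _ + 1, φ => dKappa κB (deltaKappa F g κB φ) + deltaKappa F g κB (dKappa κB φ)

/-- `Δ_κ`-harmonic forms. -/
def IsKappaHarmonic (F : Foliation N p M) (g : Metric N M) (κB : Form N M ℝ 1) {k : ℕ}
    (φ : Form N M ℂ k) : Prop :=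
  laplaceKappa F g κB φ = 0

/-! ### The transverse complex structure -/

/-- The bundle-like metric `g` and the field `J` of endomorphisms make `F` a transverse Kähler
foliation.  Here `J` is an almost complex structure on `Q`, regarded as the endomorphism `J ∘ π` of
`TM` with values in the orthogonal complement of the leaves; `g_Q` is Hermitian, and `∇ J = 0` for
the transverse Levi-Civita connection. -/
structure IsTransverseKahler (F : Foliation N p M) (g : Metric N M)
    (J : M → Coord N →L[ℝ] Coord N) : Prop where
  bundleLike : IsBundleLike F g
  smooth : IsSmoothEnd J
  map_tangent : ∀ x, ∀ v ∈ F.tangent x, J x v = 0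
  map_mem_normal : ∀ x v, J x v ∈ normal F g x
  sq : ∀ x v, J x (J x v) = -proj F g x v
  hermitian : ∀ x v w, transMetric F g x (J x v) (J x w) = transMetric F g x v w
  parallel : ∀ x u v,
    proj F g x (fderiv ℝ (coordEnd x J) (extChartAt (𝓡 N) x x) u v) +
      transConn F g x u (J x v) - J x (transConn F g x u v) = 0

/-- `Q_{1,0} = {θ + i Jθ | θ ∈ Q*}` at `x`, where `(Jθ)(v) = -θ(J v)`. -/
def covectors10 (F : Foliation N p M) (J : M → Coord N →L[ℝ] Coord N) (x : M) :
    Set (Coord N →L[ℝ] ℂ) :=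
  {ξ | ∃ θ : Coord N →L[ℝ] ℝ, (∀ v ∈ F.tangent x, θ v = 0) ∧
    ∀ v, ξ v = (θ v : ℂ) + Complex.I * (-(θ (J x v)) : ℝ)}

/-- `Q_{0,1} = {θ - i Jθ | θ ∈ Q*}` at `x`. -/
def covectors01 (F : Foliation N p M) (J : M → Coord N →L[ℝ] Coord N) (x : M) :
    Set (Coord N →L[ℝ] ℂ) :=
  {ξ | ∃ θ : Coord N →L[ℝ] ℝ, (∀ v ∈ F.tangent x, θ v = 0) ∧
    ∀ v, ξ v = (θ v : ℂ) - Complex.I * (-(θ (J x v)) : ℝ)}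

/-- The space `Λ^{r,s} Q*` at `x`, spanned by the products `θ₁ ∧ ⋯ ∧ θ_{r+s}` (determinants) with
`θ₁, …, θ_r` in `Q_{1,0}` and `θ_{r+1}, …, θ_{r+s}` in `Q_{0,1}`. -/
def typeSpace (F : Foliation N p M) (J : M → Coord N →L[ℝ] Coord N) (x : M) (r s : ℕ) :
    Submodule ℂ (Coord N [⋀^Fin (r + s)]→L[ℝ] ℂ) :=
  Submodule.span ℂ {α | ∃ θ : Fin (r + s) → Coord N →L[ℝ] ℂ,
    (∀ i : Fin (r + s), (i : ℕ) < r → θ i ∈ covectors10 F J x) ∧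
    (∀ i : Fin (r + s), r ≤ (i : ℕ) → θ i ∈ covectors01 F J x) ∧
    ∀ v, α v = Matrix.det (Matrix.of fun i j => θ i (v j))}

/-- Forms of type `(r, s)`. -/
def IsOfType (F : Foliation N p M) (J : M → Coord N →L[ℝ] Coord N) (r s : ℕ)
    (φ : Form N M ℂ (r + s)) : Prop :=
  ∀ x, φ x ∈ typeSpace F J x r s

/-- The rotation `R_t = cos t + sin t J`. -/
def rotation (J : M → Coord N →L[ℝ] Coord N) (x : M) (t : ℝ) : Coord N →L[ℝ] Coord N :=
  Real.cos t • ContinuousLinearMap.id ℝ (Coord N) + Real.sin t • J x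

/-- The component of type `(r, s)` of a horizontal form `α` of degree `k = r + s` at `x`, i.e. the
projection onto `Λ^{r,s} Q*` along the other summands `Λ^{a,b} Q*` with `a + b = k`.  As the pullback
by `R_t` is multiplication by `e^{i (a - b) t}` on `Λ^{a,b} Q*`, the projection is the average of
`e^{-i (r - s) t} R_t^* α` over the angles `t = 2 π j / (2 k + 1)`, `0 ≤ j ≤ 2 k`; note that
`|(a - b) - (r - s)| < 2 k + 1`. -/
def typePart (J : M → Coord N →L[ℝ] Coord N) (x : M) (r s : ℕ)
    (α : Coord N [⋀^Fin (r + s)]→L[ℝ] ℂ) : Coord N [⋀^Fin (r + s)]→L[ℝ] ℂ :=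
  let t : ℕ → ℝ := fun j => 2 * Real.pi * j / (2 * (r + s) + 1)
  (1 / (2 * (r + s) + 1) : ℂ) • ∑ j ∈ Finset.range (2 * (r + s) + 1),
    Complex.exp (-(((r : ℂ) - (s : ℂ)) * t j * Complex.I)) •
      α.compContinuousLinearMap (rotation J x (t j))

/-- The operator `∂̄_B` on basic forms of type `(r, s)`: the component of `dφ` of type
`(r, s + 1)`. -/
def dbarB (J : M → Coord N →L[ℝ] Coord N) (r s : ℕ) (φ : Form N M ℂ (r + s)) :
    Form N M ℂ (r + (s + 1)) := fun x =>
  typePart J x r (s + 1) (extD φ x)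

/-- `κB^{0,1} = ½ (κB - i J κB)`, where `(J κB)(v) = -κB(J v)`. -/
def kappa01 (J : M → Coord N →L[ℝ] Coord N) (κB : Form N M ℝ 1) (x : M) : Coord N →L[ℝ] ℂ :=
  (1 / 2 : ℂ) • (Complex.ofRealCLM ∘L covector κB x +
    Complex.I • (Complex.ofRealCLM ∘L covector κB x ∘L J x))

/-- The operator `∂̄_κ φ = ∂̄_B φ - ½ κB^{0,1} ∧ φ` on basic forms of type `(r, s)`. -/
def dbarKappa (J : M → Coord N →L[ℝ] Coord N) (κB : Form N M ℝ 1) (r s : ℕ)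
    (φ : Form N M ℂ (r + s)) : Form N M ℂ (r + (s + 1)) := fun x =>
  dbarB J r s φ x - (1 / 2 : ℝ) • wedge (kappa01 J κB x) (φ x)

/-- `∂̄_κ`-holomorphic forms of type `(r, s)`. -/
def IsKappaHolomorphic (J : M → Coord N →L[ℝ] Coord N) (κB : Form N M ℝ 1) (r s : ℕ)
    (φ : Form N M ℂ (r + s)) : Prop :=
  dbarKappa J κB r s φ = 0

end Geometry

end TransverseKahler

end

/-! Put `D = ∇ - ½ κB ⊗` for the twisted transverse covariant derivative (`twistedCovDeriv`). Since
`∇` is torsion-free, `d_κ = Alt D`; since `δ_κ = δ_T + ½ κB♯ ⌟`, the same `D` gives `δ_κ = -tr D`. A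
form of type `(r, 0)` is complex linear in every slot with respect to `J`. As `∇J = 0`, each `D_u φ`
is again complex linear, and `∂̄_κ φ` is the alternation of the antilinear part of `u ↦ D_u φ`.
Alternation is injective on such antilinear families, so holomorphy means `D_{Ju} φ = i D_u φ`
(`isKappaHolomorphic_iff`).

For (1), the Kähler identity `Λ (Alt L) = 2i tr L` for complex linear families
(`contract_alternatize`) reads `δ_κ φ = (i/2) Λ d_κ φ` on forms of type `(r, 0)`. If `φ` is
holomorphic, replacing the frame `E_a` by `J E_a` turns `tr D` into `-tr D`, so `δ_κ φ = 0`.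
Moreover `d_κ φ` is complex linear again, so `δ_κ d_κ φ = (i/2) Λ d_κ d_κ φ`, which vanishes because
`d_κ² = 0` when `dκB = 0` (`dKappa_dKappa`).

For (2), `d_κ` and `δ_κ` are adjoint up to `δ_B` of a basic one-form, and `∫ δ_B ψ = 0` on a compact
manifold (`integral_re_deltaB`). Indeed `δ_B ψ = -div ψ♯ - (κ - κB)(ψ♯)`: the divergence theorem
kills the first term and the definition of the basic part kills the second. Hence a harmonic `φ` has
`d_κ φ = Alt D φ = 0`, and this already forces the antilinear part of `D φ` to vanish.

On a compact manifold `dκB = 0` is automatic (`IsBasicPart.extD_eq_zero`). With `η = dκB`, integrate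
`δ_B` of `δ_T η` and of `X ↦ ⟨κB, X ⌟ η⟩`. Because `δ_T δ_T η = 0` and `η (κB♯, κB♯) = 0`, the
difference of the two identities is `∫ |η|² = 0`. The vanishing of `δ_T δ_T` on basic two-forms is
deduced from `d² = 0` and the Kähler identities `δ_T = ½ Λ d J` and `J δ_T = ½ (Λ d J - d Λ)` in
degrees one and two, so the curvature of `∇` never enters.

All computations take place at the base point of a preferred chart. The auxiliary Christoffel
symbols `adaptedConn` make the projection to `Q`, the transverse cometric and `J` parallel, so
contractions built from these tensors commute with `∇` and preserve basic forms. -/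

set_option linter.unusedSectionVars false

noncomputable section

namespace TransverseKahler

/-! ### Charts, transition maps and coordinate expressions -/

section Charts

variable {N : ℕ} {M : Type*} [TopologicalSpace M] [ChartedSpace (Coord N) M]
  [IsManifold (𝓡 N) ∞ M]

/-- The transition map from the chart at `z` to the chart at `w`. -/
def transition (z w : M) : Coord N → Coord N :=
  extChartAt (𝓡 N) w ∘ (extChartAt (𝓡 N) z).symm

instance isManifold_one : IsManifold (𝓡 N) 1 M := IsManifold.of_le (n := ∞) (by simp)

theorem chartDeriv_comp_chartSymmDeriv {z : M} {y : Coord N}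
    (hy : y ∈ (extChartAt (𝓡 N) z).target) :
    chartDeriv z y ∘L chartSymmDeriv z y = ContinuousLinearMap.id ℝ (Coord N) := by
  have h := mfderiv_extChartAt_comp_mfderivWithin_extChartAt_symm (I := 𝓡 N) hy
  simp only [modelWithCornersSelf_coe, Set.range_id, mfderivWithin_univ] at h
  exact h

theorem chartSymmDeriv_comp_chartDeriv {z : M} {y : Coord N}
    (hy : y ∈ (extChartAt (𝓡 N) z).target) :
    chartSymmDeriv z y ∘L chartDeriv z y = ContinuousLinearMap.id ℝ (Coord N) := by
  have h := mfderivWithin_extChartAt_symm_comp_mfderiv_extChartAt (I := 𝓡 N) hy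
  simp only [modelWithCornersSelf_coe, Set.range_id, mfderivWithin_univ] at h
  exact h

@[simp]
theorem chartDeriv_chartSymmDeriv {z : M} {y : Coord N}
    (hy : y ∈ (extChartAt (𝓡 N) z).target) (v : Coord N) :
    chartDeriv z y (chartSymmDeriv z y v) = v :=
  DFunLike.congr_fun (chartDeriv_comp_chartSymmDeriv hy) v

@[simp]
theorem chartSymmDeriv_chartDeriv {z : M} {y : Coord N}
    (hy : y ∈ (extChartAt (𝓡 N) z).target) (v : Coord N) :
    chartSymmDeriv z y (chartDeriv z y v) = v :=
  DFunLike.congr_fun (chartSymmDeriv_comp_chartDeriv hy) v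

theorem isOpen_target (z : M) : IsOpen (extChartAt (𝓡 N) z).target :=
  isOpen_extChartAt_target z

theorem target_mem_nhds {z : M} {y : Coord N} (hy : y ∈ (extChartAt (𝓡 N) z).target) :
    (extChartAt (𝓡 N) z).target ∈ 𝓝 y := (isOpen_target z).mem_nhds hy

theorem base_mem_target (x : M) : extChartAt (𝓡 N) x x ∈ (extChartAt (𝓡 N) x).target :=
  mem_extChartAt_target x

@[simp]
theorem symm_base (x : M) : (extChartAt (𝓡 N) x).symm (extChartAt (𝓡 N) x x) = x :=
  extChartAt_to_inv x

theorem mdifferentiableAt_symm {z : M} {y : Coord N}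
    (hy : y ∈ (extChartAt (𝓡 N) z).target) :
    MDifferentiableAt (𝓡 N) (𝓡 N) (extChartAt (𝓡 N) z).symm y := by
  have h := mdifferentiableWithinAt_extChartAt_symm (I := 𝓡 N) hy
  rwa [modelWithCornersSelf_coe, Set.range_id, mdifferentiableWithinAt_univ] at h

theorem contDiffAt_transition {z w : M} {y : Coord N} (hy : y ∈ (extChartAt (𝓡 N) z).target)
    (hw : (extChartAt (𝓡 N) z).symm y ∈ (extChartAt (𝓡 N) w).source) :
    ContDiffAt ℝ ∞ (transition (N := N) z w) y := by
  have := contDiffWithinAt_ext_coord_change (I := 𝓡 N) (n := ∞) w z (y := y) (by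
    simp only [PartialEquiv.trans_source, PartialEquiv.symm_source]
    exact ⟨hy, hw⟩)
  simpa [contDiffWithinAt_univ, transition] using this

theorem eventually_mem_source {z w : M} {y : Coord N} (hy : y ∈ (extChartAt (𝓡 N) z).target)
    (hw : (extChartAt (𝓡 N) z).symm y ∈ (extChartAt (𝓡 N) w).source) :
    ∀ᶠ y' in 𝓝 y, y' ∈ (extChartAt (𝓡 N) z).target ∧
      (extChartAt (𝓡 N) z).symm y' ∈ (extChartAt (𝓡 N) w).source := by
  refine Filter.Eventually.and (target_mem_nhds hy) ?_
  exact (mdifferentiableAt_symm hy).continuousAt.preimage_mem_nhds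
    ((isOpen_extChartAt_source w).mem_nhds hw)

theorem chartSymmDeriv_eq_comp {z w : M} {y : Coord N} (hy : y ∈ (extChartAt (𝓡 N) z).target)
    (hw : (extChartAt (𝓡 N) z).symm y ∈ (extChartAt (𝓡 N) w).source) :
    chartSymmDeriv z y =
      chartSymmDeriv w (transition z w y) ∘L fderiv ℝ (transition z w) y := by
  have hT : transition z w y ∈ (extChartAt (𝓡 N) w).target :=
    (extChartAt (𝓡 N) w).map_source hw
  have he : (extChartAt (𝓡 N) z).symm =ᶠ[𝓝 y]
      (extChartAt (𝓡 N) w).symm ∘ transition (N := N) z w := by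
    filter_upwards [eventually_mem_source hy hw] with y' hy'
    simp only [transition, Function.comp_apply]
    exact ((extChartAt (𝓡 N) w).left_inv hy'.2).symm
  have hd : MDifferentiableAt (𝓡 N) (𝓡 N) (transition (N := N) z w) y :=
    ((contDiffAt_transition hy hw).differentiableAt (by simp)).mdifferentiableAt
  unfold chartSymmDeriv
  rw [he.mfderiv_eq, mfderiv_comp y (mdifferentiableAt_symm hT) hd, mfderiv_eq_fderiv]
  rfl

@[simp]
theorem chartSymmDeriv_base (x : M) :
    chartSymmDeriv (N := N) x (extChartAt (𝓡 N) x x) = ContinuousLinearMap.id ℝ (Coord N) := by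
  have h := mfderivWithin_range_extChartAt_symm (I := 𝓡 N) (x := x)
  simp only [modelWithCornersSelf_coe, Set.range_id, mfderivWithin_univ] at h
  exact h

@[simp]
theorem chartDeriv_base (x : M) :
    chartDeriv (N := N) x (extChartAt (𝓡 N) x x) = ContinuousLinearMap.id ℝ (Coord N) := by
  have h := chartDeriv_comp_chartSymmDeriv (base_mem_target (N := N) x)
  rw [chartSymmDeriv_base] at h
  simpa using h

theorem transition_symm {z : M} (y : Coord N) :
    transition z ((extChartAt (𝓡 N) z).symm y) y =
      extChartAt (𝓡 N) ((extChartAt (𝓡 N) z).symm y) ((extChartAt (𝓡 N) z).symm y) := rfl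

/-- Tangent vectors at a point are read in its own preferred chart, where the derivative of the
inverse chart is the identity; only the transition map from the chart at `z` to that chart remains.
-/
theorem chartSymmDeriv_eq_fderiv {z : M} {y : Coord N}
    (hy : y ∈ (extChartAt (𝓡 N) z).target) :
    chartSymmDeriv z y = fderiv ℝ (transition z ((extChartAt (𝓡 N) z).symm y)) y := by
  rw [chartSymmDeriv_eq_comp hy (mem_extChartAt_source _), transition_symm, chartSymmDeriv_base]
  rfl

theorem minSmoothness_two_le : minSmoothness ℝ 2 ≤ (∞ : WithTop ℕ∞) := by
  rw [minSmoothness_of_isRCLikeNormedField]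
  exact WithTop.coe_le_coe.2 le_top

section Forms

variable {V : Type*} [NormedAddCommGroup V] [NormedSpace ℝ V] {k : ℕ}

theorem coordForm_apply (x : M) (φ : Form N M V k) (y : Coord N) (v : Fin k → Coord N) :
    coordForm x φ y v = φ ((extChartAt (𝓡 N) x).symm y) (fun i => chartSymmDeriv x y (v i)) := rfl

@[simp]
theorem coordForm_base (x : M) (φ : Form N M V k) :
    coordForm x φ (extChartAt (𝓡 N) x x) = φ x := by
  ext v
  simp only [coordForm_apply, chartSymmDeriv_base, symm_base, ContinuousLinearMap.id_apply]

theorem coordForm_eventuallyEq (φ : Form N M V k) {z w : M} {y : Coord N}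
    (hy : y ∈ (extChartAt (𝓡 N) z).target)
    (hw : (extChartAt (𝓡 N) z).symm y ∈ (extChartAt (𝓡 N) w).source) :
    coordForm z φ =ᶠ[𝓝 y] fun y' => (coordForm w φ (transition z w y')).compContinuousLinearMap
      (fderiv ℝ (transition z w) y') := by
  filter_upwards [eventually_mem_source hy hw] with y' hy'
  ext v
  have : (extChartAt (𝓡 N) w).symm (transition (N := N) z w y') = (extChartAt (𝓡 N) z).symm y' :=
    (extChartAt (𝓡 N) w).left_inv hy'.2
  simp only [coordForm_apply, ContinuousAlternatingMap.compContinuousLinearMap_apply,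
    chartSymmDeriv_eq_comp hy'.1 hy'.2, this]
  rfl

theorem IsSmoothForm.contDiffAt {φ : Form N M V k} (hφ : IsSmoothForm φ) {z : M} {y : Coord N}
    (hy : y ∈ (extChartAt (𝓡 N) z).target) : ContDiffAt ℝ ∞ (coordForm z φ) y :=
  (hφ z).contDiffAt (target_mem_nhds hy)

theorem IsSmoothForm.differentiableAt {φ : Form N M V k} (hφ : IsSmoothForm φ) {z : M} {y : Coord N}
    (hy : y ∈ (extChartAt (𝓡 N) z).target) : DifferentiableAt ℝ (coordForm z φ) y :=
  (hφ.contDiffAt hy).differentiableAt (by simp)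

/-- `extD` uses a different chart at every point. Exterior differentiation commutes with pullback by
the transition maps, so in any fixed chart it is the usual exterior derivative on the whole chart
domain. Smoothness of `dφ` and `d² = 0` rest on this. -/
theorem coordForm_extD {φ : Form N M V k} (hφ : IsSmoothForm φ) {z : M} {y : Coord N}
    (hy : y ∈ (extChartAt (𝓡 N) z).target) :
    coordForm z (extD φ) y = extDeriv (coordForm z φ) y := by
  have hw := mem_extChartAt_source (I := 𝓡 N) ((extChartAt (𝓡 N) z).symm y)
  rw [(coordForm_eventuallyEq φ hy hw).extDeriv_eq,
    extDeriv_pullback (r := ∞) (f := transition z ((extChartAt (𝓡 N) z).symm y))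
      (hφ.differentiableAt (base_mem_target _))
      (contDiffAt_transition hy hw) minSmoothness_two_le]
  rw [coordForm, chartSymmDeriv_eq_fderiv hy]
  rfl

theorem IsSmoothForm.extD {φ : Form N M V k} (hφ : IsSmoothForm φ) :
    IsSmoothForm (TransverseKahler.extD φ) := by
  intro z
  have h : ContDiffOn ℝ ∞ (extDeriv (coordForm z φ)) (extChartAt (𝓡 N) z).target :=
    (ContinuousAlternatingMap.alternatizeUncurryFinCLM ℝ (Coord N) V).contDiff.comp_contDiffOn
      ((hφ z).fderiv_of_isOpen (isOpen_target z) (by simp))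
  exact h.congr fun y hy => coordForm_extD hφ hy

theorem extD_extD {φ : Form N M V k} (hφ : IsSmoothForm φ) :
    TransverseKahler.extD (TransverseKahler.extD φ) = 0 := by
  funext x
  have h : coordForm x (TransverseKahler.extD φ) =ᶠ[𝓝 (extChartAt (𝓡 N) x x)]
      extDeriv (coordForm x φ) := by
    filter_upwards [target_mem_nhds (base_mem_target (N := N) x)] with y hy using coordForm_extD hφ hy
  rw [TransverseKahler.extD, h.extDeriv_eq]
  exact extDeriv_extDeriv_apply (hφ.contDiffAt (base_mem_target x)) minSmoothness_two_le

end Forms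

/-- The coordinate expression of a vector field in the chart at `z`. -/
def coordVec (z : M) (V : M → Coord N) (y : Coord N) : Coord N :=
  chartDeriv z y (V ((extChartAt (𝓡 N) z).symm y))

@[simp]
theorem coordVec_base (x : M) (V : M → Coord N) :
    coordVec x V (extChartAt (𝓡 N) x x) = V x := by
  simp only [coordVec, chartDeriv_base, symm_base, ContinuousLinearMap.id_apply]

theorem mem_chart_source_of_target {z : M} {y : Coord N}
    (hy : y ∈ (extChartAt (𝓡 N) z).target) :
    (extChartAt (𝓡 N) z).symm y ∈ (chartAt (Coord N) z).source := by
  have := (extChartAt (𝓡 N) z).map_target hy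
  rwa [extChartAt_source] at this

/-- The trivialization of the tangent bundle at `z` acts on fibres as the derivative of the chart,
so smoothness of the bundle section becomes smoothness of the coordinate vector. -/
theorem IsSmoothField.contDiffOn {V : M → Coord N} (hV : IsSmoothField V) (z : M) :
    ContDiffOn ℝ ∞ (coordVec z V) (extChartAt (𝓡 N) z).target := by
  intro y hy
  have hs := mem_chart_source_of_target hy
  have h1 := (Bundle.Trivialization.contMDiffAt_section_iff
    (trivializationAt (Coord N) (TangentSpace (𝓡 N) : M → Type) z)
    (E := (TangentSpace (𝓡 N) : M → Type)) (s := V) hs).1 (hV _)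
  have h2 : ContMDiffWithinAt (𝓡 N) 𝓘(ℝ, Coord N) ∞ ((fun x : M =>
      (trivializationAt (Coord N) (TangentSpace (𝓡 N)) z ⟨x, V x⟩).2) ∘
        (extChartAt (𝓡 N) z).symm) (extChartAt (𝓡 N) z).target y :=
    ContMDiffAt.comp_contMDiffWithinAt (I' := 𝓡 N) y h1 (contMDiffOn_extChartAt_symm z y hy)
  refine (h2.contDiffWithinAt).congr_of_mem (fun y' hy' => ?_) hy
  have hs' := mem_chart_source_of_target hy'
  have h3 := TangentBundle.continuousLinearMapAt_trivializationAt (I := 𝓡 N) hs'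
  have h4 := DFunLike.congr_fun h3 (V ((extChartAt (𝓡 N) z).symm y'))
  have h5 := congrFun ((trivializationAt (Coord N) (TangentSpace (𝓡 N) : M → Type) z
    ).coe_linearMapAt_of_mem (R := ℝ) hs') (V ((extChartAt (𝓡 N) z).symm y'))
  exact h4.symm.trans h5

theorem coordBilin_apply (x : M) (B : M → Coord N →L[ℝ] Coord N →L[ℝ] ℝ) (y u v : Coord N) :
    coordBilin x B y u v =
      B ((extChartAt (𝓡 N) x).symm y) (chartSymmDeriv x y u) (chartSymmDeriv x y v) := rfl

@[simp]
theorem coordBilin_base (x : M) (B : M → Coord N →L[ℝ] Coord N →L[ℝ] ℝ) :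
    coordBilin x B (extChartAt (𝓡 N) x x) = B x := by
  ext u v
  simp only [coordBilin_apply, chartSymmDeriv_base, symm_base, ContinuousLinearMap.id_apply]

theorem coordEnd_apply (x : M) (A : M → Coord N →L[ℝ] Coord N) (y v : Coord N) :
    coordEnd x A y v =
      chartDeriv x y (A ((extChartAt (𝓡 N) x).symm y) (chartSymmDeriv x y v)) := rfl

@[simp]
theorem coordEnd_base (x : M) (A : M → Coord N →L[ℝ] Coord N) :
    coordEnd x A (extChartAt (𝓡 N) x x) = A x := by
  ext1 u
  simp only [coordEnd_apply, chartDeriv_base, chartSymmDeriv_base, symm_base,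
    ContinuousLinearMap.id_apply]

theorem contMDiffOn_symm_section (z : M) (u : Coord N) :
    ContMDiffOn (𝓡 N) (𝓡 N).tangent ∞ (fun m : M => (⟨m,
      (trivializationAt (Coord N) (TangentSpace (𝓡 N)) z).symm m u⟩ : TangentBundle (𝓡 N) M))
      (chartAt (Coord N) z).source := by
  intro m hm
  refine ((Bundle.Trivialization.contMDiffAt_section_iff
    (trivializationAt (Coord N) (TangentSpace (𝓡 N)) z) hm).2 ?_).contMDiffWithinAt
  refine (contMDiffAt_const (c := u)).congr_of_eventuallyEq ?_
  filter_upwards [(chartAt (Coord N) z).open_source.mem_nhds hm] with m' hm'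
  rw [Bundle.Trivialization.apply_mk_symm _ hm']

theorem trivialization_symm_eq {z : M} {y : Coord N}
    (hy : y ∈ (extChartAt (𝓡 N) z).target) (u : Coord N) :
    (trivializationAt (Coord N) (TangentSpace (𝓡 N)) z).symm ((extChartAt (𝓡 N) z).symm y) u =
      chartSymmDeriv z y u := by
  have h := TangentBundle.symmL_trivializationAt (I := 𝓡 N) (mem_chart_source_of_target hy)
  rw [(extChartAt (𝓡 N) z).right_inv hy] at h
  simp only [modelWithCornersSelf_coe, Set.range_id, mfderivWithin_univ] at h
  have h' := DFunLike.congr_fun h u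
  rw [Bundle.Trivialization.symmL_apply _ (mem_chart_source_of_target hy)] at h'
  exact h'

theorem contDiffOn_coordBilin_metric (g : Metric N M) (z : M) :
    ContDiffOn ℝ ∞ (coordBilin z (Metric.bilin g)) (extChartAt (𝓡 N) z).target := by
  rw [contDiffOn_clm_apply]
  intro u
  rw [contDiffOn_clm_apply]
  intro v y hy
  have hs := mem_chart_source_of_target hy
  have hnh := (chartAt (Coord N) z).open_source.mem_nhds hs
  have key : ContMDiffAt (𝓡 N) ((𝓡 N).prod 𝓘(ℝ)) ∞ (fun m : M =>
      Bundle.TotalSpace.mk' ℝ (E := Bundle.Trivial M ℝ) m (g.inner m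
        ((trivializationAt (Coord N) (TangentSpace (𝓡 N)) z).symm m u)
        ((trivializationAt (Coord N) (TangentSpace (𝓡 N)) z).symm m v)))
        ((extChartAt (𝓡 N) z).symm y) := by
    apply ContMDiffAt.clm_bundle_apply₂ (F₁ := Coord N) (F₂ := Coord N)
    · exact g.contMDiff _
    · exact (contMDiffOn_symm_section z u).contMDiffAt hnh
    · exact (contMDiffOn_symm_section z v).contMDiffAt hnh
  have h1 := (Bundle.contMDiffAt_totalSpace.1 key).2
  have h2 := ContMDiffAt.comp_contMDiffWithinAt (I' := 𝓡 N) y h1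
    (contMDiffOn_extChartAt_symm (I := 𝓡 N) (n := ∞) z y hy)
  refine (h2.contDiffWithinAt).congr_of_mem (fun y' hy' => ?_) hy
  simp only [Function.comp_apply]
  change _ = g.inner _ _ _
  rw [trivialization_symm_eq hy', trivialization_symm_eq hy']
  rfl

end Charts

/-! ### Linear algebra of the normal bundle at a point -/

section PointwiseAlgebra

variable {N p : ℕ} {M : Type*} [TopologicalSpace M] [ChartedSpace (Coord N) M]
  [IsManifold (𝓡 N) ∞ M] (F : Foliation N p M) (g : Metric N M) (x : M)

theorem proj_mem_normal (v : Coord N) : proj F g x v ∈ normal F g x :=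
  Submodule.projection_apply_mem _ v

theorem proj_of_mem_normal {v : Coord N} (hv : v ∈ normal F g x) : proj F g x v = v :=
  Submodule.projection_apply_of_mem_left (isCompl_normal F g x) hv

theorem proj_of_mem_tangent {v : Coord N} (hv : v ∈ F.tangent x) : proj F g x v = 0 :=
  (Submodule.projection_apply_eq_zero_iff (isCompl_normal F g x)).2 hv

theorem proj_eq_zero_iff {v : Coord N} : proj F g x v = 0 ↔ v ∈ F.tangent x :=
  Submodule.projection_apply_eq_zero_iff (isCompl_normal F g x)

@[simp]
theorem proj_proj (v : Coord N) : proj F g x (proj F g x v) = proj F g x v :=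
  proj_of_mem_normal F g x (proj_mem_normal F g x v)

theorem sub_proj_mem_tangent (v : Coord N) : v - proj F g x v ∈ F.tangent x := by
  rw [← proj_eq_zero_iff F g, map_sub, proj_proj, sub_self]

theorem bilin_tangent_normal {u v : Coord N} (hu : u ∈ F.tangent x) (hv : v ∈ normal F g x) :
    Metric.bilin g x u v = 0 := hv u hu

theorem bilin_proj_left (u v : Coord N) :
    Metric.bilin g x (proj F g x u) v = transMetric F g x u v := by
  have h := bilin_tangent_normal F g x (sub_proj_mem_tangent F g x v) (proj_mem_normal F g x u)
  rw [Metric.bilin_symm, map_sub, sub_eq_zero] at h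
  exact h

theorem transMetric_apply (u v : Coord N) :
    transMetric F g x u v = Metric.bilin g x (proj F g x u) (proj F g x v) := rfl

theorem transMetric_symm (u v : Coord N) : transMetric F g x u v = transMetric F g x v u :=
  Metric.bilin_symm g x _ _

theorem bilin_proj_right (u v : Coord N) :
    Metric.bilin g x u (proj F g x v) = transMetric F g x u v := by
  rw [Metric.bilin_symm, bilin_proj_left, transMetric_symm]

@[simp]
theorem transMetric_proj_left (u v : Coord N) :
    transMetric F g x (proj F g x u) v = transMetric F g x u v := by
  simp [transMetric_apply]

theorem transMetric_tangent_left {u : Coord N} (hu : u ∈ F.tangent x) (v : Coord N) :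
    transMetric F g x u v = 0 := by
  simp [transMetric_apply, proj_of_mem_tangent F g x hu]

theorem proj_eq_zero_of_transMetric {u : Coord N} (h : ∀ v, transMetric F g x u v = 0) :
    proj F g x u = 0 := by
  by_contra h0
  exact (Metric.bilin_pos g x _ h0).ne' (h u)

theorem isInvertible_bilin : (Metric.bilin g x).IsInvertible := by
  have hinj : Function.Injective ((Metric.bilin g x : Coord N →ₗ[ℝ] (Coord N →L[ℝ] ℝ))) := by
    rw [← LinearMap.ker_eq_bot, LinearMap.ker_eq_bot']
    intro v hv
    by_contra h0
    refine (Metric.bilin_pos g x v h0).ne' ?_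
    exact DFunLike.congr_fun hv v
  have hdim : Module.finrank ℝ (Coord N) = Module.finrank ℝ (Coord N →L[ℝ] ℝ) := by
    rw [← (LinearMap.toContinuousLinearMap (𝕜 := ℝ) (E := Coord N) (F' := ℝ)).finrank_eq]
    exact (Subspace.dual_finrank_eq (K := ℝ) (V := Coord N)).symm
  let e := (LinearEquiv.ofInjectiveOfFinrankEq _ hinj hdim).toContinuousLinearEquiv
  exact ⟨e, by ext v w; rfl⟩

@[simp]
theorem bilin_sharp (ξ : Coord N →L[ℝ] ℝ) : Metric.bilin g x (sharp g x ξ) = ξ := by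
  obtain ⟨e, he⟩ := isInvertible_bilin g x
  rw [sharp, ← he, ContinuousLinearMap.inverse_equiv]
  exact e.apply_symm_apply ξ

/-- The cometric `Q* → Q` of the transverse metric, as a map `T*M → TM`. -/
def cometric : (Coord N →L[ℝ] ℝ) →L[ℝ] Coord N := proj F g x ∘L sharp g x

@[simp]
theorem proj_cometric (ξ : Coord N →L[ℝ] ℝ) :
    proj F g x (cometric F g x ξ) = cometric F g x ξ := by
  simp [cometric]

/-- Together with `proj_cometric` this characterizes the cometric as the inverse of `g_Q` on the
normal space; later arguments use only these two properties. -/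
theorem transMetric_cometric (ξ : Coord N →L[ℝ] ℝ) (w : Coord N) :
    transMetric F g x (cometric F g x ξ) w = ξ (proj F g x w) := by
  rw [cometric, ContinuousLinearMap.comp_apply, transMetric_proj_left, ← bilin_proj_right,
    bilin_sharp]

end PointwiseAlgebra

/-! ### Smoothness of the metric, the projection and the cometric -/

section Smoothness

variable {N p : ℕ} {M : Type*} [TopologicalSpace M] [ChartedSpace (Coord N) M]
  [IsManifold (𝓡 N) ∞ M] (F : Foliation N p M) (g : Metric N M)

theorem coordBilin_metric_isInvertible {z : M} {y : Coord N}
    (hy : y ∈ (extChartAt (𝓡 N) z).target) :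
    (coordBilin z (Metric.bilin g) y).IsInvertible := by
  obtain ⟨e, he⟩ := isInvertible_bilin g ((extChartAt (𝓡 N) z).symm y)
  let S : Coord N ≃L[ℝ] Coord N := ContinuousLinearEquiv.equivOfInverse (chartSymmDeriv z y)
    (chartDeriv z y) (chartDeriv_chartSymmDeriv hy) (chartSymmDeriv_chartDeriv hy)
  refine ⟨(S.trans e).trans (S.symm.arrowCongr (ContinuousLinearEquiv.refl ℝ ℝ)), ?_⟩
  ext u v
  have := DFunLike.congr_fun (DFunLike.congr_fun he (chartSymmDeriv z y u)) (chartSymmDeriv z y v)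
  rw [coordBilin_apply, ← this]
  rfl

theorem coordBilin_metric_symm (z : M) (y u v : Coord N) :
    coordBilin z (Metric.bilin g) y u v = coordBilin z (Metric.bilin g) y v u :=
  Metric.bilin_symm g _ _ _

theorem contDiffOn_coordBilin_inverse (z : M) :
    ContDiffOn ℝ ∞ (fun y => (coordBilin z (Metric.bilin g) y).inverse)
      (extChartAt (𝓡 N) z).target := by
  intro y hy
  obtain ⟨e, he⟩ := coordBilin_metric_isInvertible g hy
  have h1 : ContDiffAt ℝ ∞ ContinuousLinearMap.inverse (coordBilin z (Metric.bilin g) y) := by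
    rw [← he]
    exact contDiffAt_map_inverse e
  exact h1.comp_contDiffWithinAt y (contDiffOn_coordBilin_metric g z y hy)

theorem proj_eq_sub {x : M} {v k : Coord N} (hk : k ∈ F.tangent x)
    (h : ∀ u ∈ F.tangent x, Metric.bilin g x u (v - k) = 0) : proj F g x v = v - k := by
  have h1 : proj F g x (v - k) = v - k := proj_of_mem_normal F g x h
  rwa [map_sub, proj_of_mem_tangent F g x hk, sub_zero] at h1

/-- Orthogonal projection along a frame: near a point, leafwise fields `V i` form a frame of the
leaves, with inclusion `Vm`, dual map `VT = g(V i, ·)` and Gram matrix `S = VT ∘ Vm`. The projection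
onto the normal space is then `1 - Vm S⁻¹ VT`, which is smooth because inversion is. -/
theorem contDiffOn_coordEnd_proj (z : M) :
    ContDiffOn ℝ ∞ (coordEnd z (proj F g)) (extChartAt (𝓡 N) z).target := by
  intro y₀ hy₀
  set x₁ := (extChartAt (𝓡 N) z).symm y₀ with hx₁
  let b := Module.finBasisOfFinrankEq ℝ (F.tangent x₁) (F.finrank_tangent x₁)
  choose V hVs hVt hVx using fun i => F.smooth x₁ (b i) (b i).2
  let Vm : Coord N → (Fin p → ℝ) →L[ℝ] Coord N := fun y =>
    ∑ i, (ContinuousLinearMap.proj (R := ℝ) (φ := fun _ : Fin p => ℝ) i).smulRight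
      (coordVec z (V i) y)
  let VT : Coord N → Coord N →L[ℝ] (Fin p → ℝ) := fun y =>
    ContinuousLinearMap.pi fun i => coordBilin z (Metric.bilin g) y (coordVec z (V i) y)
  have hVm : ∀ y c, Vm y c = ∑ i, c i • coordVec z (V i) y := fun y c => by
    simp [Vm, sum_apply]
  have hVT : ∀ y w i, VT y w i = coordBilin z (Metric.bilin g) y (coordVec z (V i) y) w :=
    fun y w i => rfl
  have sVm : ContDiffOn ℝ ∞ Vm (extChartAt (𝓡 N) z).target := by
    rw [contDiffOn_clm_apply]
    intro c
    simp only [hVm]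
    exact ContDiffOn.sum fun i _ => ContDiffOn.const_smul (c i) ((hVs i).contDiffOn z)
  have sVT : ContDiffOn ℝ ∞ VT (extChartAt (𝓡 N) z).target := by
    rw [contDiffOn_clm_apply]
    intro w
    rw [contDiffOn_pi]
    intro i
    exact ((contDiffOn_coordBilin_metric g z).clm_apply ((hVs i).contDiffOn z)).clm_apply
      contDiffOn_const
  let S : Coord N → (Fin p → ℝ) →L[ℝ] (Fin p → ℝ) := fun y => VT y ∘L Vm y
  have sS : ContDiffOn ℝ ∞ S (extChartAt (𝓡 N) z).target := sVT.clm_comp sVm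
  -- The quadratic form of the Gram matrix is `g` evaluated on the combination with coefficients
  -- `c`; positivity of `g` then makes `S y₀` injective.
  have hquad : ∀ y c, ∑ i, c i * S y c i =
      coordBilin z (Metric.bilin g) y (Vm y c) (Vm y c) := fun y c => by
    have : ∀ i, S y c i = coordBilin z (Metric.bilin g) y (coordVec z (V i) y) (Vm y c) :=
      fun i => rfl
    simp only [this]
    nth_rw 2 [hVm y c]
    simp [sum_apply]
  have hchart : ∀ y ∈ (extChartAt (𝓡 N) z).target, ∀ c, chartSymmDeriv z y (Vm y c) =
      ∑ i, c i • V i ((extChartAt (𝓡 N) z).symm y) := fun y hy c => by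
    simp only [hVm, coordVec, map_sum, map_smul, chartSymmDeriv_chartDeriv hy]
  have hunit₀ : IsUnit (S y₀) := by
    have hinj : Function.Injective (S y₀ : (Fin p → ℝ) →ₗ[ℝ] (Fin p → ℝ)) := by
      rw [← LinearMap.ker_eq_bot, LinearMap.ker_eq_bot']
      intro c hc
      have h1 : S y₀ c = 0 := hc
      have h2 := hquad y₀ c
      rw [h1] at h2
      simp only [Pi.zero_apply, mul_zero, Finset.sum_const_zero] at h2
      have h3 : chartSymmDeriv z y₀ (Vm y₀ c) = 0 := by
        by_contra h0
        exact (Metric.bilin_pos g _ _ h0).ne h2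
      rw [hchart y₀ hy₀] at h3
      have h4 : ∑ i, c i • b i = 0 := by
        apply Subtype.ext
        rw [← hx₁] at h3
        simp only [hVx] at h3
        simpa only [AddSubmonoidClass.coe_finsetSum, Submodule.coe_smul, Submodule.coe_zero] using h3
      funext i
      exact Fintype.linearIndependent_iff.1 b.linearIndependent c h4 i
    let e := (LinearEquiv.ofInjectiveEndo _ hinj).toContinuousLinearEquiv
    exact ⟨ContinuousLinearEquiv.unitsEquiv ℝ _ |>.symm e, by ext; rfl⟩
  have sInv : ContDiffWithinAt ℝ ∞ (fun y => Ring.inverse (S y)) (extChartAt (𝓡 N) z).target y₀ := by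
    obtain ⟨u, hu⟩ := hunit₀
    have h1 : ContDiffAt ℝ ∞ Ring.inverse (S y₀) := by
      rw [← hu]
      exact contDiffAt_ringInverse ℝ u
    exact h1.comp_contDiffWithinAt y₀ (sS y₀ hy₀)
  -- The fields are independent at `y₀` only by choice; openness of the units propagates this to
  -- nearby points.
  have hev : ∀ᶠ y in 𝓝[(extChartAt (𝓡 N) z).target] y₀, IsUnit (S y) := by
    have h1 : {A : (Fin p → ℝ) →L[ℝ] (Fin p → ℝ) | IsUnit A} ∈ 𝓝 (S y₀) :=
      Units.isOpen.mem_nhds hunit₀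
    exact (sS y₀ hy₀).continuousWithinAt h1
  have hformula : ContDiffWithinAt ℝ ∞ (fun y => ContinuousLinearMap.id ℝ (Coord N) -
      Vm y ∘L Ring.inverse (S y) ∘L VT y) (extChartAt (𝓡 N) z).target y₀ :=
    contDiffWithinAt_const.sub ((sVm y₀ hy₀).clm_comp (sInv.clm_comp (sVT y₀ hy₀)))
  refine hformula.congr_of_eventuallyEq_of_mem ?_ hy₀
  filter_upwards [hev, self_mem_nhdsWithin] with y hu hy
  ext1 w
  have hmem : ∀ c, chartSymmDeriv z y (Vm y c) ∈
      F.tangent ((extChartAt (𝓡 N) z).symm y) := fun c => by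
    rw [hchart y hy]
    exact Submodule.sum_mem _ fun i _ => Submodule.smul_mem _ _ (hVt i _)
  have hSS : S y ∘L Ring.inverse (S y) = 1 := Ring.mul_inverse_cancel _ hu
  have hSS' : Ring.inverse (S y) ∘L S y = 1 := Ring.inverse_mul_cancel _ hu
  -- Invertibility of `S y` makes the fields independent, and the leaves have constant rank `p`, so
  -- they also span.
  have hspan : ∀ u ∈ F.tangent ((extChartAt (𝓡 N) z).symm y), ∃ c,
      u = chartSymmDeriv z y (Vm y c) := by
    let T : (Fin p → ℝ) →ₗ[ℝ] F.tangent ((extChartAt (𝓡 N) z).symm y) :=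
      LinearMap.codRestrict _ (chartSymmDeriv z y ∘L Vm y : (Fin p → ℝ) →ₗ[ℝ] Coord N) hmem
    have hT : Function.Injective T := by
      rw [← LinearMap.ker_eq_bot, LinearMap.ker_eq_bot']
      intro c hc
      have h1 : chartSymmDeriv z y (Vm y c) = 0 := congrArg Subtype.val hc
      have h2 : Vm y c = 0 := by
        rw [← chartDeriv_chartSymmDeriv hy (Vm y c), h1, map_zero]
      have h3 : S y c = 0 := by
        change VT y (Vm y c) = 0
        rw [h2, map_zero]
      have h4 := DFunLike.congr_fun hSS' c
      simpa [h3] using h4.symm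
    have hTs : Function.Surjective T :=
      (LinearMap.injective_iff_surjective_of_finrank_eq_finrank
        (by rw [F.finrank_tangent, Module.finrank_fin_fun])).1 hT
    intro u hu
    obtain ⟨c, hc⟩ := hTs ⟨u, hu⟩
    exact ⟨c, (congrArg Subtype.val hc).symm⟩
  rw [coordEnd_apply, proj_eq_sub F g (hmem (Ring.inverse (S y) (VT y w)))]
  · rw [map_sub, chartDeriv_chartSymmDeriv hy, chartDeriv_chartSymmDeriv hy]
    rfl
  · intro u hu'
    obtain ⟨c, rfl⟩ := hspan u hu'
    have h5 : VT y (w - Vm y (Ring.inverse (S y) (VT y w))) = 0 := by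
      rw [map_sub]
      have h6 := DFunLike.congr_fun hSS (VT y w)
      rw [sub_eq_zero]
      exact h6.symm
    rw [← map_sub]
    change coordBilin z (Metric.bilin g) y (Vm y c) _ = 0
    rw [hVm]
    simp only [map_sum, map_smul, sum_apply, smul_apply]
    refine Finset.sum_eq_zero fun i _ => ?_
    rw [← hVT, h5]
    simp

theorem coordBilin_transMetric (z : M) {y : Coord N} (hy : y ∈ (extChartAt (𝓡 N) z).target) :
    coordBilin z (transMetric F g) y = (coordBilin z (Metric.bilin g) y).bilinearComp
      (coordEnd z (proj F g) y) (coordEnd z (proj F g) y) := by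
  ext u v
  simp only [coordBilin_apply, coordEnd_apply, transMetric_apply, chartSymmDeriv_chartDeriv hy,
    ContinuousLinearMap.bilinearComp_apply]

theorem contDiffOn_coordBilin_transMetric (z : M) :
    ContDiffOn ℝ ∞ (coordBilin z (transMetric F g)) (extChartAt (𝓡 N) z).target := by
  rw [contDiffOn_clm_apply]
  intro u
  rw [contDiffOn_clm_apply]
  intro v
  have hP := contDiffOn_coordEnd_proj F g z
  have h : ∀ w : Coord N, ContDiffOn ℝ ∞ (fun y => coordEnd z (proj F g) y w)
      (extChartAt (𝓡 N) z).target := fun w => hP.clm_apply contDiffOn_const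
  refine (((contDiffOn_coordBilin_metric g z).clm_apply (h u)).clm_apply (h v)).congr
    fun y hy => ?_
  rw [coordBilin_transMetric F g z hy]
  rfl

/-- The coordinate expression of the cometric. -/
def coordCometric (z : M) (y : Coord N) : (Coord N →L[ℝ] ℝ) →L[ℝ] Coord N :=
  coordEnd z (proj F g) y ∘L (coordBilin z (Metric.bilin g) y).inverse

theorem contDiffOn_coordCometric (z : M) :
    ContDiffOn ℝ ∞ (coordCometric F g z) (extChartAt (𝓡 N) z).target :=
  (contDiffOn_coordEnd_proj F g z).clm_comp (contDiffOn_coordBilin_inverse g z)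

theorem coordBilin_inverse_apply {z : M} {y : Coord N} (hy : y ∈ (extChartAt (𝓡 N) z).target)
    (ξ : Coord N →L[ℝ] ℝ) :
    (coordBilin z (Metric.bilin g) y).inverse ξ =
      chartDeriv z y (sharp g ((extChartAt (𝓡 N) z).symm y) (ξ ∘L chartDeriv z y)) := by
  obtain ⟨e, he⟩ := coordBilin_metric_isInvertible g hy
  rw [← he, ContinuousLinearMap.inverse_equiv]
  apply e.injective
  rw [ContinuousLinearEquiv.coe_coe, e.apply_symm_apply]
  ext v
  have := DFunLike.congr_fun (DFunLike.congr_fun he (chartDeriv z y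
    (sharp g ((extChartAt (𝓡 N) z).symm y) (ξ ∘L chartDeriv z y)))) v
  rw [ContinuousLinearEquiv.coe_coe] at this
  rw [this, coordBilin_apply, chartSymmDeriv_chartDeriv hy, bilin_sharp,
    ContinuousLinearMap.comp_apply, chartDeriv_chartSymmDeriv hy]

theorem coordCometric_apply {z : M} {y : Coord N} (hy : y ∈ (extChartAt (𝓡 N) z).target)
    (ξ : Coord N →L[ℝ] ℝ) :
    coordCometric F g z y ξ =
      chartDeriv z y (cometric F g ((extChartAt (𝓡 N) z).symm y) (ξ ∘L chartDeriv z y)) := by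
  rw [coordCometric, ContinuousLinearMap.comp_apply, coordBilin_inverse_apply g hy, coordEnd_apply,
    chartSymmDeriv_chartDeriv hy]
  rfl

@[simp]
theorem coordCometric_base (x : M) :
    coordCometric F g x (extChartAt (𝓡 N) x x) = cometric F g x := by
  ext1 ξ
  rw [coordCometric_apply F g (base_mem_target x), chartDeriv_base, symm_base]
  rfl

end Smoothness

/-! ### Vector fields, Lie brackets and directional derivatives in coordinates -/

section Fields

variable {N p : ℕ} {M : Type*} [TopologicalSpace M] [ChartedSpace (Coord N) M]
  [IsManifold (𝓡 N) ∞ M]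

/-- A constant local section times a bump function. The bundle-like condition speaks of global
fields only; this allows arbitrary values to be inserted at a point. -/
theorem exists_isSmoothField [T2Space M] (x : M) (u : Coord N) :
    ∃ V : M → Coord N, IsSmoothField V ∧ V x = u := by
  obtain ⟨f⟩ : Nonempty (SmoothBumpFunction (𝓡 N) x) := inferInstance
  let s : M → Coord N :=
    fun m => (trivializationAt (Coord N) (TangentSpace (𝓡 N) : M → Type) x).symm m u
  have hs : ContMDiffOn (𝓡 N) (𝓡 N).tangent ∞
      (fun m : M => (⟨m, s m⟩ : TangentBundle (𝓡 N) M)) (chartAt (Coord N) x).source :=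
    contMDiffOn_symm_section x u
  refine ⟨fun m => f m • s m, ?_, ?_⟩
  · intro m
    by_cases hm : m ∈ tsupport f
    · have hm' := f.tsupport_subset_chartAt_source hm
      exact ContMDiffAt.smul_section (f.contMDiff.contMDiffAt)
        (hs.contMDiffAt ((chartAt (Coord N) x).open_source.mem_nhds hm'))
    · have h0 : ContMDiffAt (𝓡 N) (𝓡 N).tangent ∞
          (fun m : M => (⟨m, 0⟩ : TangentBundle (𝓡 N) M)) m :=
        (Bundle.contMDiff_zeroSection ℝ (TangentSpace (𝓡 N) : M → Type)).contMDiffAt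
      refine h0.congr_of_eventuallyEq ?_
      filter_upwards [(isClosed_tsupport f).isOpen_compl.mem_nhds hm] with m' hm'
      have h1 : f m' = 0 := image_eq_zero_of_notMem_tsupport hm'
      rw [h1, zero_smul]
      rfl
  · have h1 : f x = 1 := f.eq_one
    have h2 := trivialization_symm_eq (base_mem_target (N := N) x) u
    rw [symm_base, chartSymmDeriv_base] at h2
    simp only [h1, s]
    exact (one_smul ℝ _).trans h2

theorem IsSmoothField.differentiableAt {V : M → Coord N} (hV : IsSmoothField V) (x : M) :
    DifferentiableAt ℝ (coordVec x V) (extChartAt (𝓡 N) x x) :=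
  ((hV.contDiffOn x).contDiffAt (target_mem_nhds (base_mem_target x))).differentiableAt (by simp)

/-- The bracket is pulled back through the chart at `x`, whose derivative at `x` is the identity, so
the flat formula holds there without correction. -/
theorem lieBracket_eq (V W : M → Coord N) (x : M) :
    lieBracket V W x = fderiv ℝ (coordVec x W) (extChartAt (𝓡 N) x x) (V x) -
      fderiv ℝ (coordVec x V) (extChartAt (𝓡 N) x x) (W x) := by
  have key : ∀ V : M → Coord N, VectorField.mpullbackWithin 𝓘(ℝ, Coord N) (𝓡 N)
      (extChartAt (𝓡 N) x).symm V (Set.range (𝓡 N)) =ᶠ[𝓝 (extChartAt (𝓡 N) x x)]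
      coordVec x V := by
    intro V
    filter_upwards [target_mem_nhds (base_mem_target (N := N) x)] with y hy
    have hinv : ContinuousLinearMap.inverse (chartSymmDeriv x y) = chartDeriv x y :=
      ContinuousLinearMap.inverse_eq (chartSymmDeriv_comp_chartDeriv hy)
        (chartDeriv_comp_chartSymmDeriv hy)
    have hm : mfderivWithin 𝓘(ℝ, Coord N) (𝓡 N) (extChartAt (𝓡 N) x).symm (Set.range (𝓡 N)) y =
        chartSymmDeriv x y := by
      rw [modelWithCornersSelf_coe, Set.range_id, mfderivWithin_univ]
      rfl
    change ContinuousLinearMap.inverse (mfderivWithin 𝓘(ℝ, Coord N) (𝓡 N)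
      (extChartAt (𝓡 N) x).symm (Set.range (𝓡 N)) y) _ = _
    rw [hm]
    exact DFunLike.congr_fun hinv _
  refine (VectorField.mlieBracketWithin_apply (I := 𝓡 N) (V := V) (W := W) (s := Set.univ)
    (x₀ := x)).trans ?_
  have h1 : (mfderiv (𝓡 N) 𝓘(ℝ, Coord N) (extChartAt (𝓡 N) x) x).inverse =
      ContinuousLinearMap.id ℝ (Coord N) := by
    have h := chartDeriv_base (N := N) x
    rw [chartDeriv, symm_base] at h
    rw [h]
    exact ContinuousLinearMap.inverse_id
  refine (DFunLike.congr_fun h1 _).trans ?_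
  have hu : (extChartAt (𝓡 N) x).symm ⁻¹' Set.univ ∩ Set.range (𝓡 N) = Set.univ := by simp
  have h2 := Filter.EventuallyEq.lieBracket_vectorField_eq (𝕜 := ℝ) (key V) (key W)
  change VectorField.lieBracketWithin ℝ (VectorField.mpullbackWithin 𝓘(ℝ, Coord N) (𝓡 N)
    (extChartAt (𝓡 N) x).symm V (Set.range (𝓡 N))) (VectorField.mpullbackWithin 𝓘(ℝ, Coord N)
    (𝓡 N) (extChartAt (𝓡 N) x).symm W (Set.range (𝓡 N)))
    ((extChartAt (𝓡 N) x).symm ⁻¹' Set.univ ∩ Set.range (𝓡 N)) (extChartAt (𝓡 N) x x) = _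
  rw [hu]
  have h3 : ∀ A B : Coord N → Coord N, VectorField.lieBracketWithin ℝ A B Set.univ =
    VectorField.lieBracket ℝ A B := fun A B => VectorField.lieBracketWithin_univ
  refine (congrFun (h3 _ _) _).trans (h2.trans ?_)
  change fderiv ℝ (coordVec x W) _ (coordVec x V _) - fderiv ℝ (coordVec x V) _ (coordVec x W _) = _
  rw [coordVec_base, coordVec_base]

theorem dirDeriv_eq (V : M → Coord N) {f : M → ℝ} {x : M} {f' : Coord N → ℝ}
    (hf : f ∘ (extChartAt (𝓡 N) x).symm =ᶠ[𝓝 (extChartAt (𝓡 N) x x)] f')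
    (hf' : DifferentiableAt ℝ f' (extChartAt (𝓡 N) x x)) :
    dirDeriv V f x = fderiv ℝ f' (extChartAt (𝓡 N) x x) (V x) := by
  have he : f =ᶠ[𝓝 x] f' ∘ extChartAt (𝓡 N) x := by
    have h1 := (continuousAt_extChartAt (I := 𝓡 N) x).eventually hf
    filter_upwards [h1, extChartAt_source_mem_nhds (I := 𝓡 N) x] with m hm hs
    simpa only [Function.comp_apply, (extChartAt (𝓡 N) x).left_inv hs] using hm
  have hd : MDifferentiableAt (𝓡 N) 𝓘(ℝ, Coord N) (extChartAt (𝓡 N) x) x :=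
    mdifferentiableAt_extChartAt (mem_chart_source _ x)
  rw [dirDeriv, he.mfderiv_eq, mfderiv_comp x hf'.mdifferentiableAt hd, mfderiv_eq_fderiv]
  have h := chartDeriv_base (N := N) x
  rw [chartDeriv, symm_base] at h
  rw [h]
  rfl

end Fields

/-! ### Bundle-like metrics and the transverse Levi-Civita connection -/

section Infinitesimal

variable {N p : ℕ} {M : Type*} [TopologicalSpace M] [ChartedSpace (Coord N) M]
  [IsManifold (𝓡 N) ∞ M] [T2Space M] {F : Foliation N p M} {g : Metric N M}

theorem differentiableAt_coordBilin_transMetric (F : Foliation N p M) (g : Metric N M) (x : M) :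
    DifferentiableAt ℝ (coordBilin x (transMetric F g)) (extChartAt (𝓡 N) x x) :=
  ((contDiffOn_coordBilin_transMetric F g x).contDiffAt
    (target_mem_nhds (base_mem_target x))).differentiableAt (by simp)

theorem differentiableAt_coordEnd_proj (F : Foliation N p M) (g : Metric N M) (x : M) :
    DifferentiableAt ℝ (coordEnd x (proj F g)) (extChartAt (𝓡 N) x x) :=
  ((contDiffOn_coordEnd_proj F g x).contDiffAt
    (target_mem_nhds (base_mem_target x))).differentiableAt (by simp)

theorem differentiableAt_coordCometric (F : Foliation N p M) (g : Metric N M) (x : M) :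
    DifferentiableAt ℝ (coordCometric F g x) (extChartAt (𝓡 N) x x) :=
  ((contDiffOn_coordCometric F g x).contDiffAt
    (target_mem_nhds (base_mem_target x))).differentiableAt (by simp)

theorem coordBilin_coordVec (x : M) (B : M → Coord N →L[ℝ] Coord N →L[ℝ] ℝ) (Y Z : M → Coord N)
    {y : Coord N} (hy : y ∈ (extChartAt (𝓡 N) x).target) :
    coordBilin x B y (coordVec x Y y) (coordVec x Z y) =
      B ((extChartAt (𝓡 N) x).symm y) (Y ((extChartAt (𝓡 N) x).symm y))
        (Z ((extChartAt (𝓡 N) x).symm y)) := by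
  simp only [coordBilin_apply, coordVec, chartSymmDeriv_chartDeriv hy]

/-- The Lie derivative of the transverse metric along the leaves vanishes, in coordinates. -/
theorem IsBundleLike.lie_eq_zero (hg : IsBundleLike F g) {W : M → Coord N} (hW : IsSmoothField W)
    (hWt : ∀ y, W y ∈ F.tangent y) (x : M) (u v : Coord N) :
    fderiv ℝ (coordBilin x (transMetric F g)) (extChartAt (𝓡 N) x x) (W x) u v +
      transMetric F g x (fderiv ℝ (coordVec x W) (extChartAt (𝓡 N) x x) u) v +
      transMetric F g x u (fderiv ℝ (coordVec x W) (extChartAt (𝓡 N) x x) v) = 0 := by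
  obtain ⟨Y, hY, rfl⟩ := exists_isSmoothField x u
  obtain ⟨Z, hZ, rfl⟩ := exists_isSmoothField x v
  have h := hg W Y Z hW hY hZ hWt x
  have hB := (differentiableAt_coordBilin_transMetric F g x).hasFDerivAt
  have hYd := (hY.differentiableAt x).hasFDerivAt
  have hZd := (hZ.differentiableAt x).hasFDerivAt
  have hf := (hB.clm_apply hYd).clm_apply hZd
  rw [dirDeriv_eq W (f' := fun y => coordBilin x (transMetric F g) y (coordVec x Y y)
    (coordVec x Z y)) ?_ hf.differentiableAt, hf.fderiv, lieBracket_eq, lieBracket_eq] at h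
  · simp only [coordVec_base, coordBilin_base, _root_.add_apply, ContinuousLinearMap.comp_apply,
      ContinuousLinearMap.flip_apply, map_sub, _root_.sub_apply] at h
    linarith
  · filter_upwards [target_mem_nhds (base_mem_target (N := N) x)] with y hy
    exact (coordBilin_coordVec x _ Y Z hy).symm

theorem fderiv_bilin_symm {E : Type*} [NormedAddCommGroup E] [NormedSpace ℝ E]
    {B : E → E →L[ℝ] E →L[ℝ] ℝ} (hs : ∀ y u v, B y u v = B y v u) {y : E}
    (hB : DifferentiableAt ℝ B y) (w u v : E) :
    fderiv ℝ B y w u v = fderiv ℝ B y w v u := by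
  have h : ∀ u v, HasFDerivAt (fun y => B y u v) (((fderiv ℝ B y).flip u).flip v) y := fun u v => by
    have := (hB.hasFDerivAt.clm_apply (hasFDerivAt_const u _)).clm_apply (hasFDerivAt_const v _)
    simpa using this
  have h3 : (fun y => B y u v) = fun y => B y v u := funext fun y => hs y u v
  have h4 := h u v
  rw [h3] at h4
  exact DFunLike.congr_fun (h4.unique (h v u)) w

theorem fderiv_transMetric_symm (x : M) (w u v : Coord N) :
    fderiv ℝ (coordBilin x (transMetric F g)) (extChartAt (𝓡 N) x x) w u v =
      fderiv ℝ (coordBilin x (transMetric F g)) (extChartAt (𝓡 N) x x) w v u := by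
  have hs : ∀ y u v, coordBilin x (transMetric F g) y u v = coordBilin x (transMetric F g) y v u :=
    fun y u v => by rw [coordBilin_apply, coordBilin_apply, transMetric_symm]
  exact fderiv_bilin_symm hs (differentiableAt_coordBilin_transMetric F g x) w u v

/-- Differentiate the identity `g_Q(W, v) = 0`, which holds for every leafwise field `W`. -/
theorem fderiv_transMetric_tangent {W : M → Coord N} (hW : IsSmoothField W)
    (hWt : ∀ y, W y ∈ F.tangent y) (x : M) (u v : Coord N) :
    fderiv ℝ (coordBilin x (transMetric F g)) (extChartAt (𝓡 N) x x) u (W x) v +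
      transMetric F g x (fderiv ℝ (coordVec x W) (extChartAt (𝓡 N) x x) u) v = 0 := by
  have hB := (differentiableAt_coordBilin_transMetric F g x).hasFDerivAt
  have hf := (hB.clm_apply (hW.differentiableAt x).hasFDerivAt).clm_apply (hasFDerivAt_const v _)
  have h0 : (fun y => coordBilin x (transMetric F g) y (coordVec x W y) v)
      =ᶠ[𝓝 (extChartAt (𝓡 N) x x)] fun _ => (0 : ℝ) := by
    filter_upwards [target_mem_nhds (base_mem_target (N := N) x)] with y hy
    rw [coordBilin_apply, coordVec, chartSymmDeriv_chartDeriv hy]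
    exact transMetric_tangent_left F g _ (hWt _) _
  have h1 := (hf.congr_of_eventuallyEq h0.symm).unique (hasFDerivAt_const 0 _)
  have h2 := DFunLike.congr_fun h1 u
  simp only [_root_.add_apply, ContinuousLinearMap.comp_apply, ContinuousLinearMap.flip_apply,
    _root_.zero_apply, zero_add, ContinuousLinearMap.comp_zero, coordVec_base,
    coordBilin_base] at h2
  rw [add_comm]
  exact h2

theorem koszul_apply (B : Coord N → Coord N →L[ℝ] Coord N →L[ℝ] ℝ) (y u v w : Coord N) :
    koszul B y u v w = (1 / 2) * (fderiv ℝ B y u v w + fderiv ℝ B y v u w - fderiv ℝ B y w u v) := by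
  simp [koszul]

theorem koszul_transMetric_symm (F : Foliation N p M) (g : Metric N M) (x : M) (u v : Coord N) :
    koszul (coordBilin x (transMetric F g)) (extChartAt (𝓡 N) x x) u v =
      koszul (coordBilin x (transMetric F g)) (extChartAt (𝓡 N) x x) v u := by
  ext w
  rw [koszul_apply, koszul_apply, fderiv_transMetric_symm x w u v]
  ring

theorem transConn_symm (F : Foliation N p M) (g : Metric N M) (x : M) (u v : Coord N) :
    transConn F g x u v = transConn F g x v u := by
  simp only [transConn, ContinuousLinearMap.comp_apply]
  rw [koszul_transMetric_symm]

theorem koszul_tangent_middle {W : M → Coord N} (hg : IsBundleLike F g) (hW : IsSmoothField W)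
    (hWt : ∀ y, W y ∈ F.tangent y) (x : M) (u v : Coord N) :
    koszul (coordBilin x (transMetric F g)) (extChartAt (𝓡 N) x x) u (W x) v =
      -transMetric F g x (fderiv ℝ (coordVec x W) (extChartAt (𝓡 N) x x) u) v := by
  have h1 := hg.lie_eq_zero hW hWt x u v
  have h2 := fderiv_transMetric_tangent (g := g) hW hWt x u v
  have h3 := fderiv_transMetric_tangent (g := g) hW hWt x v u
  rw [fderiv_transMetric_symm, transMetric_symm] at h3
  rw [koszul_apply]
  linarith

/-- This is where holonomy invariance enters: extend `w` to a leafwise field and subtract the two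
derivatives of `g_Q(W, ·) = 0` from `L_W g_Q = 0`. The right-hand side of the Koszul formula thus
descends to `Q`, so `transConn`, defined by raising an index and projecting, really solves it. -/
theorem koszul_tangent_right (hg : IsBundleLike F g) (x : M) (u v : Coord N) {w : Coord N}
    (hw : w ∈ F.tangent x) :
    koszul (coordBilin x (transMetric F g)) (extChartAt (𝓡 N) x x) u v w = 0 := by
  obtain ⟨W, hW, hWt, rfl⟩ := F.smooth x w hw
  have h1 := hg.lie_eq_zero hW hWt x u v
  have h2 := fderiv_transMetric_tangent (g := g) hW hWt x u v
  have h3 := fderiv_transMetric_tangent (g := g) hW hWt x v u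
  rw [fderiv_transMetric_symm] at h2 h3
  rw [transMetric_symm] at h3
  rw [koszul_apply]
  linarith

@[simp]
theorem proj_transConn (F : Foliation N p M) (g : Metric N M) (x : M) (u v : Coord N) :
    proj F g x (transConn F g x u v) = transConn F g x u v := by
  simp [transConn]

theorem transMetric_transConn (hg : IsBundleLike F g) (x : M) (u v w : Coord N) :
    transMetric F g x (transConn F g x u v) w =
      koszul (coordBilin x (transMetric F g)) (extChartAt (𝓡 N) x x) u v w := by
  have h := transMetric_cometric F g x
    (koszul (coordBilin x (transMetric F g)) (extChartAt (𝓡 N) x x) u v) w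
  have h2 := koszul_tangent_right hg x u v (sub_proj_mem_tangent F g x w)
  rw [map_sub, sub_eq_zero] at h2
  rw [h2]
  exact h

/-- The vertical fields are parallel in the normal bundle. -/
theorem proj_fderiv_tangent {W : M → Coord N} (hg : IsBundleLike F g) (hW : IsSmoothField W)
    (hWt : ∀ y, W y ∈ F.tangent y) (x : M) (u : Coord N) :
    proj F g x (fderiv ℝ (coordVec x W) (extChartAt (𝓡 N) x x) u) = -transConn F g x u (W x) := by
  have h := proj_eq_zero_of_transMetric F g x
    (u := fderiv ℝ (coordVec x W) (extChartAt (𝓡 N) x x) u + transConn F g x u (W x)) (fun v => by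
      rw [map_add, _root_.add_apply, transMetric_transConn hg, koszul_tangent_middle hg hW hWt]
      ring)
  rw [map_add, proj_transConn] at h
  exact eq_neg_of_add_eq_zero_left h

/-- The derivative of the projection at the base point of the chart. -/
def projDeriv (F : Foliation N p M) (g : Metric N M) (x : M) (u : Coord N) :
    Coord N →L[ℝ] Coord N :=
  fderiv ℝ (coordEnd x (proj F g)) (extChartAt (𝓡 N) x x) u

/-- Differentiate `π W = 0` for a leafwise extension `W` of `w` and insert `proj_fderiv_tangent`. -/
theorem projDeriv_tangent (hg : IsBundleLike F g) (x : M) (u : Coord N) {w : Coord N}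
    (hw : w ∈ F.tangent x) : projDeriv F g x u w = transConn F g x u w := by
  obtain ⟨W, hW, hWt, rfl⟩ := F.smooth x w hw
  have hf := (differentiableAt_coordEnd_proj F g x).hasFDerivAt.clm_apply
    (hW.differentiableAt x).hasFDerivAt
  have h0 : (fun y => coordEnd x (proj F g) y (coordVec x W y))
      =ᶠ[𝓝 (extChartAt (𝓡 N) x x)] fun _ => (0 : Coord N) := by
    filter_upwards [target_mem_nhds (base_mem_target (N := N) x)] with y hy
    rw [coordEnd_apply, coordVec, chartSymmDeriv_chartDeriv hy, proj_of_mem_tangent F g _ (hWt _),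
      map_zero]
  have h1 := (hf.congr_of_eventuallyEq h0.symm).unique (hasFDerivAt_const 0 _)
  have h2 := DFunLike.congr_fun h1 u
  simp only [_root_.add_apply, ContinuousLinearMap.comp_apply, ContinuousLinearMap.flip_apply,
    coordVec_base, coordEnd_base, _root_.zero_apply] at h2
  rw [proj_fderiv_tangent hg hW hWt] at h2
  rw [projDeriv]
  rwa [neg_add_eq_zero, eq_comm] at h2

/-- The derivative of `π² = π`. -/
theorem proj_projDeriv_add (F : Foliation N p M) (g : Metric N M) (x : M) (u v : Coord N) :
    proj F g x (projDeriv F g x u v) + projDeriv F g x u (proj F g x v) = projDeriv F g x u v := by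
  have hP := (differentiableAt_coordEnd_proj F g x).hasFDerivAt
  have hf := hP.clm_apply (hP.clm_apply (hasFDerivAt_const v _))
  have h0 : (fun y => coordEnd x (proj F g) y (coordEnd x (proj F g) y v))
      =ᶠ[𝓝 (extChartAt (𝓡 N) x x)] fun y => coordEnd x (proj F g) y v := by
    filter_upwards [target_mem_nhds (base_mem_target (N := N) x)] with y hy
    simp only [coordEnd_apply, chartSymmDeriv_chartDeriv hy, proj_proj]
  have h1 := (hf.congr_of_eventuallyEq h0.symm).unique (hP.clm_apply (hasFDerivAt_const v _))
  have h2 := DFunLike.congr_fun h1 u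
  simp only [_root_.add_apply, ContinuousLinearMap.comp_apply, ContinuousLinearMap.flip_apply,
    coordEnd_base, zero_add, ContinuousLinearMap.comp_zero] at h2
  exact h2

@[simp]
theorem proj_projDeriv_proj (F : Foliation N p M) (g : Metric N M) (x : M) (u v : Coord N) :
    proj F g x (projDeriv F g x u (proj F g x v)) = 0 := by
  have h := congrArg (proj F g x) (proj_projDeriv_add F g x u v)
  rw [map_add, proj_proj] at h
  simpa using h

/-- The Christoffel symbols of a connection on `TM` that preserves the leaves and induces `∇` on the
normal bundle. -/
def adaptedConn (F : Foliation N p M) (g : Metric N M) (x : M) (u : Coord N) :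
    Coord N →L[ℝ] Coord N :=
  transConn F g x u - projDeriv F g x u ∘L proj F g x

theorem adaptedConn_apply (F : Foliation N p M) (g : Metric N M) (x : M) (u v : Coord N) :
    adaptedConn F g x u v = transConn F g x u v - projDeriv F g x u (proj F g x v) := rfl

@[simp]
theorem proj_adaptedConn (F : Foliation N p M) (g : Metric N M) (x : M) (u v : Coord N) :
    proj F g x (adaptedConn F g x u v) = transConn F g x u v := by
  simp [adaptedConn_apply]

/-- The projection is parallel for the adapted connection: its coordinate derivative is the
commutator with the Christoffel symbols. -/
theorem projDeriv_eq (hg : IsBundleLike F g) (x : M) (u v : Coord N) :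
    projDeriv F g x u v =
      proj F g x (adaptedConn F g x u v) - adaptedConn F g x u (proj F g x v) := by
  rw [proj_adaptedConn, adaptedConn_apply, proj_proj]
  have h := projDeriv_tangent hg x u (sub_proj_mem_tangent F g x v)
  rw [map_sub, map_sub] at h
  rw [eq_add_of_sub_eq h]
  abel

/-- The transverse metric is parallel: in the sum of the Koszul expressions for `(u, v, w)` and `(u,
w, v)` all but the `u`-derivatives cancel. -/
theorem fderiv_transMetric_eq (hg : IsBundleLike F g) (x : M) (u v w : Coord N) :
    fderiv ℝ (coordBilin x (transMetric F g)) (extChartAt (𝓡 N) x x) u v w =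
      transMetric F g x (adaptedConn F g x u v) w + transMetric F g x v (adaptedConn F g x u w) := by
  have h1 : ∀ v w, transMetric F g x (adaptedConn F g x u v) w =
      koszul (coordBilin x (transMetric F g)) (extChartAt (𝓡 N) x x) u v w := fun v w => by
    rw [← transMetric_proj_left, proj_adaptedConn, transMetric_transConn hg]
  rw [transMetric_symm F g x v, h1, h1, koszul_apply, koszul_apply,
    fderiv_transMetric_symm x u w v]
  ring

/-- The cometric is parallel, as the inverse of a parallel metric on a parallel subbundle. The
defect `X` has no vertical part, by differentiating `π A = A` (`e1`), and no normal part, by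
differentiating `g_Q(Aξ, w) = ξ(π w)` (`e2`). -/
theorem fderiv_coordCometric_eq (hg : IsBundleLike F g) (x : M) (u : Coord N)
    (ξ : Coord N →L[ℝ] ℝ) :
    fderiv ℝ (coordCometric F g x) (extChartAt (𝓡 N) x x) u ξ =
      -adaptedConn F g x u (cometric F g x ξ) - cometric F g x (ξ ∘L adaptedConn F g x u) := by
  have hA := (differentiableAt_coordCometric F g x).hasFDerivAt
  have hP := (differentiableAt_coordEnd_proj F g x).hasFDerivAt
  have hB := (differentiableAt_coordBilin_transMetric F g x).hasFDerivAt
  set D := fderiv ℝ (coordCometric F g x) (extChartAt (𝓡 N) x x) u ξ with hD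
  have e1 : projDeriv F g x u (cometric F g x ξ) + proj F g x D = D := by
    have hf := hP.clm_apply (hA.clm_apply (hasFDerivAt_const ξ _))
    have h0 : (fun y => coordEnd x (proj F g) y (coordCometric F g x y ξ))
        =ᶠ[𝓝 (extChartAt (𝓡 N) x x)] fun y => coordCometric F g x y ξ := by
      filter_upwards [target_mem_nhds (base_mem_target (N := N) x)] with y hy
      simp only [coordEnd_apply, coordCometric_apply F g hy, chartSymmDeriv_chartDeriv hy,
        proj_cometric]
    have h1 := (hf.congr_of_eventuallyEq h0.symm).unique (hA.clm_apply (hasFDerivAt_const ξ _))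
    have h2 := DFunLike.congr_fun h1 u
    simp only [_root_.add_apply, ContinuousLinearMap.comp_apply, ContinuousLinearMap.flip_apply,
      coordEnd_base, coordCometric_base, zero_add,
      ContinuousLinearMap.comp_zero] at h2
    rw [← hD] at h2
    rw [add_comm]
    exact h2
  have e2 : ∀ w, fderiv ℝ (coordBilin x (transMetric F g)) (extChartAt (𝓡 N) x x) u
      (cometric F g x ξ) w + transMetric F g x D w = ξ (projDeriv F g x u w) := fun w => by
    have hf := (hB.clm_apply (hA.clm_apply (hasFDerivAt_const ξ _))).clm_apply
      (hasFDerivAt_const w _)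
    have h0 : (fun y => coordBilin x (transMetric F g) y (coordCometric F g x y ξ) w)
        =ᶠ[𝓝 (extChartAt (𝓡 N) x x)] fun y => ξ (coordEnd x (proj F g) y w) := by
      filter_upwards [target_mem_nhds (base_mem_target (N := N) x)] with y hy
      simp only [coordBilin_apply, coordCometric_apply F g hy, chartSymmDeriv_chartDeriv hy,
        transMetric_cometric, coordEnd_apply, ContinuousLinearMap.comp_apply]
    have h1 := (hf.congr_of_eventuallyEq h0.symm).unique
      ((hasFDerivAt_const ξ _).clm_apply (hP.clm_apply (hasFDerivAt_const w _)))
    have h2 := DFunLike.congr_fun h1 u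
    simp only [_root_.add_apply, ContinuousLinearMap.comp_apply, ContinuousLinearMap.flip_apply,
      coordBilin_base, coordCometric_base, _root_.zero_apply, zero_add, add_zero,
      ContinuousLinearMap.comp_zero] at h2
    rw [← hD] at h2
    rw [add_comm]
    exact h2
  set X := D + adaptedConn F g x u (cometric F g x ξ) +
    cometric F g x (ξ ∘L adaptedConn F g x u) with hX
  have hPX : proj F g x X = 0 := by
    refine proj_eq_zero_of_transMetric F g x fun w => ?_
    have e3 := e2 w
    rw [fderiv_transMetric_eq hg, transMetric_cometric, projDeriv_eq hg, map_sub,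
      ] at e3
    rw [hX, map_add, map_add, _root_.add_apply, _root_.add_apply, transMetric_cometric]
    simp only [ContinuousLinearMap.comp_apply]
    linarith
  have hXX : X = 0 := by
    have e4 : X - proj F g x X = 0 := by
      rw [hX, map_add, map_add, proj_adaptedConn, proj_cometric, adaptedConn_apply, proj_cometric]
      nth_rw 1 [← e1]
      abel
    rwa [hPX, sub_zero] at e4
  rw [hX] at hXX
  rw [eq_sub_iff_add_eq, eq_neg_iff_add_eq_zero, ← hXX]
  abel

end Infinitesimal

/-! ### The transverse complex structure is parallel -/

section AlmostComplex

variable {N p : ℕ} {M : Type*} [TopologicalSpace M] [ChartedSpace (Coord N) M]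
  [IsManifold (𝓡 N) ∞ M] [T2Space M] {F : Foliation N p M} {g : Metric N M}
  {J : M → Coord N →L[ℝ] Coord N}

theorem IsTransverseKahler.proj_J (hJ : IsTransverseKahler F g J) (x : M) (v : Coord N) :
    proj F g x (J x v) = J x v := proj_of_mem_normal F g x (hJ.map_mem_normal x v)

theorem IsTransverseKahler.J_proj (hJ : IsTransverseKahler F g J) (x : M) (v : Coord N) :
    J x (proj F g x v) = J x v := by
  have := hJ.map_tangent x _ (sub_proj_mem_tangent F g x v)
  rw [map_sub, sub_eq_zero] at this
  exact this.symm

theorem IsTransverseKahler.differentiableAt_coordEnd (hJ : IsTransverseKahler F g J) (x : M) :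
    DifferentiableAt ℝ (coordEnd x J) (extChartAt (𝓡 N) x x) :=
  ((hJ.smooth x).contDiffAt (target_mem_nhds (base_mem_target x))).differentiableAt (by simp)

/-- The hypothesis `parallel` controls only the normal component of the derivative of `J`; the
vertical component comes from differentiating `π J = J`. -/
theorem IsTransverseKahler.fderiv_coordEnd_eq (hJ : IsTransverseKahler F g J) (x : M)
    (u v : Coord N) :
    fderiv ℝ (coordEnd x J) (extChartAt (𝓡 N) x x) u v =
      J x (adaptedConn F g x u v) - adaptedConn F g x u (J x v) := by
  have hP := (differentiableAt_coordEnd_proj F g x).hasFDerivAt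
  have hJd := (hJ.differentiableAt_coordEnd x).hasFDerivAt
  set D := fderiv ℝ (coordEnd x J) (extChartAt (𝓡 N) x x) u v with hD
  have e1 : projDeriv F g x u (J x v) + proj F g x D = D := by
    have hf := hP.clm_apply (hJd.clm_apply (hasFDerivAt_const v _))
    have h0 : (fun y => coordEnd x (proj F g) y (coordEnd x J y v))
        =ᶠ[𝓝 (extChartAt (𝓡 N) x x)] fun y => coordEnd x J y v := by
      filter_upwards [target_mem_nhds (base_mem_target (N := N) x)] with y hy
      simp only [coordEnd_apply, chartSymmDeriv_chartDeriv hy, hJ.proj_J]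
    have h1 := (hf.congr_of_eventuallyEq h0.symm).unique (hJd.clm_apply (hasFDerivAt_const v _))
    have h2 := DFunLike.congr_fun h1 u
    simp only [_root_.add_apply, ContinuousLinearMap.comp_apply, ContinuousLinearMap.flip_apply,
      coordEnd_base, zero_add,
      ContinuousLinearMap.comp_zero] at h2
    rw [← hD] at h2
    rw [add_comm]
    exact h2
  have e2 := hJ.parallel x u v
  rw [← hD] at e2
  have e3 : J x (adaptedConn F g x u v) = J x (transConn F g x u v) := by
    rw [← hJ.J_proj, proj_adaptedConn]
  rw [e3, adaptedConn_apply, hJ.proj_J, ← e1, ← sub_eq_zero, ← e2]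
  abel

end AlmostComplex

/-! ### Horizontal forms, derivations and interior products at a point -/

section PointwiseForms

variable {N k : ℕ}

/-- The form `α` vanishes as soon as one of its arguments lies in `K`. -/
def VanishesOn (K : Submodule ℝ (Coord N)) (α : Coord N [⋀^Fin k]→L[ℝ] ℂ) : Prop :=
  ∀ w : Fin k → Coord N, (∃ i, w i ∈ K) → α w = 0

theorem derivationAct_apply (A : Coord N →L[ℝ] Coord N) (α : Coord N [⋀^Fin k]→L[ℝ] ℂ)
    (v : Fin k → Coord N) :
    derivationAct A α v = ∑ j, α (Function.update v j (A (v j))) :=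
  sum_update_comp_apply A α v

theorem derivationAct_eq (A : Coord N →L[ℝ] Coord N) (α : Coord N [⋀^Fin k]→L[ℝ] ℂ) :
    derivationAct A α =
      α.fderivCompContinuousLinearMap (ContinuousLinearMap.id ℝ (Coord N)) A := by
  ext v
  rw [derivationAct_apply, ContinuousAlternatingMap.fderivCompContinuousLinearMap_apply]
  refine Finset.sum_congr rfl fun j _ => congrArg α (funext fun i => ?_)
  rcases eq_or_ne i j with rfl | h
  · simp
  · simp [h]

theorem derivationAct_sum {ι : Type*} (s : Finset ι) (A : Coord N →L[ℝ] Coord N)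
    (α : ι → Coord N [⋀^Fin k]→L[ℝ] ℂ) :
    derivationAct A (∑ i ∈ s, α i) = ∑ i ∈ s, derivationAct A (α i) := by
  ext v
  simp only [derivationAct_apply, ContinuousAlternatingMap.sum_apply]
  rw [Finset.sum_comm]

theorem derivationAct_zero_degree (A : Coord N →L[ℝ] Coord N) (α : Coord N [⋀^Fin 0]→L[ℝ] ℂ) :
    derivationAct A α = 0 := by
  ext v
  simp [derivationAct_apply]

theorem derivationAct_curryLeft (A : Coord N →L[ℝ] Coord N)
    (α : Coord N [⋀^Fin (k + 1)]→L[ℝ] ℂ) (v : Coord N) :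
    (derivationAct A α).curryLeft v = derivationAct A (α.curryLeft v) + α.curryLeft (A v) := by
  ext w
  rw [ContinuousAlternatingMap.curryLeft_apply_apply, derivationAct_apply, Fin.sum_univ_succ,
    ContinuousAlternatingMap.add_apply, derivationAct_apply, add_comm]
  congr 1
  · refine Finset.sum_congr rfl fun i _ => ?_
    rw [ContinuousAlternatingMap.curryLeft_apply_apply]
    congr 1
    exact (Fin.cons_update _ _ _ _).symm
  · rw [ContinuousAlternatingMap.curryLeft_apply_apply]
    congr 1
    funext i
    refine Fin.cases ?_ (fun i => ?_) i <;> simp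

theorem VanishesOn.curryLeft {K : Submodule ℝ (Coord N)} {α : Coord N [⋀^Fin (k + 1)]→L[ℝ] ℂ}
    (h : VanishesOn K α) (v : Coord N) : VanishesOn K (α.curryLeft v) := by
  rintro w ⟨i, hi⟩
  exact h _ ⟨i.succ, hi⟩

theorem VanishesOn.curryLeft_eq_zero {K : Submodule ℝ (Coord N)}
    {α : Coord N [⋀^Fin (k + 1)]→L[ℝ] ℂ} (h : VanishesOn K α) {v : Coord N} (hv : v ∈ K) :
    α.curryLeft v = 0 := by
  ext w
  exact h _ ⟨0, hv⟩

theorem VanishesOn.real_smul {K : Submodule ℝ (Coord N)} {α : Coord N [⋀^Fin k]→L[ℝ] ℂ}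
    (hα : VanishesOn K α) (c : ℝ) : VanishesOn K (c • α) := fun w hw => by
  rw [ContinuousAlternatingMap.smul_apply, hα w hw, smul_zero]

theorem VanishesOn.sum {ι : Type*} {s : Finset ι} {K : Submodule ℝ (Coord N)}
    {α : ι → Coord N [⋀^Fin k]→L[ℝ] ℂ} (hα : ∀ i, VanishesOn K (α i)) :
    VanishesOn K (∑ i ∈ s, α i) := fun w hw => by
  rw [ContinuousAlternatingMap.sum_apply]
  exact Finset.sum_eq_zero fun i _ => hα i w hw

/-- In each summand of the alternation the vector of `K` is either the argument of `L` or one of the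
arguments of the resulting form. -/
theorem VanishesOn.alternatize {K : Submodule ℝ (Coord N)}
    {L : Coord N →L[ℝ] Coord N [⋀^Fin k]→L[ℝ] ℂ} (hL : ∀ u, VanishesOn K (L u))
    (hK : ∀ u ∈ K, L u = 0) :
    VanishesOn K (ContinuousAlternatingMap.alternatizeUncurryFin L) := by
  rintro w ⟨i, hi⟩
  rw [ContinuousAlternatingMap.alternatizeUncurryFin_apply]
  refine Finset.sum_eq_zero fun j _ => ?_
  rcases eq_or_ne i j with rfl | h
  · rw [hK _ hi]
    exact smul_zero _
  · obtain ⟨l, rfl⟩ := Fin.exists_succAbove_eq h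
    rw [hL _ _ ⟨l, hi⟩, smul_zero]

/-- `v ⌟ Alt L = L_v - Alt (v ⌟ L)`. -/
theorem alternatize_curryLeft (L : Coord N →L[ℝ] Coord N [⋀^Fin (k + 1)]→L[ℝ] ℂ) (v : Coord N) :
    (ContinuousAlternatingMap.alternatizeUncurryFin L).curryLeft v =
      L v - ContinuousAlternatingMap.alternatizeUncurryFin
        ((ContinuousAlternatingMap.curryLeftLI.toContinuousLinearMap ∘L L).flip v) := by
  ext w
  rw [ContinuousAlternatingMap.curryLeft_apply_apply,
    ContinuousAlternatingMap.alternatizeUncurryFin_apply, Fin.sum_univ_succ, ContinuousAlternatingMap.sub_apply,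
    ContinuousAlternatingMap.alternatizeUncurryFin_apply, sub_eq_add_neg, ← Finset.sum_neg_distrib]
  congr 1
  · simp [Fin.removeNth_zero]
  · refine Finset.sum_congr rfl fun i _ => ?_
    have h : i.succ.removeNth (Matrix.vecCons v w) = Matrix.vecCons v (i.removeNth w) := by
      funext j
      refine Fin.cases ?_ (fun j => ?_) j
      · simp [Fin.removeNth]
      · simp [Fin.removeNth]
    rw [h]
    simp [pow_succ]

theorem alternatize_curryLeft_zero (L : Coord N →L[ℝ] Coord N [⋀^Fin 0]→L[ℝ] ℂ) (v : Coord N) :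
    (ContinuousAlternatingMap.alternatizeUncurryFin L).curryLeft v = L v := by
  ext w
  rw [ContinuousAlternatingMap.curryLeft_apply_apply,
    ContinuousAlternatingMap.alternatizeUncurryFin_apply, Fin.sum_univ_succ]
  simp [Fin.removeNth_zero]

theorem form_ext_curryLeft {V : Type*} [NormedAddCommGroup V] [NormedSpace ℝ V]
    {α β : Coord N [⋀^Fin (k + 1)]→L[ℝ] V}
    (h : ∀ v, α.curryLeft v = β.curryLeft v) : α = β := by
  ext w
  have := DFunLike.congr_fun (h (w 0)) (Matrix.vecTail w)
  rw [ContinuousAlternatingMap.curryLeft_apply_apply,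
    ContinuousAlternatingMap.curryLeft_apply_apply] at this
  have hw : Matrix.vecCons (w 0) (Matrix.vecTail w) = w := Matrix.cons_head_tail w
  rwa [hw] at this

end PointwiseForms

/-! ### The transverse covariant derivative and basic forms -/

section CovariantDerivative

variable {N p k : ℕ} {M : Type*} [TopologicalSpace M] [ChartedSpace (Coord N) M]
  [IsManifold (𝓡 N) ∞ M] [T2Space M] {F : Foliation N p M} {g : Metric N M}

/-- The Christoffel symbols of the transverse connection as a bilinear map. -/
def transConnL (F : Foliation N p M) (g : Metric N M) (x : M) :
    Coord N →L[ℝ] Coord N →L[ℝ] Coord N :=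
  LinearMap.toContinuousLinearMap
    { toFun := transConn F g x
      map_add' := fun u v => by
        ext1 w
        rw [transConn_symm, map_add, _root_.add_apply, transConn_symm F g x u,
          transConn_symm F g x v]
      map_smul' := fun c u => by
        ext1 w
        rw [transConn_symm, map_smul, smul_apply, transConn_symm F g x u]
        rfl }

/-- The covariant derivative at `x` as a linear map. -/
def covDerivL (F : Foliation N p M) (g : Metric N M) (φ : Form N M ℂ k) (x : M) :
    Coord N →L[ℝ] Coord N [⋀^Fin k]→L[ℝ] ℂ :=
  fderiv ℝ (coordForm x φ) (extChartAt (𝓡 N) x x) -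
    (φ x).fderivCompContinuousLinearMap (ContinuousLinearMap.id ℝ (Coord N)) ∘L transConnL F g x

@[simp]
theorem covDerivL_apply (F : Foliation N p M) (g : Metric N M) (φ : Form N M ℂ k) (x : M)
    (u : Coord N) : covDerivL F g φ x u = covDeriv F g φ x u := by
  rw [covDeriv, derivationAct_eq]
  rfl

/-- The transverse connection is torsion-free. -/
theorem extD_eq_alternatize (F : Foliation N p M) (g : Metric N M) (φ : Form N M ℂ k) (x : M) :
    extD φ x = ContinuousAlternatingMap.alternatizeUncurryFin (covDerivL F g φ x) := by
  have h := ContinuousAlternatingMap.alternatizeUncurryFin_fderivCompContinuousLinearMap_eq_zero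
    (φ x) (ContinuousLinearMap.id ℝ (Coord N)) (h := transConnL F g x)
    (fun u v => transConn_symm F g x u v)
  rw [covDerivL, ← ContinuousAlternatingMap.alternatizeUncurryFinCLM_apply, map_sub,
    ContinuousAlternatingMap.alternatizeUncurryFinCLM_apply,
    ContinuousAlternatingMap.alternatizeUncurryFinCLM_apply, h, sub_zero]
  rfl

theorem VanishesOn.map_update_eq {x : M} {α : Coord N [⋀^Fin k]→L[ℝ] ℂ}
    (h : VanishesOn (F.tangent x) α) (w : Fin k → Coord N) (i : Fin k) {a b : Coord N}
    (hab : proj F g x a = proj F g x b) :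
    α (Function.update w i a) = α (Function.update w i b) := by
  rw [← sub_eq_zero, ← ContinuousAlternatingMap.map_update_sub]
  refine h _ ⟨i, ?_⟩
  rw [Function.update_self, ← proj_eq_zero_iff F g, map_sub, hab, sub_self]

/-- Horizontal forms see only normal components, and there the two families of Christoffel symbols
agree. Hence `∇` on horizontal forms may be computed with `adaptedConn`, for which all structure
tensors are parallel. -/
theorem derivationAct_transConn {x : M} {α : Coord N [⋀^Fin k]→L[ℝ] ℂ}
    (h : VanishesOn (F.tangent x) α) (u : Coord N) :
    derivationAct (transConn F g x u) α = derivationAct (adaptedConn F g x u) α := by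
  ext w
  rw [derivationAct_apply, derivationAct_apply]
  refine Finset.sum_congr rfl fun i _ => h.map_update_eq (g := g) w i ?_
  rw [proj_transConn, proj_adaptedConn]

theorem covDeriv_eq {φ : Form N M ℂ k} {x : M} (h : VanishesOn (F.tangent x) (φ x)) (u : Coord N) :
    covDeriv F g φ x u = fderiv ℝ (coordForm x φ) (extChartAt (𝓡 N) x x) u -
      derivationAct (adaptedConn F g x u) (φ x) := by
  rw [covDeriv, derivationAct_transConn h]

/-- Differentiate `φ(…, W, …) = 0` with a leafwise field `W` in slot `i`. Modulo the leaves the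
derivative of `W` is minus its Christoffel term, which is exactly the correction in `∇_u φ`. -/
theorem covDeriv_vanishesOn (hg : IsBundleLike F g) {φ : Form N M ℂ k} (hφ : IsSmoothForm φ)
    (h : ∀ x, VanishesOn (F.tangent x) (φ x)) (x : M) (u : Coord N) :
    VanishesOn (F.tangent x) (covDeriv F g φ x u) := by
  rintro w ⟨i, hi⟩
  obtain ⟨W, hW, hWt, hWx⟩ := F.smooth x _ hi
  have hd : ∀ j, DifferentiableAt ℝ (fun y => Function.update (fun j _ => w j) i (coordVec x W) j y)
      (extChartAt (𝓡 N) x x) := fun j => by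
    rcases eq_or_ne j i with rfl | hj
    · simpa using hW.differentiableAt x
    · simp [hj]
  have hf := fderiv_continuousAlternatingMap_apply_apply
    (hφ.differentiableAt (base_mem_target x)) hd u
  have h0 : (fun y => coordForm x φ y
      fun j => Function.update (fun j _ => w j) i (coordVec x W) j y)
      =ᶠ[𝓝 (extChartAt (𝓡 N) x x)] fun _ => (0 : ℂ) := by
    filter_upwards [target_mem_nhds (base_mem_target (N := N) x)] with y hy
    rw [coordForm_apply]
    refine h _ _ ⟨i, ?_⟩
    simp only [Function.update_self, coordVec, chartSymmDeriv_chartDeriv hy]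
    exact hWt _
  have hw : (fun j => Function.update (fun j (_ : Coord N) => w j) i (coordVec x W) j
      (extChartAt (𝓡 N) x x)) = w := by
    funext j
    rcases eq_or_ne j i with rfl | hj
    · rw [Function.update_self, coordVec_base, hWx]
    · rw [Function.update_of_ne hj]
  rw [h0.fderiv_eq, fderiv_fun_const, hw, coordForm_base] at hf
  -- Updating any other slot leaves the vertical vector in slot `i`, so only the summand `j = i`
  -- survives.
  have hsum : ∀ A : Fin k → Coord N, ∑ j, φ x (Function.update w j (A j)) =
      φ x (Function.update w i (A i)) := fun A => by
    refine Finset.sum_eq_single i (fun j _ hj => h x _ ⟨i, ?_⟩) (by simp)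
    rwa [Function.update_of_ne hj.symm]
  rw [hsum (fun j => fderiv ℝ (Function.update (fun j _ => w j) i (coordVec x W) j)
    (extChartAt (𝓡 N) x x) u), Function.update_self] at hf
  rw [covDeriv, ContinuousAlternatingMap.sub_apply, derivationAct_apply, hsum, ← hWx]
  have h1 := (h x).map_update_eq (g := g) w i (a := fderiv ℝ (coordVec x W)
    (extChartAt (𝓡 N) x x) u) (b := -transConn F g x u (W x)) (by
      rw [proj_fderiv_tangent hg hW hWt, map_neg, proj_transConn])
  have h2 : φ x (Function.update w i (-transConn F g x u (W x))) =
      -φ x (Function.update w i (transConn F g x u (W x))) :=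
    (φ x).toMultilinearMap.map_update_neg w i _
  rw [h1, h2, ← sub_eq_add_neg] at hf
  exact hf.symm

/-- In `v ⌟ Alt ∇φ` every term other than `∇_v φ` has `v` as an argument of some `∇_u φ`, and these
are horizontal. A horizontal form is therefore basic exactly when it is parallel along the leaves,
the criterion used to show that operators preserve basic forms. -/
theorem covDeriv_tangent (hg : IsBundleLike F g) {φ : Form N M ℂ k} (hφ : IsSmoothForm φ)
    (h : ∀ x, VanishesOn (F.tangent x) (φ x)) {x : M} {v : Coord N} (hv : v ∈ F.tangent x) :
    covDeriv F g φ x v = (extD φ x).curryLeft v := by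
  rw [extD_eq_alternatize F g]
  cases k with
  | zero => rw [alternatize_curryLeft_zero, covDerivL_apply]
  | succ k =>
    rw [alternatize_curryLeft, covDerivL_apply]
    have : (ContinuousAlternatingMap.curryLeftLI.toContinuousLinearMap ∘L
        covDerivL F g φ x).flip v = 0 := by
      ext1 u
      have h1 := (covDeriv_vanishesOn hg hφ h x u).curryLeft_eq_zero hv
      rw [← covDerivL_apply] at h1
      exact h1
    rw [this, ← ContinuousAlternatingMap.alternatizeUncurryFinCLM_apply, map_zero, sub_zero]

theorem IsBasic.vanishesOn {φ : Form N M ℂ k} (hφ : IsBasic F φ) (x : M) :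
    VanishesOn (F.tangent x) (φ x) := hφ.horizontal x

theorem IsBasic.covDeriv_eq_zero (hg : IsBundleLike F g) {φ : Form N M ℂ k} (hφ : IsBasic F φ)
    {x : M} {v : Coord N} (hv : v ∈ F.tangent x) : covDeriv F g φ x v = 0 := by
  rw [covDeriv_tangent hg hφ.smooth hφ.vanishesOn hv]
  ext w
  exact hφ.horizontal_extD x _ ⟨0, hv⟩

theorem IsBasic.covDeriv_vanishesOn (hg : IsBundleLike F g) {φ : Form N M ℂ k} (hφ : IsBasic F φ)
    (x : M) (u : Coord N) : VanishesOn (F.tangent x) (covDeriv F g φ x u) :=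
  TransverseKahler.covDeriv_vanishesOn hg hφ.smooth hφ.vanishesOn x u

theorem isBasic_of_covDeriv (hg : IsBundleLike F g) {φ : Form N M ℂ k} (hφ : IsSmoothForm φ)
    (h : ∀ x, VanishesOn (F.tangent x) (φ x))
    (h' : ∀ x, ∀ v ∈ F.tangent x, covDeriv F g φ x v = 0) : IsBasic F φ where
  smooth := hφ
  horizontal := h
  horizontal_extD := fun x => by
    rw [extD_eq_alternatize F g]
    exact VanishesOn.alternatize
      (fun u => by rw [covDerivL_apply]; exact covDeriv_vanishesOn hg hφ h x u)
      (fun u hu => by rw [covDerivL_apply, h' x u hu])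

theorem IsBasic.extD {φ : Form N M ℂ k} (hφ : IsBasic F φ) : IsBasic F (extD φ) where
  smooth := hφ.smooth.extD
  horizontal := hφ.horizontal_extD
  horizontal_extD := fun x w _ => by rw [extD_extD hφ.smooth]; rfl

end CovariantDerivative

/-! ### Traces, the Hermitian pairing of forms, and their derivatives -/

section Frames

variable {N k : ℕ} {V : Type*} [NormedAddCommGroup V] [NormedSpace ℝ V]

/-- The standard basis of `ℝᴺ`. -/
def stdVec (i : Fin N) : Coord N := EuclideanSpace.single i 1

/-- The standard basis of the dual of `ℝᴺ`. -/
def stdCovec (i : Fin N) : Coord N →L[ℝ] ℝ := EuclideanSpace.proj i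

theorem stdCovec_apply (i : Fin N) (v : Coord N) : stdCovec i v = v i := rfl

theorem sum_stdCovec_smul (v : Coord N) : ∑ i, stdCovec i v • stdVec i = v := by
  ext j
  simp only [stdVec, WithLp.ofLp_sum, WithLp.ofLp_smul, Finset.sum_apply, Pi.smul_apply,
    stdCovec_apply, PiLp.single_apply, smul_eq_mul]
  simp

theorem sum_smul_stdCovec (ξ : Coord N →L[ℝ] ℝ) : ∑ i, ξ (stdVec i) • stdCovec i = ξ := by
  ext v
  conv_rhs => rw [← sum_stdCovec_smul v, map_sum]
  rw [_root_.sum_apply]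
  exact Finset.sum_congr rfl fun i _ => by simp [mul_comm]

/-- Cyclicity of the trace: an endomorphism may be moved from the dual basis to the basis.
Coordinate invariance of contractions and the cancellation of Christoffel terms both reduce to it.
-/
theorem sum_stdCovec_comp (f : (Coord N →L[ℝ] ℝ) →ₗ[ℝ] Coord N →ₗ[ℝ] V)
    (T : Coord N →L[ℝ] Coord N) :
    ∑ i, f (stdCovec i ∘L T) (stdVec i) = ∑ i, f (stdCovec i) (T (stdVec i)) := by
  have h1 : ∀ i, f (stdCovec i ∘L T) (stdVec i) =
      ∑ j, stdCovec i (T (stdVec j)) • f (stdCovec j) (stdVec i) := fun i => by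
    conv_lhs => rw [← sum_smul_stdCovec (stdCovec i ∘L T), map_sum, LinearMap.sum_apply]
    simp
  have h2 : ∀ j, f (stdCovec j) (T (stdVec j)) =
      ∑ i, stdCovec i (T (stdVec j)) • f (stdCovec j) (stdVec i) := fun j => by
    conv_lhs => rw [← sum_stdCovec_smul (T (stdVec j)), map_sum]
    simp
  simp only [h1, h2]
  exact Finset.sum_comm

/-- The contraction `∑ i, B (A eⁱ, e_i)` of a bilinear map. -/
def traceWith (A : (Coord N →L[ℝ] ℝ) →L[ℝ] Coord N) (B : Coord N →ₗ[ℝ] Coord N →ₗ[ℝ] V) : V :=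
  ∑ i, B (A (stdCovec i)) (stdVec i)

theorem traceWith_comp (A : (Coord N →L[ℝ] ℝ) →L[ℝ] Coord N) (B : Coord N →ₗ[ℝ] Coord N →ₗ[ℝ] V)
    (T : Coord N →L[ℝ] Coord N) :
    ∑ i, B (A (stdCovec i ∘L T)) (stdVec i) = ∑ i, B (A (stdCovec i)) (T (stdVec i)) :=
  sum_stdCovec_comp (B ∘ₗ (A : (Coord N →L[ℝ] ℝ) →ₗ[ℝ] Coord N)) T

theorem traceWith_pullback {A A' : (Coord N →L[ℝ] ℝ) →L[ℝ] Coord N} {S : Coord N →L[ℝ] Coord N}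
    (hA : ∀ ξ, A' ξ = S (A (ξ ∘L S))) (B : Coord N →ₗ[ℝ] Coord N →ₗ[ℝ] V) :
    traceWith A' B = ∑ i, B (S (A (stdCovec i))) (S (stdVec i)) := by
  simp only [traceWith, hA]
  exact traceWith_comp (S ∘L A) B S

/-- The interior product as a linear map in both arguments. -/
def curryLeftₗ : Coord N →ₗ[ℝ] (Coord N [⋀^Fin (k + 1)]→L[ℝ] V) →ₗ[ℝ]
    (Coord N [⋀^Fin k]→L[ℝ] V) :=
  LinearMap.mk₂ ℝ (fun v α => α.curryLeft v) (fun _ _ α => map_add α.curryLeft _ _)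
    (fun _ _ α => map_smul α.curryLeft _ _) (fun _ _ _ => rfl) (fun _ _ _ => rfl)

/-- The pairing of two forms that is induced by the cometric `A`; it is conjugate linear in the
first form. -/
def pairing (A : (Coord N →L[ℝ] ℝ) →L[ℝ] Coord N) :
    ∀ k : ℕ, (Coord N [⋀^Fin k]→L[ℝ] ℂ) →ₗ[ℝ] (Coord N [⋀^Fin k]→L[ℝ] ℂ) →ₗ[ℝ] ℂ
  | 0 => LinearMap.mk₂ ℝ (fun α β => (starRingEnd ℂ) (α ![]) * β ![])
      (fun α α' β => by rw [ContinuousAlternatingMap.add_apply, map_add, add_mul])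
      (fun c α β => by
        rw [ContinuousAlternatingMap.smul_apply, Complex.real_smul, map_mul, Complex.conj_ofReal,
          mul_assoc, Complex.real_smul])
      (fun α β β' => by rw [ContinuousAlternatingMap.add_apply, mul_add])
      (fun c α β => by rw [ContinuousAlternatingMap.smul_apply, mul_smul_comm])
  | k + 1 => ∑ i, (pairing A k).compl₁₂ (curryLeftₗ (A (stdCovec i))) (curryLeftₗ (stdVec i))

theorem pairing_zero (A : (Coord N →L[ℝ] ℝ) →L[ℝ] Coord N) (α β : Coord N [⋀^Fin 0]→L[ℝ] ℂ) :
    pairing A 0 α β = (starRingEnd ℂ) (α ![]) * β ![] := rfl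

theorem pairing_succ (A : (Coord N →L[ℝ] ℝ) →L[ℝ] Coord N)
    (α β : Coord N [⋀^Fin (k + 1)]→L[ℝ] ℂ) :
    pairing A (k + 1) α β =
      ∑ i, pairing A k (α.curryLeft (A (stdCovec i))) (β.curryLeft (stdVec i)) := by
  rw [pairing, LinearMap.sum_apply, LinearMap.sum_apply]
  rfl

/-- The bilinear map `(u, v) ↦ ⟨u ⌟ α, v ⌟ β⟩`. -/
def pairingCurry (A : (Coord N →L[ℝ] ℝ) →L[ℝ] Coord N) (α β : Coord N [⋀^Fin (k + 1)]→L[ℝ] ℂ) :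
    Coord N →ₗ[ℝ] Coord N →ₗ[ℝ] ℂ :=
  (pairing A k).compl₁₂ (α.curryLeft : Coord N →ₗ[ℝ] Coord N [⋀^Fin k]→L[ℝ] ℂ)
    (β.curryLeft : Coord N →ₗ[ℝ] Coord N [⋀^Fin k]→L[ℝ] ℂ)

theorem pairingCurry_apply (A : (Coord N →L[ℝ] ℝ) →L[ℝ] Coord N)
    (α β : Coord N [⋀^Fin (k + 1)]→L[ℝ] ℂ) (u v : Coord N) :
    pairingCurry A α β u v = pairing A k (α.curryLeft u) (β.curryLeft v) := rfl

theorem pairing_succ_eq_traceWith (A : (Coord N →L[ℝ] ℝ) →L[ℝ] Coord N)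
    (α β : Coord N [⋀^Fin (k + 1)]→L[ℝ] ℂ) :
    pairing A (k + 1) α β = traceWith A (pairingCurry A α β) :=
  pairing_succ A α β

theorem pairing_pullback {A A' : (Coord N →L[ℝ] ℝ) →L[ℝ] Coord N} {S : Coord N →L[ℝ] Coord N}
    (hA : ∀ ξ, A' ξ = S (A (ξ ∘L S))) : ∀ {k : ℕ} (α β : Coord N [⋀^Fin k]→L[ℝ] ℂ),
    pairing A' k α β =
      pairing A k (α.compContinuousLinearMap S) (β.compContinuousLinearMap S)
  | 0, α, β => by
    rw [pairing_zero, pairing_zero, ContinuousAlternatingMap.compContinuousLinearMap_apply,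
      ContinuousAlternatingMap.compContinuousLinearMap_apply]
    congr 3 <;> exact Subsingleton.elim _ _
  | k + 1, α, β => by
    rw [pairing_succ_eq_traceWith, traceWith_pullback hA, pairing_succ]
    refine Finset.sum_congr rfl fun i _ => ?_
    rw [pairingCurry_apply, pairing_pullback hA,
      ContinuousAlternatingMap.curryLeft_compContinuousLinearMap,
      ContinuousAlternatingMap.curryLeft_compContinuousLinearMap]

section Calculus

variable {E : Type*} [NormedAddCommGroup E] [NormedSpace ℝ E] {s : Set E} {y₀ : E}

/-- `ContinuousAlternatingMap.curryLeft` as a continuous linear map. -/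
def curryLeftCLM (N k : ℕ) (V : Type*) [NormedAddCommGroup V] [NormedSpace ℝ V] :
    (Coord N [⋀^Fin (k + 1)]→L[ℝ] V) →L[ℝ] (Coord N →L[ℝ] (Coord N [⋀^Fin k]→L[ℝ] V)) :=
  ContinuousAlternatingMap.curryLeftLI.toContinuousLinearMap

@[simp]
theorem curryLeftCLM_apply (α : Coord N [⋀^Fin (k + 1)]→L[ℝ] V) :
    curryLeftCLM N k V α = α.curryLeft := rfl

theorem hasFDerivAt_curryLeft {α : E → Coord N [⋀^Fin (k + 1)]→L[ℝ] V}
    {α' : E →L[ℝ] Coord N [⋀^Fin (k + 1)]→L[ℝ] V} {a : E → Coord N} {a' : E →L[ℝ] Coord N}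
    (hα : HasFDerivAt α α' y₀) (ha : HasFDerivAt a a' y₀) :
    HasFDerivAt (fun y => (α y).curryLeft (a y)) ((α y₀).curryLeft ∘L a' +
      (curryLeftCLM N k V ∘L α').flip (a y₀)) y₀ :=
by
  have h := HasFDerivAt.comp (F := Coord N [⋀^Fin (k + 1)]→L[ℝ] V)
      (G := Coord N →L[ℝ] (Coord N [⋀^Fin k]→L[ℝ] V)) y₀ (curryLeftCLM N k V).hasFDerivAt hα
  exact h.clm_apply ha

theorem contDiffOn_curryLeft {α : E → Coord N [⋀^Fin (k + 1)]→L[ℝ] V} {a : E → Coord N}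
    (hα : ContDiffOn ℝ ∞ α s) (ha : ContDiffOn ℝ ∞ a s) :
    ContDiffOn ℝ ∞ (fun y => (α y).curryLeft (a y)) s :=
by
  have h := ContDiff.comp_contDiffOn (F := Coord N [⋀^Fin (k + 1)]→L[ℝ] V)
      (G := Coord N →L[ℝ] (Coord N [⋀^Fin k]→L[ℝ] V)) (curryLeftCLM N k V).contDiff hα
  exact h.clm_apply ha

/-- A form is recovered smoothly from its interior products, since the alternation of `v ↦ v ⌟ α` is
`(k + 1) α`. -/
theorem contDiffOn_of_curryLeft {α : E → Coord N [⋀^Fin (k + 1)]→L[ℝ] V}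
    (h : ∀ v, ContDiffOn ℝ ∞ (fun y => (α y).curryLeft v) s) : ContDiffOn ℝ ∞ α s := by
  have h1 : ContDiffOn ℝ ∞ (fun y => (α y).curryLeft) s := contDiffOn_clm_apply.2 h
  have h2 := ((ContinuousAlternatingMap.alternatizeUncurryFinCLM ℝ (Coord N) V).contDiff
    (n := ∞)).comp_contDiffOn h1
  have h3 := h2.const_smul ((k + 1 : ℝ)⁻¹)
  refine h3.congr fun y _ => ?_
  change _ = ((k + 1 : ℝ)⁻¹) • ContinuousAlternatingMap.alternatizeUncurryFin (α y).curryLeft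
  rw [ContinuousAlternatingMap.alternatizeUncurryFin_curryLeft, ← Nat.cast_smul_eq_nsmul ℝ,
    smul_smul]
  push_cast
  rw [inv_mul_cancel₀ (by positivity), one_smul]

theorem contDiffOn_compContinuousLinearMap {T : E → Coord N →L[ℝ] Coord N}
    (hT : ContDiffOn ℝ ∞ T s) : ∀ {k : ℕ} {α : E → Coord N [⋀^Fin k]→L[ℝ] V},
    ContDiffOn ℝ ∞ α s → ContDiffOn ℝ ∞ (fun y => (α y).compContinuousLinearMap (T y)) s
  | 0, α, hα => by
    refine hα.congr fun y _ => ?_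
    ext v
    rw [ContinuousAlternatingMap.compContinuousLinearMap_apply]
    congr 1
    exact Subsingleton.elim _ _
  | k + 1, α, hα => by
    refine contDiffOn_of_curryLeft fun v => ?_
    simp only [ContinuousAlternatingMap.curryLeft_compContinuousLinearMap]
    exact contDiffOn_compContinuousLinearMap hT
      (contDiffOn_curryLeft hα (hT.clm_apply contDiffOn_const))

theorem contDiffOn_pairing {A : E → (Coord N →L[ℝ] ℝ) →L[ℝ] Coord N} (hA : ContDiffOn ℝ ∞ A s) :
    ∀ {k : ℕ} {α β : E → Coord N [⋀^Fin k]→L[ℝ] ℂ}, ContDiffOn ℝ ∞ α s → ContDiffOn ℝ ∞ β s →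
    ContDiffOn ℝ ∞ (fun y => pairing (A y) k (α y) (β y)) s
  | 0, α, β, hα, hβ =>
    (Complex.conjCLE.contDiff.comp_contDiffOn ((ContinuousAlternatingMap.apply ℝ (Coord N) ℂ
      ![]).contDiff.comp_contDiffOn hα)).mul
      ((ContinuousAlternatingMap.apply ℝ (Coord N) ℂ ![]).contDiff.comp_contDiffOn hβ)
  | k + 1, α, β, hα, hβ => by
    simp only [pairing_succ]
    exact ContDiffOn.sum fun i _ => contDiffOn_pairing hA
      (contDiffOn_curryLeft hα (hA.clm_apply contDiffOn_const))
      (contDiffOn_curryLeft hβ contDiffOn_const)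

/-- The derivative of the pairing in terms of a connection for which the cometric is parallel. -/
theorem hasFDerivAt_pairing {A : E → (Coord N →L[ℝ] ℝ) →L[ℝ] Coord N}
    {A' : E →L[ℝ] (Coord N →L[ℝ] ℝ) →L[ℝ] Coord N} (hA : HasFDerivAt A A' y₀)
    {Γ : E → Coord N →L[ℝ] Coord N}
    (hΓ : ∀ u ξ, A' u ξ = -Γ u (A y₀ ξ) - A y₀ (ξ ∘L Γ u)) :
    ∀ {k : ℕ} {α β : E → Coord N [⋀^Fin k]→L[ℝ] ℂ} {α' β' : E →L[ℝ] Coord N [⋀^Fin k]→L[ℝ] ℂ},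
    HasFDerivAt α α' y₀ → HasFDerivAt β β' y₀ →
    ∃ D : E →L[ℝ] ℂ, HasFDerivAt (fun y => pairing (A y) k (α y) (β y)) D y₀ ∧
      ∀ u, D u = pairing (A y₀) k (α' u - derivationAct (Γ u) (α y₀)) (β y₀) +
        pairing (A y₀) k (α y₀) (β' u - derivationAct (Γ u) (β y₀))
  | 0, α, β, α', β', hα, hβ => by
    refine ⟨_, (Complex.conjCLE.hasFDerivAt.comp y₀ (hα.continuousAlternatingMap_apply_const
      ![])).mul (hβ.continuousAlternatingMap_apply_const ![]), fun u => ?_⟩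
    rw [derivationAct_zero_degree, derivationAct_zero_degree, sub_zero, sub_zero, pairing_zero,
      pairing_zero, add_comm, mul_comm _ (β y₀ ![])]
    rfl
  | k + 1, α, β, α', β', hα, hβ => by
    choose D hD hDu using fun i : Fin N => hasFDerivAt_pairing hA hΓ
      (hasFDerivAt_curryLeft hα (hA.clm_apply (hasFDerivAt_const (stdCovec i) y₀)))
      (hasFDerivAt_curryLeft hβ (hasFDerivAt_const (stdVec i) y₀))
    refine ⟨∑ i, D i, ?_, fun u => ?_⟩
    · simp only [pairing_succ]
      exact HasFDerivAt.fun_sum fun i _ => hD i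
    -- By induction, with the Leibniz rule for interior products. The last two terms are the
    -- leftovers from differentiating the cometric and from the fixed vectors `stdVec i`; their sums
    -- over `i` cancel by `traceWith_comp`.
    · have h1 : ∀ i, D i u =
          pairing (A y₀) k ((α' u - derivationAct (Γ u) (α y₀)).curryLeft (A y₀ (stdCovec i)))
            ((β y₀).curryLeft (stdVec i)) +
          pairing (A y₀) k ((α y₀).curryLeft (A y₀ (stdCovec i)))
            ((β' u - derivationAct (Γ u) (β y₀)).curryLeft (stdVec i)) -
          pairingCurry (A y₀) (α y₀) (β y₀) (A y₀ (stdCovec i ∘L Γ u)) (stdVec i) +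
          pairingCurry (A y₀) (α y₀) (β y₀) (A y₀ (stdCovec i)) (Γ u (stdVec i)) := fun i => by
        have e1 : ∀ (a b : Coord N [⋀^Fin (k + 1)]→L[ℝ] ℂ) v,
            (a - b).curryLeft v = a.curryLeft v - b.curryLeft v := fun a b v => rfl
        rw [hDu, e1, e1, derivationAct_curryLeft, derivationAct_curryLeft, pairingCurry_apply,
          pairingCurry_apply]
        simp only [_root_.add_apply, ContinuousLinearMap.comp_apply,
          ContinuousLinearMap.flip_apply, hΓ,
          ContinuousLinearMap.comp_zero, zero_add, map_add, map_sub, map_neg,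
          curryLeftCLM_apply, LinearMap.add_apply, LinearMap.sub_apply, LinearMap.neg_apply]
        ring
      rw [_root_.sum_apply, pairing_succ, pairing_succ]
      simp only [h1]
      rw [Finset.sum_add_distrib, Finset.sum_sub_distrib, Finset.sum_add_distrib, traceWith_comp]
      ring

end Calculus

end Frames

/-! ### Parallel contractions: the operators `Λ`, `J^*` and `⟨α, · ⌟ β⟩` -/

section Operators

variable {N p k : ℕ} {M : Type*} [TopologicalSpace M] [ChartedSpace (Coord N) M]
  [IsManifold (𝓡 N) ∞ M] [T2Space M] {F : Foliation N p M} {g : Metric N M}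
  {J : M → Coord N →L[ℝ] Coord N}

theorem cometric_eq_coordCometric {z : M} {y : Coord N} (hy : y ∈ (extChartAt (𝓡 N) z).target)
    (ξ : Coord N →L[ℝ] ℝ) :
    cometric F g ((extChartAt (𝓡 N) z).symm y) ξ =
      chartSymmDeriv z y (coordCometric F g z y (ξ ∘L chartSymmDeriv z y)) := by
  rw [coordCometric_apply F g hy, chartSymmDeriv_chartDeriv hy, ContinuousLinearMap.comp_assoc,
    chartSymmDeriv_comp_chartDeriv hy, ContinuousLinearMap.comp_id]

/-- The contraction `Λη = ∑ a, η (E_a, J E_a, ·)`. -/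
def kahlerContract (F : Foliation N p M) (g : Metric N M) (J : M → Coord N →L[ℝ] Coord N)
    (η : Form N M ℂ (k + 2)) : Form N M ℂ k := fun x =>
  ∑ i, ((η x).curryLeft (cometric F g x (stdCovec i))).curryLeft (J x (stdVec i))

/-- The pullback `η (J ·, …, J ·)`. -/
def pullbackJ (J : M → Coord N →L[ℝ] Coord N) (η : Form N M ℂ k) : Form N M ℂ k := fun x =>
  (η x).compContinuousLinearMap (J x)

/-- The one-form `X ↦ ⟨α, X ⌟ β⟩`. -/
def pairingForm (F : Foliation N p M) (g : Metric N M) (α : Form N M ℂ k)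
    (β : Form N M ℂ (k + 1)) : Form N M ℂ 1 := fun x =>
  ContinuousAlternatingMap.ofSubsingletonLIE (𝕜 := ℝ) (E := Coord N) (F := ℂ) (0 : Fin 1)
    (LinearMap.toContinuousLinearMap
      (pairing (cometric F g x) k (α x) ∘ₗ (β x).curryLeft.toLinearMap))

theorem pairingForm_apply (α : Form N M ℂ k) (β : Form N M ℂ (k + 1)) (x : M)
    (w : Fin 1 → Coord N) :
    pairingForm F g α β x w = pairing (cometric F g x) k (α x) ((β x).curryLeft (w 0)) := rfl

/-- The bilinear map `(u, v) ↦ v ⌟ u ⌟ α`. -/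
def curryCurry (α : Coord N [⋀^Fin (k + 2)]→L[ℝ] ℂ) :
    Coord N →ₗ[ℝ] Coord N →ₗ[ℝ] Coord N [⋀^Fin k]→L[ℝ] ℂ :=
  curryLeftₗ.flip ∘ₗ α.curryLeft.toLinearMap

theorem curryCurry_apply (α : Coord N [⋀^Fin (k + 2)]→L[ℝ] ℂ) (u v : Coord N) :
    curryCurry α u v = (α.curryLeft u).curryLeft v := rfl

/-- The contraction is a trace against the cometric, so the derivative of the chart may be moved
across it. -/
theorem coordForm_kahlerContract (η : Form N M ℂ (k + 2)) {z : M} {y : Coord N}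
    (hy : y ∈ (extChartAt (𝓡 N) z).target) :
    coordForm z (kahlerContract F g J η) y =
      ∑ i, ((coordForm z η y).curryLeft (coordCometric F g z y (stdCovec i))).curryLeft
        (coordEnd z J y (stdVec i)) := by
  set S := chartSymmDeriv z y with hS
  set m := (extChartAt (𝓡 N) z).symm y with hm
  have h1 : ∀ v, J m (S v) = S (coordEnd z J y v) := fun v => by
    rw [coordEnd_apply, chartSymmDeriv_chartDeriv hy]
  have h2 : ∀ i, ((coordForm z η y).curryLeft (coordCometric F g z y (stdCovec i))).curryLeft
        (coordEnd z J y (stdVec i)) =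
      (((η m).curryLeft (S (coordCometric F g z y (stdCovec i)))).curryLeft
        (J m (S (stdVec i)))).compContinuousLinearMap S := fun i => by
    rw [h1, coordForm, ContinuousAlternatingMap.curryLeft_compContinuousLinearMap,
      ContinuousAlternatingMap.curryLeft_compContinuousLinearMap]
  have h3 := traceWith_comp (S ∘L coordCometric F g z y)
    ((curryCurry (η m)).compl₁₂ LinearMap.id (J m).toLinearMap) S
  simp only [h2]
  ext w
  rw [ContinuousAlternatingMap.sum_apply]
  change (kahlerContract F g J η m) (fun i => S (w i)) = _
  have h4 := congrArg (fun a : Coord N [⋀^Fin k]→L[ℝ] ℂ => a fun i => S (w i)) h3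
  simp only [ContinuousAlternatingMap.sum_apply] at h4
  rw [kahlerContract, ContinuousAlternatingMap.sum_apply]
  refine Eq.trans ?_ h4
  refine Finset.sum_congr rfl fun i _ => ?_
  rw [hm, cometric_eq_coordCometric hy]
  rfl

theorem coordForm_pullbackJ (η : Form N M ℂ k) {z : M} {y : Coord N}
    (hy : y ∈ (extChartAt (𝓡 N) z).target) :
    coordForm z (pullbackJ J η) y =
      (coordForm z η y).compContinuousLinearMap (coordEnd z J y) := by
  ext w
  simp only [coordForm_apply, ContinuousAlternatingMap.compContinuousLinearMap_apply,
    Function.comp_def, coordEnd_apply, chartSymmDeriv_chartDeriv hy, pullbackJ]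

theorem coordForm_pairingForm (α : Form N M ℂ k) (β : Form N M ℂ (k + 1)) {z : M} {y : Coord N}
    (hy : y ∈ (extChartAt (𝓡 N) z).target) :
    coordForm z (pairingForm F g α β) y =
      ContinuousAlternatingMap.ofSubsingletonLIE (𝕜 := ℝ) (E := Coord N) (F := ℂ) (0 : Fin 1)
        (LinearMap.toContinuousLinearMap (pairing (coordCometric F g z y) k (coordForm z α y) ∘ₗ
          (coordForm z β y).curryLeft.toLinearMap)) := by
  ext w
  rw [coordForm_apply, pairingForm_apply, pairing_pullback (cometric_eq_coordCometric hy),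
    ← ContinuousAlternatingMap.curryLeft_compContinuousLinearMap]
  rfl

theorem coordForm_pairing {α β : Form N M ℂ k} {z : M} {y : Coord N}
    (hy : y ∈ (extChartAt (𝓡 N) z).target) :
    pairing (cometric F g ((extChartAt (𝓡 N) z).symm y)) k (α ((extChartAt (𝓡 N) z).symm y))
      (β ((extChartAt (𝓡 N) z).symm y)) =
      pairing (coordCometric F g z y) k (coordForm z α y) (coordForm z β y) :=
  pairing_pullback (cometric_eq_coordCometric hy) _ _

theorem IsSmoothForm.kahlerContract (hJ : IsTransverseKahler F g J) {η : Form N M ℂ (k + 2)}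
    (hη : IsSmoothForm η) : IsSmoothForm (kahlerContract F g J η) := fun z => by
  refine ContDiffOn.congr (ContDiffOn.sum fun i _ => ?_) fun y hy => coordForm_kahlerContract η hy
  exact contDiffOn_curryLeft (contDiffOn_curryLeft (hη z)
    ((contDiffOn_coordCometric F g z).clm_apply contDiffOn_const))
    ((hJ.smooth z).clm_apply contDiffOn_const)

theorem IsSmoothForm.pullbackJ (hJ : IsTransverseKahler F g J) {η : Form N M ℂ k}
    (hη : IsSmoothForm η) : IsSmoothForm (pullbackJ J η) := fun z =>
  (contDiffOn_compContinuousLinearMap (hJ.smooth z) (hη z)).congr fun _ hy =>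
    coordForm_pullbackJ η hy

theorem IsSmoothForm.pairingForm {α : Form N M ℂ k} {β : Form N M ℂ (k + 1)}
    (hα : IsSmoothForm α) (hβ : IsSmoothForm β) : IsSmoothForm (pairingForm F g α β) := fun z => by
  refine ContDiffOn.congr ?_ fun y hy => coordForm_pairingForm α β hy
  refine (ContinuousAlternatingMap.ofSubsingletonLIE (𝕜 := ℝ) (E := Coord N) (F := ℂ) (0 : Fin 1)).contDiff.comp_contDiffOn
    (contDiffOn_clm_apply.2 fun v => ?_)
  exact contDiffOn_pairing (contDiffOn_coordCometric F g z) (hα z)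
    (contDiffOn_curryLeft (hβ z) contDiffOn_const)

theorem kahlerContract_vanishesOn {η : Form N M ℂ (k + 2)}
    (hη : ∀ x, VanishesOn (F.tangent x) (η x)) (x : M) :
    VanishesOn (F.tangent x) (kahlerContract F g J η x) :=
  VanishesOn.sum fun _ => ((hη x).curryLeft _).curryLeft _

theorem pullbackJ_vanishesOn (hJ : IsTransverseKahler F g J) (η : Form N M ℂ k) (x : M) :
    VanishesOn (F.tangent x) (pullbackJ J η x) := by
  rintro w ⟨i, hi⟩
  rw [pullbackJ, ContinuousAlternatingMap.compContinuousLinearMap_apply]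
  exact (η x).map_coord_zero i (hJ.map_tangent x _ hi)

theorem pairingForm_vanishesOn (α : Form N M ℂ k) {β : Form N M ℂ (k + 1)}
    (hβ : ∀ x, VanishesOn (F.tangent x) (β x)) (x : M) :
    VanishesOn (F.tangent x) (pairingForm F g α β x) := by
  rintro w ⟨i, hi⟩
  rw [Subsingleton.elim i 0] at hi
  rw [pairingForm_apply, (hβ x).curryLeft_eq_zero hi, map_zero]

/-- `∇` commutes with `Λ` because the cometric and `J` are parallel; the Christoffel terms from the
two contracted slots cancel as in a trace. -/
theorem covDeriv_kahlerContract (hJ : IsTransverseKahler F g J) {η : Form N M ℂ (k + 2)}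
    (hη : IsSmoothForm η) (hη' : ∀ x, VanishesOn (F.tangent x) (η x)) (x : M) (u : Coord N) :
    covDeriv F g (kahlerContract F g J η) x u =
      ∑ i, ((covDeriv F g η x u).curryLeft (cometric F g x (stdCovec i))).curryLeft
        (J x (stdVec i)) := by
  have hA := (differentiableAt_coordCometric F g x).hasFDerivAt
  have hJd := (hJ.differentiableAt_coordEnd x).hasFDerivAt
  have hη1 := (hη.differentiableAt (base_mem_target x)).hasFDerivAt
  have h0 : coordForm x (kahlerContract F g J η) =ᶠ[𝓝 (extChartAt (𝓡 N) x x)] fun y =>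
      ∑ i, ((coordForm x η y).curryLeft (coordCometric F g x y (stdCovec i))).curryLeft
        (coordEnd x J y (stdVec i)) := by
    filter_upwards [target_mem_nhds (base_mem_target (N := N) x)] with y hy
    exact coordForm_kahlerContract η hy
  have h1 := HasFDerivAt.fun_sum (u := Finset.univ) fun (i : Fin N) _ =>
    hasFDerivAt_curryLeft (hasFDerivAt_curryLeft hη1
      (hA.clm_apply (hasFDerivAt_const (stdCovec i) _)))
      (hJd.clm_apply (hasFDerivAt_const (stdVec i) _))
  rw [covDeriv_eq (kahlerContract_vanishesOn hη' x), covDeriv_eq (hη' x), h0.fderiv_eq, h1.fderiv,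
    kahlerContract, derivationAct_sum, _root_.sum_apply, ← Finset.sum_sub_distrib]
  set Γ := adaptedConn F g x u
  have h2 := traceWith_comp (cometric F g x) ((curryCurry (η x)).compl₁₂
    LinearMap.id (J x).toLinearMap) Γ
  rw [← sub_eq_zero, ← Finset.sum_sub_distrib] at h2 ⊢
  rw [← neg_eq_zero, ← Finset.sum_neg_distrib] at h2
  refine Eq.trans (Finset.sum_congr rfl fun i _ => ?_) h2
  have e1 : ∀ (a b : Coord N [⋀^Fin (k + 2)]→L[ℝ] ℂ) v,
      (a - b).curryLeft v = a.curryLeft v - b.curryLeft v := fun a b v => rfl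
  have e2 : ∀ (a b : Coord N [⋀^Fin (k + 1)]→L[ℝ] ℂ) v,
      (a - b).curryLeft v = a.curryLeft v - b.curryLeft v := fun a b v => rfl
  have e3 : ∀ (a b : Coord N [⋀^Fin (k + 1)]→L[ℝ] ℂ) v,
      (a + b).curryLeft v = a.curryLeft v + b.curryLeft v := fun a b v => rfl
  simp only [_root_.add_apply, ContinuousLinearMap.comp_apply,
    ContinuousLinearMap.flip_apply, ContinuousLinearMap.comp_zero, zero_add, coordForm_base, coordCometric_base, coordEnd_base,
    curryLeftCLM_apply,
    fderiv_coordCometric_eq hJ.bundleLike, hJ.fderiv_coordEnd_eq,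
    LinearMap.compl₁₂_apply, curryCurry_apply, LinearMap.id_apply, ContinuousLinearMap.coe_coe, e1,
    derivationAct_curryLeft, e2, e3, map_sub, map_add, map_neg, _root_.sub_apply,
    _root_.neg_apply, Γ]
  abel

theorem covDeriv_pullbackJ (hJ : IsTransverseKahler F g J) {η : Form N M ℂ k}
    (hη : IsSmoothForm η) (hη' : ∀ x, VanishesOn (F.tangent x) (η x)) (x : M) (u : Coord N) :
    covDeriv F g (pullbackJ J η) x u =
      (covDeriv F g η x u).compContinuousLinearMap (J x) := by
  have hJd := (hJ.differentiableAt_coordEnd x).hasFDerivAt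
  have hη1 := (hη.differentiableAt (base_mem_target x)).hasFDerivAt
  have h0 : coordForm x (pullbackJ J η) =ᶠ[𝓝 (extChartAt (𝓡 N) x x)] fun y =>
      (coordForm x η y).compContinuousLinearMap (coordEnd x J y) := by
    filter_upwards [target_mem_nhds (base_mem_target (N := N) x)] with y hy
    exact coordForm_pullbackJ η hy
  rw [covDeriv_eq (pullbackJ_vanishesOn hJ η x), covDeriv_eq (hη' x), h0.fderiv_eq,
    (hη1.continuousAlternatingMapCompContinuousLinearMap hJd).fderiv]
  ext w
  simp only [_root_.add_apply, ContinuousLinearMap.comp_apply, coordForm_base, coordEnd_base,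
    ContinuousAlternatingMap.sub_apply, ContinuousAlternatingMap.add_apply,
    ContinuousAlternatingMap.compContinuousLinearMap_apply, derivationAct_apply,
    ContinuousAlternatingMap.fderivCompContinuousLinearMap_apply, pullbackJ]
  have e1 : ∀ i : Fin k, (fun j => Function.update (fun _ => J x) i
      (fderiv ℝ (coordEnd x J) (extChartAt (𝓡 N) x x) u) j (w j)) =
      Function.update (J x ∘ w) i (J x (adaptedConn F g x u (w i)) -
        adaptedConn F g x u (J x (w i))) := fun i => by
    funext j
    rcases eq_or_ne j i with rfl | h
    · simp only [Function.update_self, hJ.fderiv_coordEnd_eq]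
    · simp [h]
  have e2 : ∀ i : Fin k, (J x ∘ Function.update w i (adaptedConn F g x u (w i))) =
      Function.update (J x ∘ w) i (J x (adaptedConn F g x u (w i))) := fun i => by
    funext j
    rcases eq_or_ne j i with rfl | h
    · simp
    · simp [h]
  simp only [e1, e2, ContinuousAlternatingMap.map_update_sub, Finset.sum_sub_distrib,
    Function.comp_apply]
  change (fderiv ℝ (coordForm x η) (extChartAt (𝓡 N) x x) u) (J x ∘ w) + _ - _ = _
  ring

theorem covDeriv_pairingForm (hg : IsBundleLike F g) {α : Form N M ℂ k} {β : Form N M ℂ (k + 1)}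
    (hα : IsSmoothForm α) (hα' : ∀ x, VanishesOn (F.tangent x) (α x))
    (hβ : IsSmoothForm β) (hβ' : ∀ x, VanishesOn (F.tangent x) (β x)) (x : M) (u : Coord N)
    (w : Fin 1 → Coord N) :
    covDeriv F g (pairingForm F g α β) x u w =
      pairing (cometric F g x) k (covDeriv F g α x u) ((β x).curryLeft (w 0)) +
        pairing (cometric F g x) k (α x) ((covDeriv F g β x u).curryLeft (w 0)) := by
  have hA := (differentiableAt_coordCometric F g x).hasFDerivAt
  have hα1 := (hα.differentiableAt (base_mem_target x)).hasFDerivAt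
  have hβ1 := (hβ.differentiableAt (base_mem_target x)).hasFDerivAt
  have hψ := (IsSmoothForm.pairingForm (F := F) (g := g) hα hβ).differentiableAt
    (base_mem_target x)
  obtain ⟨D, hD, hDu⟩ := hasFDerivAt_pairing hA (Γ := adaptedConn F g x)
    (fun u ξ => by rw [fderiv_coordCometric_eq hg, coordCometric_base]) hα1
    (hasFDerivAt_curryLeft hβ1 (hasFDerivAt_const (w 0) _))
  have h0 : (fun y => coordForm x (pairingForm F g α β) y w) =ᶠ[𝓝 (extChartAt (𝓡 N) x x)] fun y =>
      pairing (coordCometric F g x y) k (coordForm x α y) ((coordForm x β y).curryLeft (w 0)) := by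
    filter_upwards [target_mem_nhds (base_mem_target (N := N) x)] with y hy
    rw [coordForm_pairingForm α β hy]
    rfl
  have h1 := fderiv_continuousAlternatingMap_apply_const_apply hψ w u
  rw [h0.fderiv_eq, hD.fderiv, hDu] at h1
  rw [covDeriv_eq (pairingForm_vanishesOn α hβ' x), ContinuousAlternatingMap.sub_apply, ← h1,
    derivationAct_apply, covDeriv_eq (hα' x), covDeriv_eq (hβ' x)]
  simp only [Finset.univ_unique, Finset.sum_singleton, pairingForm_apply]
  have e1 : ∀ (a b : Coord N [⋀^Fin (k + 1)]→L[ℝ] ℂ) v,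
      (a - b).curryLeft v = a.curryLeft v - b.curryLeft v := fun a b v => rfl
  simp only [Fin.default_eq_zero, Function.update_self, coordForm_base, coordCometric_base,
    _root_.add_apply,
    ContinuousLinearMap.comp_apply, ContinuousLinearMap.flip_apply, _root_.zero_apply, map_zero,
    zero_add, curryLeftCLM_apply, e1, derivationAct_curryLeft, map_sub, map_add]
  ring

/-- Being basic means horizontal and parallel along the leaves, and `∇` passes through the
contraction. -/
theorem IsBasic.kahlerContract (hJ : IsTransverseKahler F g J) {η : Form N M ℂ (k + 2)}
    (hη : IsBasic F η) : IsBasic F (kahlerContract F g J η) :=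
  isBasic_of_covDeriv hJ.bundleLike (hη.smooth.kahlerContract hJ)
    (kahlerContract_vanishesOn hη.vanishesOn) fun x v hv => by
      rw [covDeriv_kahlerContract hJ hη.smooth hη.vanishesOn,
        hη.covDeriv_eq_zero hJ.bundleLike hv]
      exact Finset.sum_eq_zero fun i _ => rfl

theorem IsBasic.pullbackJ (hJ : IsTransverseKahler F g J) {η : Form N M ℂ k}
    (hη : IsBasic F η) : IsBasic F (pullbackJ J η) :=
  isBasic_of_covDeriv hJ.bundleLike (hη.smooth.pullbackJ hJ)
    (pullbackJ_vanishesOn hJ η) fun x v hv => by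
      rw [covDeriv_pullbackJ hJ hη.smooth hη.vanishesOn, hη.covDeriv_eq_zero hJ.bundleLike hv]
      rfl

theorem IsBasic.pairingForm (hg : IsBundleLike F g) {α : Form N M ℂ k} {β : Form N M ℂ (k + 1)}
    (hα : IsBasic F α) (hβ : IsBasic F β) : IsBasic F (pairingForm F g α β) :=
  isBasic_of_covDeriv hg (IsSmoothForm.pairingForm hα.smooth hβ.smooth)
    (pairingForm_vanishesOn α hβ.vanishesOn) fun x v hv => by
      ext w
      rw [covDeriv_pairingForm hg hα.smooth hα.vanishesOn hβ.smooth hβ.vanishesOn,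
        hα.covDeriv_eq_zero hg hv, hβ.covDeriv_eq_zero hg hv]
      simp

end Operators

/-! ### Traces in orthonormal frames and their `J`-invariance -/

section TraceIdentities

variable {N p k : ℕ} {M : Type*} [TopologicalSpace M] [T2Space M] [ChartedSpace (Coord N) M]
  [IsManifold (𝓡 N) ∞ M] {F : Foliation N p M} {g : Metric N M}
  {J : M → Coord N →L[ℝ] Coord N} {V : Type*} [NormedAddCommGroup V] [NormedSpace ℝ V]

theorem onb_orthonormal (g : Metric N M) (x : M) (S : Submodule ℝ (Coord N))
    (i j : Fin (Module.finrank ℝ S)) :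
    Metric.bilin g x (onb g x S i) (onb g x S j) = if i = j then 1 else 0 :=
  (exists_orthonormal g x S).choose_spec i j

theorem sum_bilin_onb (g : Metric N M) (x : M) (S : Submodule ℝ (Coord N)) {v : Coord N}
    (hv : v ∈ S) :
    ∑ a, Metric.bilin g x v (onb g x S a) • (onb g x S a : Coord N) = v := by
  have h := (onb g x S).sum_repr ⟨v, hv⟩
  have h1 := congrArg (Subtype.val) h
  rw [Submodule.coe_sum] at h1
  simp only [Submodule.coe_smul] at h1
  have h2 : ∀ a, Metric.bilin g x v (onb g x S a) = (onb g x S).repr ⟨v, hv⟩ a := fun a => by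
    conv_lhs => rw [← h1]
    simp [onb_orthonormal]
  simp only [h2]
  exact h1

theorem cometric_eq_sum_onb (F : Foliation N p M) (g : Metric N M) (x : M) (ξ : Coord N →L[ℝ] ℝ) :
    cometric F g x ξ = ∑ a, ξ (onb g x (normal F g x) a) • (onb g x (normal F g x) a : Coord N) := by
  have h1 : cometric F g x ξ ∈ normal F g x := by
    rw [← proj_cometric]
    exact proj_mem_normal F g x _
  refine (sum_bilin_onb g x (normal F g x) h1).symm.trans (Finset.sum_congr rfl fun a _ => ?_)
  have h2 := (onb g x (normal F g x) a).2
  have h3 := transMetric_cometric F g x ξ (onb g x (normal F g x) a)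
  rw [transMetric_apply, proj_cometric, proj_of_mem_normal F g x h2] at h3
  rw [h3]

/-- The frame `onb` is chosen separately at every point, without continuity. This identity trades
its sums for the cometric, which is smooth and can be differentiated. -/
theorem traceWith_cometric (F : Foliation N p M) (g : Metric N M) (x : M)
    (B : Coord N →ₗ[ℝ] Coord N →ₗ[ℝ] V) :
    traceWith (cometric F g x) B =
      ∑ a, B (onb g x (normal F g x) a) (onb g x (normal F g x) a) := by
  have h1 : ∀ i, B (cometric F g x (stdCovec i)) (stdVec i) =
      ∑ a, B (onb g x (normal F g x) a)
        (stdCovec i (onb g x (normal F g x) a : Coord N) • stdVec i) := fun i => by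
    rw [cometric_eq_sum_onb, map_sum, LinearMap.sum_apply]
    refine Finset.sum_congr rfl fun a _ => ?_
    rw [map_smul, LinearMap.smul_apply, map_smul]
  rw [traceWith]
  simp only [h1]
  rw [Finset.sum_comm]
  refine Finset.sum_congr rfl fun a _ => ?_
  rw [← map_sum, sum_stdCovec_smul]

theorem traceWith_flip (F : Foliation N p M) (g : Metric N M) (x : M)
    (B : Coord N →ₗ[ℝ] Coord N →ₗ[ℝ] V) :
    ∑ i, B (stdVec i) (cometric F g x (stdCovec i)) = traceWith (cometric F g x) B := by
  have h := traceWith_cometric F g x B.flip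
  rw [traceWith_cometric]
  exact h

/-- `J` is orthogonal for `g_Q`, hence preserves the inverse metric on `Q*`. Consequently `J E_a` is
as good a frame as `E_a` in any trace. -/
theorem IsTransverseKahler.J_cometric (hJ : IsTransverseKahler F g J) (x : M)
    (ξ : Coord N →L[ℝ] ℝ) : cometric F g x ξ = J x (cometric F g x (ξ ∘L J x)) := by
  have h := proj_eq_zero_of_transMetric F g x
    (u := cometric F g x ξ - J x (cometric F g x (ξ ∘L J x))) fun w => by
      rw [map_sub, _root_.sub_apply, transMetric_cometric, ← hJ.hermitian x (J x _) w, hJ.sq,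
        map_neg, _root_.neg_apply, proj_cometric, transMetric_cometric, hJ.proj_J,
        ContinuousLinearMap.comp_apply, hJ.sq, map_neg]
      ring
  rw [map_sub, proj_cometric, hJ.proj_J] at h
  exact sub_eq_zero.1 h

theorem IsTransverseKahler.traceWith_J (hJ : IsTransverseKahler F g J) (x : M)
    (B : Coord N →ₗ[ℝ] Coord N →ₗ[ℝ] V) :
    ∑ i, B (J x (cometric F g x (stdCovec i))) (J x (stdVec i)) =
      traceWith (cometric F g x) B :=
  (traceWith_pullback (hJ.J_cometric x) B).symm

end TraceIdentities

/-! ### Complex linear forms and antilinear parts -/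

section HolomorphicType

variable {N k : ℕ}

/-- The form `α` is complex linear in each argument with respect to `T`. -/
def IsComplexLinear (T : Coord N →L[ℝ] Coord N) (α : Coord N [⋀^Fin k]→L[ℝ] ℂ) : Prop :=
  ∀ (w : Fin k → Coord N) j, α (Function.update w j (T (w j))) = Complex.I * α w

variable {T : Coord N →L[ℝ] Coord N}

theorem IsComplexLinear.curryLeft_map {α : Coord N [⋀^Fin (k + 1)]→L[ℝ] ℂ}
    (h : IsComplexLinear T α) (v : Coord N) :
    α.curryLeft (T v) = Complex.I • α.curryLeft v := by
  ext w
  have := h (Matrix.vecCons v w) 0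
  rw [ContinuousAlternatingMap.smul_apply, ContinuousAlternatingMap.curryLeft_apply_apply,
    ContinuousAlternatingMap.curryLeft_apply_apply, smul_eq_mul, ← this]
  congr 1
  funext i
  refine Fin.cases ?_ (fun i => ?_) i <;> simp

theorem IsComplexLinear.curryLeft {α : Coord N [⋀^Fin (k + 1)]→L[ℝ] ℂ}
    (h : IsComplexLinear T α) (v : Coord N) : IsComplexLinear T (α.curryLeft v) := fun w j => by
  have := h (Matrix.vecCons v w) j.succ
  rw [ContinuousAlternatingMap.curryLeft_apply_apply,
    ContinuousAlternatingMap.curryLeft_apply_apply, ← this]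
  congr 1
  funext i
  refine Fin.cases ?_ (fun i => ?_) i
  · simp [Function.update_of_ne (Fin.succ_ne_zero j).symm]
  · rcases eq_or_ne i j with rfl | hi
    · simp
    · simp [hi]

/-- Linearity in the first slot suffices: slot `j` is moved to the front at the cost of the sign
`(-1)^j` on both sides. -/
theorem isComplexLinear_of_curryLeft {α : Coord N [⋀^Fin (k + 1)]→L[ℝ] ℂ}
    (h : ∀ v, α.curryLeft (T v) = Complex.I • α.curryLeft v) : IsComplexLinear T α := fun w j => by
  have h1 := DFunLike.congr_fun (h (w j)) (j.removeNth w)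
  rw [ContinuousAlternatingMap.smul_apply, ContinuousAlternatingMap.curryLeft_apply_apply,
    ContinuousAlternatingMap.curryLeft_apply_apply, smul_eq_mul,
    ← ContinuousAlternatingMap.neg_one_pow_smul_map_insertNth α j,
    ← ContinuousAlternatingMap.neg_one_pow_smul_map_insertNth α j, Fin.insertNth_removeNth,
    Fin.insertNth_removeNth, Function.update_eq_self, mul_smul_comm] at h1
  have h2 := congrArg (fun z : ℂ => ((-1 : ℤ) ^ (j : ℕ)) • z) h1
  simp only [smul_smul, ← pow_add, ← two_mul, pow_mul] at h2
  simpa using h2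

theorem IsComplexLinear.add {α β : Coord N [⋀^Fin k]→L[ℝ] ℂ} (hα : IsComplexLinear T α)
    (hβ : IsComplexLinear T β) : IsComplexLinear T (α + β) := fun w j => by
  rw [ContinuousAlternatingMap.add_apply, ContinuousAlternatingMap.add_apply, hα, hβ, mul_add]

theorem IsComplexLinear.smul {α : Coord N [⋀^Fin k]→L[ℝ] ℂ} (hα : IsComplexLinear T α) (c : ℂ) :
    IsComplexLinear T (c • α) := fun w j => by
  rw [ContinuousAlternatingMap.smul_apply, ContinuousAlternatingMap.smul_apply, hα, smul_eq_mul,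
    smul_eq_mul]
  ring

theorem IsComplexLinear.real_smul {α : Coord N [⋀^Fin k]→L[ℝ] ℂ} (hα : IsComplexLinear T α)
    (c : ℝ) : IsComplexLinear T (c • α) := fun w j => by
  rw [ContinuousAlternatingMap.smul_apply, ContinuousAlternatingMap.smul_apply, hα,
    mul_smul_comm]

theorem IsComplexLinear.sub {α β : Coord N [⋀^Fin k]→L[ℝ] ℂ} (hα : IsComplexLinear T α)
    (hβ : IsComplexLinear T β) : IsComplexLinear T (α - β) := fun w j => by
  rw [ContinuousAlternatingMap.sub_apply, ContinuousAlternatingMap.sub_apply, hα, hβ, mul_sub]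

/-- In each of the `k` slots `cos t + sin t T` acts as multiplication by `e^{it}`. -/
theorem IsComplexLinear.compContinuousLinearMap_rotation :
    ∀ {k : ℕ} {α : Coord N [⋀^Fin k]→L[ℝ] ℂ}, IsComplexLinear T α → ∀ t : ℝ,
    α.compContinuousLinearMap (Real.cos t • ContinuousLinearMap.id ℝ (Coord N) + Real.sin t • T) =
      Complex.exp (k * t * Complex.I) • α
  | 0, α, _, t => by
    ext w
    rw [ContinuousAlternatingMap.compContinuousLinearMap_apply,
      ContinuousAlternatingMap.smul_apply]
    simp only [Nat.cast_zero, zero_mul, Complex.exp_zero, one_smul]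
    congr 1
    exact Subsingleton.elim _ _
  | k + 1, α, hα, t => by
    refine form_ext_curryLeft fun v => ?_
    have h1 : (Complex.exp ((k + 1 : ℕ) * t * Complex.I) • α).curryLeft v =
      Complex.exp ((k + 1 : ℕ) * t * Complex.I) • α.curryLeft v := rfl
    have h2 : α.curryLeft ((Real.cos t • ContinuousLinearMap.id ℝ (Coord N) + Real.sin t • T) v) =
        Complex.exp (t * Complex.I) • α.curryLeft v := by
      rw [_root_.add_apply, smul_apply, smul_apply, map_add, map_smul, map_smul,
        hα.curryLeft_map, ContinuousLinearMap.id_apply, Complex.exp_mul_I, add_smul, mul_smul]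
      ext w
      simp
    rw [ContinuousAlternatingMap.curryLeft_compContinuousLinearMap, h1, h2]
    have h3 := (hα.curryLeft v).compContinuousLinearMap_rotation t
    ext w
    have h4 := DFunLike.congr_fun h3 w
    rw [ContinuousAlternatingMap.compContinuousLinearMap_apply,
      ContinuousAlternatingMap.smul_apply] at h4
    rw [ContinuousAlternatingMap.compContinuousLinearMap_apply,
      ContinuousAlternatingMap.smul_apply, ContinuousAlternatingMap.smul_apply, h4, smul_smul,
      ← Complex.exp_add]
    congr 2
    push_cast
    ring

theorem IsComplexLinear.neg {α : Coord N [⋀^Fin k]→L[ℝ] ℂ} (hα : IsComplexLinear T α) :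
    IsComplexLinear T (-α) := fun w j => by
  rw [ContinuousAlternatingMap.neg_apply, ContinuousAlternatingMap.neg_apply, hα, mul_neg]

/-- For a family `L` of complex linear forms, `Alt L` determines the anti-linear part of `L`. -/
theorem alternatize_curryLeft_map {L : Coord N →L[ℝ] Coord N [⋀^Fin k]→L[ℝ] ℂ}
    (hL : ∀ u, IsComplexLinear T (L u)) (v : Coord N) :
    (ContinuousAlternatingMap.alternatizeUncurryFin L).curryLeft (T v) -
      Complex.I • (ContinuousAlternatingMap.alternatizeUncurryFin L).curryLeft v =
      L (T v) - Complex.I • L v := by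
  cases k with
  | zero => rw [alternatize_curryLeft_zero, alternatize_curryLeft_zero]
  | succ k =>
    rw [alternatize_curryLeft, alternatize_curryLeft, smul_sub]
    -- The correction `Alt (v ⌟ L)` is complex linear in `v`, so it drops out of the difference.
    have h1 : (ContinuousAlternatingMap.curryLeftLI.toContinuousLinearMap ∘L L).flip (T v) =
        Complex.I • (ContinuousAlternatingMap.curryLeftLI.toContinuousLinearMap ∘L L).flip v := by
      ext1 u
      exact (hL u).curryLeft_map v
    rw [h1, ContinuousAlternatingMap.alternatizeUncurryFin_smul]
    abel

theorem alternatize_isComplexLinear {L : Coord N →L[ℝ] Coord N [⋀^Fin k]→L[ℝ] ℂ}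
    (hL : ∀ u, IsComplexLinear T (L u)) (hT : ∀ u, L (T u) = Complex.I • L u) :
    IsComplexLinear T (ContinuousAlternatingMap.alternatizeUncurryFin L) :=
  isComplexLinear_of_curryLeft fun v => by
    have h := alternatize_curryLeft_map hL v
    rw [hT, sub_self] at h
    exact sub_eq_zero.1 h

/-- The anti-linear part `½ (L + i L ∘ T)` of a family of forms. -/
def antilinearPart (T : Coord N →L[ℝ] Coord N) (L : Coord N →L[ℝ] Coord N [⋀^Fin k]→L[ℝ] ℂ) :
    Coord N →L[ℝ] Coord N [⋀^Fin k]→L[ℝ] ℂ :=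
  (1 / 2 : ℂ) • (L + Complex.I • (L ∘L T))

theorem antilinearPart_apply (L : Coord N →L[ℝ] Coord N [⋀^Fin k]→L[ℝ] ℂ) (u : Coord N) :
    antilinearPart T L u = (1 / 2 : ℂ) • (L u + Complex.I • L (T u)) := rfl

/-- Alternation is injective on antilinear families. If `B` is the antilinear part then `B (T u) =
-i B u`, so `alternatize_curryLeft_map` recovers `-2i B u` from `Alt B`. -/
theorem alternatize_antilinearPart_eq_zero_iff {L : Coord N →L[ℝ] Coord N [⋀^Fin k]→L[ℝ] ℂ}
    (hL : ∀ u, IsComplexLinear T (L u)) (hT : ∀ u, L (T (T u)) = -L u) :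
    ContinuousAlternatingMap.alternatizeUncurryFin (antilinearPart T L) = 0 ↔
      ∀ u, L (T u) = Complex.I • L u := by
  constructor
  · intro h u
    have h1 := alternatize_curryLeft_map (T := T) (L := antilinearPart T L)
      (fun u => ((hL u).add ((hL _).smul _)).smul _) u
    rw [h, antilinearPart_apply, antilinearPart_apply, hT] at h1
    have h2 : Complex.I • (L u + Complex.I • L (T u)) = 0 := by
      have h3 : ∀ a b : Coord N [⋀^Fin k]→L[ℝ] ℂ, (1 / 2 : ℂ) • (b + Complex.I • -a) -
          Complex.I • (1 / 2 : ℂ) • (a + Complex.I • b) = -(Complex.I • (a + Complex.I • b)) :=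
        fun a b => by
          ext w
          simp only [ContinuousAlternatingMap.sub_apply, ContinuousAlternatingMap.add_apply,
            ContinuousAlternatingMap.smul_apply, ContinuousAlternatingMap.neg_apply, smul_eq_mul]
          linear_combination (1 / 2 * b w) * Complex.I_sq
      rw [h3] at h1
      rw [← neg_eq_zero, ← h1]
      ext w
      simp
    ext w
    have h5 : Complex.I * (L u w + Complex.I * L (T u) w) = 0 := DFunLike.congr_fun h2 w
    rw [ContinuousAlternatingMap.smul_apply, smul_eq_mul]
    have h6 := (mul_eq_zero.1 h5).resolve_left Complex.I_ne_zero
    linear_combination (-Complex.I) * h6 + L (T u) w * Complex.I_sq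
  · intro h
    have : antilinearPart T L = 0 := by
      ext1 u
      rw [antilinearPart_apply, h, smul_smul, Complex.I_mul_I]
      ext w
      change (1 / 2 : ℂ) * (L u w + -1 * L u w) = 0
      ring
    rw [this, ← ContinuousAlternatingMap.alternatizeUncurryFinCLM_apply, map_zero]

/-- The summands are the powers of `e^{4πi/n}`, an `n`-th root of unity that differs from `1`
because `n > 2` does not divide `2`. -/
theorem exp_sum_eq_zero (n : ℕ) (hn : 2 < n) :
    ∑ j ∈ Finset.range n, Complex.exp (2 * (2 * Real.pi * j / n : ℝ) * Complex.I) = 0 := by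
  have hn0 : (n : ℂ) ≠ 0 := by
    have : n ≠ 0 := by omega
    exact_mod_cast this
  set ζ := Complex.exp (4 * Real.pi * Complex.I / n) with hζ
  have h1 : ∀ j : ℕ, Complex.exp (2 * (2 * Real.pi * j / n : ℝ) * Complex.I) = ζ ^ j := fun j => by
    rw [hζ, ← Complex.exp_nat_mul]
    congr 1
    push_cast
    ring
  have h2 : ζ ≠ 1 := by
    intro h
    obtain ⟨m, hm⟩ := Complex.exp_eq_one_iff.1 h
    have h3 : (2 : ℂ) = m * n := by
      have hpi : (2 * Real.pi * Complex.I : ℂ) ≠ 0 := Complex.two_pi_I_ne_zero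
      rw [div_eq_iff hn0] at hm
      have h4 : (2 * Real.pi * Complex.I : ℂ) * (2 - m * n) = 0 := by
        linear_combination hm
      exact sub_eq_zero.1 ((mul_eq_zero.1 h4).resolve_left hpi)
    have h5 : (2 : ℤ) = m * n := by exact_mod_cast h3
    have h6 : (n : ℤ) ∣ 2 := ⟨m, by rw [h5]; ring⟩
    have := Int.le_of_dvd (by norm_num) h6
    omega
  have h3 : ζ ^ n = 1 := by
    rw [hζ, ← Complex.exp_nat_mul, Complex.exp_eq_one_iff]
    exact ⟨2, by field_simp; push_cast; ring⟩
  simp only [h1]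
  have h4 := geom_sum_mul ζ n
  rw [h3, sub_self] at h4
  exact (mul_eq_zero.1 h4).resolve_right (sub_ne_zero.2 h2)

end HolomorphicType

/-! ### The type `(r, 0)` and the `(r, 1)` component of an alternation -/

section TypeDecomposition

variable {N p k : ℕ} {M : Type*} [TopologicalSpace M] [T2Space M] [ChartedSpace (Coord N) M]
  [IsManifold (𝓡 N) ∞ M] {F : Foliation N p M} {g : Metric N M}
  {J : M → Coord N →L[ℝ] Coord N}

/-- A `(1, 0)`-covector satisfies `θ (J v) = i θ v`, so applying `J` to one argument multiplies one
column of the determinant by `i`. -/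
theorem isComplexLinear_of_mem_typeSpace (hJ : IsTransverseKahler F g J) {x : M} {r : ℕ}
    {α : Coord N [⋀^Fin (r + 0)]→L[ℝ] ℂ} (hα : α ∈ typeSpace F J x r 0) :
    IsComplexLinear (J x) α := by
  induction hα using Submodule.span_induction with
  | mem α h =>
    obtain ⟨θ, h1, -, h2⟩ := h
    intro w j
    have hθ : ∀ i v, θ i (J x v) = Complex.I * θ i v := fun i v => by
      obtain ⟨θ₀, h3, h4⟩ := h1 i i.2
      have h5 := h3 _ (sub_proj_mem_tangent F g x v)
      rw [map_sub, sub_eq_zero] at h5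
      rw [h4, h4, hJ.sq, map_neg, ← h5]
      push_cast
      linear_combination (θ₀ (J x v) : ℂ) * Complex.I_sq
    rw [h2, h2]
    have h6 := Matrix.det_updateCol_smul (Matrix.of fun i j => θ i (w j)) j Complex.I
      (fun i => θ i (w j))
    have h7 : (Matrix.of fun i j => θ i (w j)).updateCol j (fun i => θ i (w j)) =
        Matrix.of fun i j => θ i (w j) := by
      ext a b
      rcases eq_or_ne b j with rfl | hb
      · simp
      · simp [hb]
    rw [h7] at h6
    rw [← h6]
    congr 1
    ext a b
    rcases eq_or_ne b j with rfl | hb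
    · simp [hθ]
    · simp [hb]
  | zero => intro w j; simp
  | add α β _ _ hα hβ => exact hα.add hβ
  | smul c α _ hα => exact hα.smul c

/-- Split `L` into its complex linear and antilinear parts. Under rotation by `t` their alternations
`X` and `Y` have weights `r + 1` and `r - 1`; the averaging that defines the `(r, 1)` component
keeps weight `r - 1` and kills weight `r + 1`. -/
theorem typePart_alternatize {x : M} {r : ℕ}
    {L : Coord N →L[ℝ] Coord N [⋀^Fin r]→L[ℝ] ℂ} (hL : ∀ u, IsComplexLinear (J x) (L u)) :
    typePart J x r (0 + 1) (ContinuousAlternatingMap.alternatizeUncurryFin L) =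
      ContinuousAlternatingMap.alternatizeUncurryFin (antilinearPart (J x) L) := by
  set Y := ContinuousAlternatingMap.alternatizeUncurryFin (antilinearPart (J x) L) with hY
  set X := ContinuousAlternatingMap.alternatizeUncurryFin (L - antilinearPart (J x) L) with hX
  -- The `r` slots of `L u` contribute `e^{irt}`; the direction slot gives `cos t L + sin t L∘J`,
  -- which is `e^{it}` times the linear part plus `e^{-it}` times the antilinear part.
  have key : ∀ t : ℝ, (ContinuousAlternatingMap.alternatizeUncurryFin L).compContinuousLinearMap
      (rotation J x t) = Complex.exp ((r + 1) * t * Complex.I) • X +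
        Complex.exp ((r - 1) * t * Complex.I) • Y := fun t => by
    ext w
    rw [ContinuousAlternatingMap.compContinuousLinearMap_apply,
      ContinuousAlternatingMap.alternatizeUncurryFin_apply, ContinuousAlternatingMap.add_apply,
      ContinuousAlternatingMap.smul_apply, ContinuousAlternatingMap.smul_apply, hX, hY,
      ContinuousAlternatingMap.alternatizeUncurryFin_apply,
      ContinuousAlternatingMap.alternatizeUncurryFin_apply, Finset.smul_sum, Finset.smul_sum,
      ← Finset.sum_add_distrib]
    refine Finset.sum_congr rfl fun i _ => ?_
    have h1 := DFunLike.congr_fun ((hL (rotation J x t (w i))).compContinuousLinearMap_rotation t)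
      (i.removeNth w)
    rw [ContinuousAlternatingMap.compContinuousLinearMap_apply] at h1
    change (-1 : ℤ) ^ (i : ℕ) • (L (rotation J x t (w i))) (rotation J x t ∘ i.removeNth w) = _
    refine (congrArg _ h1).trans ?_
    have h2 : L (rotation J x t (w i)) (i.removeNth w) =
        Complex.cos t * L (w i) (i.removeNth w) +
          Complex.sin t * L (J x (w i)) (i.removeNth w) := by
      rw [rotation, _root_.add_apply, smul_apply, smul_apply, map_add, map_smul, map_smul]
      simp
    rw [ContinuousAlternatingMap.smul_apply, h2, smul_comm _ ((-1 : ℤ) ^ (i : ℕ)),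
      smul_comm _ ((-1 : ℤ) ^ (i : ℕ)), ← smul_add]
    congr 1
    rw [_root_.sub_apply, ContinuousAlternatingMap.sub_apply, antilinearPart_apply,
      ContinuousAlternatingMap.smul_apply, ContinuousAlternatingMap.add_apply,
      ContinuousAlternatingMap.smul_apply]
    simp only [smul_eq_mul]
    have e1 : Complex.exp ((r + 1) * t * Complex.I) = Complex.exp (r * t * Complex.I) *
        (Complex.cos t + Complex.sin t * Complex.I) := by
      rw [← Complex.exp_mul_I, ← Complex.exp_add]
      ring_nf
    have e2 : Complex.exp ((r - 1) * t * Complex.I) = Complex.exp (r * t * Complex.I) *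
        (Complex.cos t - Complex.sin t * Complex.I) := by
      have : Complex.cos t - Complex.sin t * Complex.I = Complex.exp (-t * Complex.I) := by
        rw [Complex.exp_mul_I, Complex.cos_neg, Complex.sin_neg]
        ring
      rw [this, ← Complex.exp_add]
      ring_nf
    rw [e1, e2]
    linear_combination (Complex.exp (r * t * Complex.I) * Complex.sin t *
      L (J x (w i)) (i.removeNth w)) * Complex.I_sq
  set n := 2 * (r + (0 + 1)) + 1 with hn
  have h1 : ∀ j : ℕ, Complex.exp (-(((r : ℂ) - ((0 + 1 : ℕ) : ℂ)) *
      ((2 * Real.pi * j / (2 * (r + ((0 + 1 : ℕ) : ℝ)) + 1) : ℝ) : ℂ) * Complex.I)) •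
      (ContinuousAlternatingMap.alternatizeUncurryFin L).compContinuousLinearMap
        (rotation J x (2 * Real.pi * j / (2 * (r + ((0 + 1 : ℕ) : ℝ)) + 1))) =
      Complex.exp (2 * (2 * Real.pi * j / n : ℝ) * Complex.I) • X + Y := fun j => by
    rw [key, smul_add, smul_smul, smul_smul, ← Complex.exp_add, ← Complex.exp_add]
    have hn' : (2 * (r + ((0 + 1 : ℕ) : ℝ)) + 1) = (n : ℝ) := by
      rw [hn]; push_cast; ring
    rw [hn']
    congr 1
    · congr 2
      push_cast
      ring
    · have : ∀ t : ℂ, -(((r : ℂ) - ((0 + 1 : ℕ) : ℂ)) * t * Complex.I) +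
          (r - 1) * t * Complex.I = 0 := fun t => by push_cast; ring
      rw [this, Complex.exp_zero, one_smul]
  have hn0 : ((2 : ℂ) * (r + ((0 + 1 : ℕ) : ℂ)) + 1) = n := by rw [hn]; push_cast; ring
  have hne : (n : ℂ) ≠ 0 := by exact_mod_cast (by omega : n ≠ 0)
  rw [typePart]
  simp only [h1]
  -- The relative weight is `2`, and the number of sample angles is `n = 2 (r + 1) + 1 ≥ 3`.
  rw [Finset.sum_add_distrib, ← Finset.sum_smul, exp_sum_eq_zero n (by omega), zero_smul]
  have h2 : (0 : Coord N [⋀^Fin (r + 1)]→L[ℝ] ℂ) + ∑ _j ∈ Finset.range n, Y = (n : ℂ) • Y := by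
    rw [zero_add, Finset.sum_const, Finset.card_range, Nat.cast_smul_eq_nsmul]
  refine (congrArg _ h2).trans ?_
  rw [hn0, smul_smul, one_div, inv_mul_cancel₀ hne, one_smul]

end TypeDecomposition

/-! ### The twisted covariant derivative and holomorphy -/

section TwistedDerivative

variable {N p k : ℕ} {M : Type*} [TopologicalSpace M] [T2Space M] [ChartedSpace (Coord N) M]
  [IsManifold (𝓡 N) ∞ M] {F : Foliation N p M} {g : Metric N M}
  {J : M → Coord N →L[ℝ] Coord N} {κB : Form N M ℝ 1} {φ : Form N M ℂ k}

theorem covector_apply (κB : Form N M ℝ 1) (x : M) (u : Coord N) :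
    covector κB x u = κB x fun _ => u := rfl

theorem IsBasic.covector_tangent (hκ : IsBasic F κB) {x : M} {u : Coord N}
    (hu : u ∈ F.tangent x) : covector κB x u = 0 :=
  hκ.horizontal x _ ⟨0, hu⟩

theorem IsBasic.covector_proj (g : Metric N M) (hκ : IsBasic F κB) (x : M) (u : Coord N) :
    covector κB x (proj F g x u) = covector κB x u := by
  have h := hκ.covector_tangent (sub_proj_mem_tangent F g x u)
  rw [map_sub, sub_eq_zero] at h
  exact h.symm

theorem IsBasic.sharp_covector (g : Metric N M) (hκ : IsBasic F κB) (x : M) :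
    sharp g x (covector κB x) = cometric F g x (covector κB x) := by
  have h : sharp g x (covector κB x) ∈ normal F g x := fun u hu => by
    rw [Metric.bilin_symm, bilin_sharp, hκ.covector_tangent hu]
  exact (proj_of_mem_normal F g x h).symm

theorem wedge_ofReal (ξ : Coord N →L[ℝ] ℝ) (α : Coord N [⋀^Fin k]→L[ℝ] ℂ) :
    wedge (Complex.ofRealCLM ∘L ξ) α =
      ContinuousAlternatingMap.alternatizeUncurryFin (ξ.smulRight α) := by
  rw [wedge]
  congr 1

/-- The twisted covariant derivative `u ↦ ∇_u φ - ½ κB(u) φ`. -/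
def twistedCovDeriv (F : Foliation N p M) (g : Metric N M) (κB : Form N M ℝ 1) (φ : Form N M ℂ k)
    (x : M) : Coord N →L[ℝ] Coord N [⋀^Fin k]→L[ℝ] ℂ :=
  covDerivL F g φ x - (1 / 2 : ℝ) • (covector κB x).smulRight (φ x)

theorem twistedCovDeriv_apply (F : Foliation N p M) (g : Metric N M) (κB : Form N M ℝ 1)
    (φ : Form N M ℂ k) (x : M) (u : Coord N) :
    twistedCovDeriv F g κB φ x u =
      covDeriv F g φ x u - (1 / 2 : ℝ) • covector κB x u • φ x := by
  rw [twistedCovDeriv, _root_.sub_apply, covDerivL_apply]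
  rfl

theorem dKappa_eq_alternatize (F : Foliation N p M) (g : Metric N M) (κB : Form N M ℝ 1)
    (φ : Form N M ℂ k) (x : M) :
    dKappa κB φ x =
      ContinuousAlternatingMap.alternatizeUncurryFin (twistedCovDeriv F g κB φ x) := by
  rw [dKappa, extD_eq_alternatize F g, wedge_ofReal, twistedCovDeriv,
    ← ContinuousAlternatingMap.alternatizeUncurryFinCLM_apply,
    ← ContinuousAlternatingMap.alternatizeUncurryFinCLM_apply,
    ← ContinuousAlternatingMap.alternatizeUncurryFinCLM_apply, map_sub, map_smul]

/-- The bilinear map `(u, v) ↦ v ⌟ L u`. -/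
def curryOf (L : Coord N →L[ℝ] Coord N [⋀^Fin (k + 1)]→L[ℝ] ℂ) :
    Coord N →ₗ[ℝ] Coord N →ₗ[ℝ] Coord N [⋀^Fin k]→L[ℝ] ℂ :=
  LinearMap.mk₂ ℝ (fun u v => (L u).curryLeft v) (fun u u' v => by rw [map_add]; rfl)
    (fun c u v => by rw [map_smul]; rfl) (fun u v v' => map_add _ _ _) (fun c u v => map_smul _ _ _)

theorem curryOf_apply (L : Coord N →L[ℝ] Coord N [⋀^Fin (k + 1)]→L[ℝ] ℂ) (u v : Coord N) :
    curryOf L u v = (L u).curryLeft v := rfl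

theorem deltaT_eq_traceWith (F : Foliation N p M) (g : Metric N M) (φ : Form N M ℂ (k + 1)) (x : M) :
    deltaT F g φ x = -traceWith (cometric F g x) (curryOf (covDerivL F g φ x)) := by
  rw [deltaT, traceWith_cometric]
  congr 1
  refine Finset.sum_congr rfl fun a _ => ?_
  rw [curryOf_apply, covDerivL_apply, interior]

theorem traceWith_smulRight (F : Foliation N p M) (g : Metric N M) (x : M) (ξ : Coord N →L[ℝ] ℝ)
    (α : Coord N [⋀^Fin (k + 1)]→L[ℝ] ℂ) :
    traceWith (cometric F g x) (curryOf (ξ.smulRight α)) = α.curryLeft (cometric F g x ξ) := by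
  rw [← traceWith_flip]
  have h : ∀ i, curryOf (ξ.smulRight α) (stdVec i) (cometric F g x (stdCovec i)) =
      α.curryLeft (cometric F g x (ξ (stdVec i) • stdCovec i)) := fun i => by
    rw [map_smul, map_smul]
    rfl
  simp only [h]
  rw [← map_sum, ← map_sum, sum_smul_stdCovec]

/-- The coefficients combine as `1 - ½ = ½`, so `δ_κ = δ_T + ½ κB♯ ⌟` is minus the trace of the same
operator `∇ - ½ κB ⊗` whose alternation is `d_κ`. From here the twist no longer appears explicitly
in the Kähler identity. -/
theorem deltaKappa_eq_traceWith (hκ : IsBasic F κB) (φ : Form N M ℂ (k + 1)) (x : M) :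
    deltaKappa F g κB φ x =
      -traceWith (cometric F g x) (curryOf (twistedCovDeriv F g κB φ x)) := by
  have h : ∀ u v, curryOf (twistedCovDeriv F g κB φ x) u v = curryOf (covDerivL F g φ x) u v -
      (1 / 2 : ℝ) • curryOf ((covector κB x).smulRight (φ x)) u v := fun u v => rfl
  have h1 : traceWith (cometric F g x) (curryOf (twistedCovDeriv F g κB φ x)) =
      traceWith (cometric F g x) (curryOf (covDerivL F g φ x)) -
        (1 / 2 : ℝ) • (φ x).curryLeft (cometric F g x (covector κB x)) := by
    rw [← traceWith_smulRight, traceWith, traceWith, traceWith, Finset.smul_sum,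
      ← Finset.sum_sub_distrib]
    exact Finset.sum_congr rfl fun i _ => h _ _
  rw [h1, deltaKappa, deltaB, deltaT_eq_traceWith, interior, hκ.sharp_covector g]
  module

theorem twistedCovDeriv_tangent (hg : IsBundleLike F g) (hκ : IsBasic F κB) (hφ : IsBasic F φ)
    {x : M} {u : Coord N} (hu : u ∈ F.tangent x) : twistedCovDeriv F g κB φ x u = 0 := by
  rw [twistedCovDeriv_apply, hφ.covDeriv_eq_zero hg hu, hκ.covector_tangent hu]
  module

theorem twistedCovDeriv_vanishesOn (hg : IsBundleLike F g) (hφ : IsBasic F φ) (x : M)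
    (u : Coord N) : VanishesOn (F.tangent x) (twistedCovDeriv F g κB φ x u) := fun w hw => by
  rw [twistedCovDeriv_apply, ContinuousAlternatingMap.sub_apply,
    hφ.covDeriv_vanishesOn hg x u w hw, ContinuousAlternatingMap.smul_apply,
    ContinuousAlternatingMap.smul_apply, hφ.horizontal x w hw]
  simp

/-- `J² = -π`, and the twisted derivative of a basic form ignores the leaf component of the
direction. -/
theorem twistedCovDeriv_J_J (hJ : IsTransverseKahler F g J) (hκ : IsBasic F κB) (hφ : IsBasic F φ)
    (x : M) (u : Coord N) : twistedCovDeriv F g κB φ x (J x (J x u)) =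
      -twistedCovDeriv F g κB φ x u := by
  have h := twistedCovDeriv_tangent hJ.bundleLike hκ hφ (sub_proj_mem_tangent F g x u)
  rw [map_sub, sub_eq_zero] at h
  rw [hJ.sq, map_neg, ← h]

theorem derivationAct_smul (A : Coord N →L[ℝ] Coord N) (c : ℂ) (α : Coord N [⋀^Fin k]→L[ℝ] ℂ) :
    derivationAct A (c • α) = c • derivationAct A α := by
  ext v
  simp [derivationAct_apply, Finset.mul_sum]

/-- Differentiate `J v ⌟ φ = i (v ⌟ φ)`; as `J` is parallel, the Christoffel terms recombine into
`∇_u φ` on both sides. -/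
theorem covDeriv_isComplexLinear (hJ : IsTransverseKahler F g J) :
    ∀ {k : ℕ} {φ : Form N M ℂ k}, IsBasic F φ → (∀ x, IsComplexLinear (J x) (φ x)) →
    ∀ (x : M) (u : Coord N), IsComplexLinear (J x) (covDeriv F g φ x u)
  | 0, φ, _, _, x, u => fun w j => j.elim0
  | k + 1, φ, hφ, hc, x, u => isComplexLinear_of_curryLeft fun v => by
    have hd := (hφ.smooth.differentiableAt (base_mem_target (N := N) x)).hasFDerivAt
    have hE : HasFDerivAt (fun y => coordEnd x J y v)
        ((ContinuousLinearMap.apply ℝ (Coord N) v) ∘L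
          fderiv ℝ (coordEnd x J) (extChartAt (𝓡 N) x x)) (extChartAt (𝓡 N) x x) :=
      (ContinuousLinearMap.apply ℝ (Coord N) v).hasFDerivAt.comp (extChartAt (𝓡 N) x x)
        (hJ.differentiableAt_coordEnd x).hasFDerivAt
    have h1 := hasFDerivAt_curryLeft hd hE
    have h2 := (hasFDerivAt_curryLeft hd (hasFDerivAt_const v (extChartAt (𝓡 N) x x))).const_smul
      Complex.I
    have h3 : (fun y => (coordForm x φ y).curryLeft (coordEnd x J y v))
        =ᶠ[𝓝 (extChartAt (𝓡 N) x x)] fun y => Complex.I • (coordForm x φ y).curryLeft v := by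
      filter_upwards [target_mem_nhds (base_mem_target (N := N) x)] with y hy
      have h4 : coordForm x φ y = (φ ((extChartAt (𝓡 N) x).symm y)).compContinuousLinearMap
        (chartSymmDeriv x y) := rfl
      rw [h4, ContinuousAlternatingMap.curryLeft_compContinuousLinearMap,
        ContinuousAlternatingMap.curryLeft_compContinuousLinearMap, coordEnd_apply,
        chartSymmDeriv_chartDeriv hy, (hc _).curryLeft_map]
      rfl
    have h5 := DFunLike.congr_fun ((h1.congr_of_eventuallyEq h3.symm).unique h2) u
    simp only [coordForm_base, coordEnd_base] at h5
    have h6 : (φ x).curryLeft (fderiv ℝ (coordEnd x J) (extChartAt (𝓡 N) x x) u v) +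
        (fderiv ℝ (coordForm x φ) (extChartAt (𝓡 N) x x) u).curryLeft (J x v) =
        Complex.I • ((φ x).curryLeft 0 +
          (fderiv ℝ (coordForm x φ) (extChartAt (𝓡 N) x x) u).curryLeft v) := h5
    rw [hJ.fderiv_coordEnd_eq, map_zero, zero_add, map_sub, (hc x).curryLeft_map] at h6
    have h7 : ∀ w, (covDeriv F g φ x u).curryLeft w =
        (fderiv ℝ (coordForm x φ) (extChartAt (𝓡 N) x x) u).curryLeft w -
          (derivationAct (adaptedConn F g x u) ((φ x).curryLeft w) +
            (φ x).curryLeft (adaptedConn F g x u w)) := fun w => by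
      rw [← derivationAct_curryLeft, covDeriv_eq (hφ.vanishesOn x)]
      rfl
    rw [h7, h7, (hc x).curryLeft_map, derivationAct_smul, eq_sub_of_add_eq' h6]
    ext w
    simp only [ContinuousAlternatingMap.sub_apply, ContinuousAlternatingMap.add_apply,
      ContinuousAlternatingMap.smul_apply, smul_eq_mul]
    ring

theorem twistedCovDeriv_isComplexLinear (hJ : IsTransverseKahler F g J) (hφ : IsBasic F φ)
    (hc : ∀ x, IsComplexLinear (J x) (φ x)) (x : M) (u : Coord N) :
    IsComplexLinear (J x) (twistedCovDeriv F g κB φ x u) := by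
  rw [twistedCovDeriv_apply]
  exact (covDeriv_isComplexLinear hJ hφ hc x u).sub (((hc x).real_smul _).real_smul _)

/-- `∂̄_B φ` is the alternation of the antilinear part of `∇φ`, and `κB^{0,1}` is the antilinear
part of `κB`, so the two terms combine before alternating. -/
theorem dbarKappa_eq_alternatize (hJ : IsTransverseKahler F g J) {r : ℕ} {φ : Form N M ℂ r}
    (hφ : IsBasic F φ) (hc : ∀ x, IsComplexLinear (J x) (φ x)) (x : M) :
    dbarKappa J κB r 0 φ x = ContinuousAlternatingMap.alternatizeUncurryFin
      (antilinearPart (J x) (twistedCovDeriv F g κB φ x)) := by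
  have h1 : dbarKappa J κB r 0 φ x = typePart J x r (0 + 1) (extD φ x) -
    (1 / 2 : ℝ) • wedge (kappa01 J κB x) (φ x) := rfl
  have h2 := typePart_alternatize (J := J) (x := x) (L := covDerivL F g φ x)
    fun u => by rw [covDerivL_apply]; exact covDeriv_isComplexLinear hJ hφ hc x u
  rw [h1, extD_eq_alternatize F g, h2, wedge,
    ← ContinuousAlternatingMap.alternatizeUncurryFinCLM_apply,
    ← ContinuousAlternatingMap.alternatizeUncurryFinCLM_apply,
    ← ContinuousAlternatingMap.alternatizeUncurryFinCLM_apply, ← map_smul, ← map_sub]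
  congr 1
  ext u w
  rw [_root_.sub_apply, smul_apply, antilinearPart_apply, antilinearPart_apply,
    twistedCovDeriv_apply, twistedCovDeriv_apply, covDerivL_apply, covDerivL_apply]
  simp only [ContinuousAlternatingMap.sub_apply, ContinuousAlternatingMap.add_apply,
      ContinuousAlternatingMap.smul_apply, smul_eq_mul, Complex.real_smul]
  have h3 : ((((ContinuousLinearMap.lsmul ℝ ℂ :
      ℂ →L[ℝ] (Coord N [⋀^Fin r]→L[ℝ] ℂ) →L[ℝ] (Coord N [⋀^Fin r]→L[ℝ] ℂ)).flip (φ x)) ∘L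
      kappa01 J κB x) u) w = (1 / 2 : ℂ) * (covector κB x u + Complex.I * covector κB x (J x u)) *
        φ x w := rfl
  rw [h3]
  push_cast
  ring

theorem isKappaHolomorphic_iff (hJ : IsTransverseKahler F g J) (hκ : IsBasic F κB) {r : ℕ}
    {φ : Form N M ℂ r} (hφ : IsBasic F φ) (hc : ∀ x, IsComplexLinear (J x) (φ x)) :
    IsKappaHolomorphic J κB r 0 φ ↔ ∀ x u, twistedCovDeriv F g κB φ x (J x u) =
      Complex.I • twistedCovDeriv F g κB φ x u := by
  have h : ∀ x, dbarKappa J κB r 0 φ x = 0 ↔ ∀ u, twistedCovDeriv F g κB φ x (J x u) =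
      Complex.I • twistedCovDeriv F g κB φ x u := fun x => by
    rw [dbarKappa_eq_alternatize hJ hφ hc]
    exact alternatize_antilinearPart_eq_zero_iff (twistedCovDeriv_isComplexLinear hJ hφ hc x)
      (twistedCovDeriv_J_J hJ hκ hφ x)
  rw [IsKappaHolomorphic, funext_iff]
  exact forall_congr' h

end TwistedDerivative

/-! ### The Kähler identity `δ_κ = (i/2) Λ d_κ` in type `(r, 0)` -/

section KahlerIdentity

variable {N p k : ℕ} {M : Type*} [TopologicalSpace M] [T2Space M] [ChartedSpace (Coord N) M]
  [IsManifold (𝓡 N) ∞ M] {F : Foliation N p M} {g : Metric N M}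
  {J : M → Coord N →L[ℝ] Coord N} {κB : Form N M ℝ 1}

theorem curryCurry_swap (α : Coord N [⋀^Fin (k + 2)]→L[ℝ] ℂ) (u v : Coord N) :
    curryCurry α u v = -curryCurry α v u := by
  ext w
  rw [curryCurry_apply, curryCurry_apply, ContinuousAlternatingMap.neg_apply,
    ContinuousAlternatingMap.curryLeft_apply_apply,
    ContinuousAlternatingMap.curryLeft_apply_apply,
    ContinuousAlternatingMap.curryLeft_apply_apply,
    ContinuousAlternatingMap.curryLeft_apply_apply]
  have h2 := α.toAlternatingMap.map_swap (Matrix.vecCons v (Matrix.vecCons u w))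
    (i := 0) (j := 1) (by simp)
  refine Eq.trans (congrArg α ?_) h2
  funext i
  refine Fin.cases ?_ (fun i => Fin.cases ?_ (fun i => ?_) i) i
  · simp
  · simp
  · have : Equiv.swap (0 : Fin (k + 2)) 1 i.succ.succ = i.succ.succ :=
      Equiv.swap_apply_of_ne_of_ne (Fin.succ_ne_zero _)
        (fun h => Fin.succ_ne_zero i (Fin.succ_injective _ h))
    simp [this]

/-- A symmetric trace of an alternating expression. -/
theorem traceWith_curryCurry_eq_zero (F : Foliation N p M) (g : Metric N M) (x : M)
    (α : Coord N [⋀^Fin (k + 2)]→L[ℝ] ℂ) :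
    traceWith (cometric F g x) (curryCurry α) = 0 := by
  have h := traceWith_flip F g x (curryCurry α)
  have h3 : ∑ i, curryCurry α (stdVec i) (cometric F g x (stdCovec i)) =
      -traceWith (cometric F g x) (curryCurry α) := by
    rw [traceWith, ← Finset.sum_neg_distrib]
    exact Finset.sum_congr rfl fun i _ => curryCurry_swap α _ _
  rw [h3] at h
  ext w
  exact self_eq_neg.1 (DFunLike.congr_fun h w).symm

/-- Expanding the second interior product leaves the alternation of `∑ J e_i ⌟ A eⁱ ⌟ L_u`, with `A`
the cometric. Complex linearity replaces `J` by `i`, and the remaining trace of an alternating form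
is zero. -/
theorem sum_alternatize_flip_curryLeft {x : M} {L : Coord N →L[ℝ] Coord N [⋀^Fin (k + 1)]→L[ℝ] ℂ}
    (hL : ∀ u, IsComplexLinear (J x) (L u)) :
    ∑ i, (ContinuousAlternatingMap.alternatizeUncurryFin
        ((ContinuousAlternatingMap.curryLeftLI.toContinuousLinearMap ∘L L).flip
          (cometric F g x (stdCovec i)))).curryLeft (J x (stdVec i)) =
      ∑ i, (L (J x (stdVec i))).curryLeft (cometric F g x (stdCovec i)) := by
  cases k with
  | zero =>
    refine Finset.sum_congr rfl fun i _ => ?_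
    rw [alternatize_curryLeft_zero]
    rfl
  | succ k =>
    have h1 : ∀ a b, (ContinuousAlternatingMap.alternatizeUncurryFin
        ((ContinuousAlternatingMap.curryLeftLI.toContinuousLinearMap ∘L L).flip a)).curryLeft b =
        (L b).curryLeft a -
        ContinuousAlternatingMap.alternatizeUncurryFinCLM ℝ (Coord N) ℂ
          ((ContinuousAlternatingMap.curryLeftLI.toContinuousLinearMap ∘L
            ((ContinuousAlternatingMap.curryLeftLI.toContinuousLinearMap ∘L L).flip a)).flip b) :=
      fun a b => alternatize_curryLeft _ b
    simp only [h1]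
    rw [Finset.sum_sub_distrib, ← map_sum]
    have h2 : ∑ i, ((ContinuousAlternatingMap.curryLeftLI.toContinuousLinearMap ∘L
            ((ContinuousAlternatingMap.curryLeftLI.toContinuousLinearMap ∘L L).flip
              (cometric F g x (stdCovec i)))).flip (J x (stdVec i))) = 0 := by
      ext1 u
      rw [_root_.sum_apply]
      have h3 : ∀ a b, ((ContinuousAlternatingMap.curryLeftLI.toContinuousLinearMap ∘L
            ((ContinuousAlternatingMap.curryLeftLI.toContinuousLinearMap ∘L L).flip
              a)).flip (J x b)) u = Complex.I • curryCurry (L u) a b := fun a b =>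
        ((hL u).curryLeft a).curryLeft_map b
      simp only [h3]
      rw [← Finset.smul_sum]
      have h4 := traceWith_curryCurry_eq_zero F g x (L u)
      rw [traceWith] at h4
      rw [h4]
      exact smul_zero _
    rw [h2, map_zero, sub_zero]

/-- The Kähler identity for a family `L` of complex linear forms. -/
theorem contract_alternatize (hJ : IsTransverseKahler F g J) {x : M}
    {L : Coord N →L[ℝ] Coord N [⋀^Fin (k + 1)]→L[ℝ] ℂ} (hL : ∀ u, IsComplexLinear (J x) (L u))
    (hT : ∀ u, L (J x (J x u)) = -L u) :
    ∑ i, ((ContinuousAlternatingMap.alternatizeUncurryFin L).curryLeft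
        (cometric F g x (stdCovec i))).curryLeft (J x (stdVec i)) =
      (2 * Complex.I) • traceWith (cometric F g x) (curryOf L) := by
  have t1 : ∑ i, (L (cometric F g x (stdCovec i))).curryLeft (J x (stdVec i)) =
      Complex.I • traceWith (cometric F g x) (curryOf L) := by
    rw [traceWith, Finset.smul_sum]
    exact Finset.sum_congr rfl fun i _ => (hL _).curryLeft_map _
  -- Replacing the frame by its image under `J` turns the summand into `L (J J e) (J e', …)`, where
  -- `J² = -1` in the direction slot gives the sign and the form slot gives `i`.
  have t2 : ∑ i, (L (J x (stdVec i))).curryLeft (cometric F g x (stdCovec i)) =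
      -(Complex.I • traceWith (cometric F g x) (curryOf L)) := by
    have h1 := hJ.traceWith_J x ((curryOf L).comp (J x).toLinearMap).flip
    have h2 : ∀ i, ((curryOf L).comp (J x).toLinearMap).flip
        (J x (cometric F g x (stdCovec i))) (J x (stdVec i)) =
        -(Complex.I • curryOf L (stdVec i) (cometric F g x (stdCovec i))) := fun i => by
      change (L (J x (J x (stdVec i)))).curryLeft (J x (cometric F g x (stdCovec i))) = _
      rw [hT, (hL _).neg.curryLeft_map]
      ext w
      change Complex.I * -_ = -(Complex.I * _)
      rw [mul_neg]
      rfl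
    simp only [h2] at h1
    rw [← traceWith_flip, Finset.smul_sum, ← Finset.sum_neg_distrib, h1]
    rfl
  have t3 : ∀ i, ((ContinuousAlternatingMap.alternatizeUncurryFin L).curryLeft
        (cometric F g x (stdCovec i))) = L (cometric F g x (stdCovec i)) -
      ContinuousAlternatingMap.alternatizeUncurryFin
        ((ContinuousAlternatingMap.curryLeftLI.toContinuousLinearMap ∘L L).flip
          (cometric F g x (stdCovec i))) := fun i => alternatize_curryLeft L _
  have key := sum_alternatize_flip_curryLeft (F := F) (g := g) hL
  have h : ∀ i, ((ContinuousAlternatingMap.alternatizeUncurryFin L).curryLeft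
        (cometric F g x (stdCovec i))).curryLeft (J x (stdVec i)) =
      (L (cometric F g x (stdCovec i))).curryLeft (J x (stdVec i)) -
      (ContinuousAlternatingMap.alternatizeUncurryFin
        ((ContinuousAlternatingMap.curryLeftLI.toContinuousLinearMap ∘L L).flip
          (cometric F g x (stdCovec i)))).curryLeft (J x (stdVec i)) := fun i => by
    rw [t3]
    rfl
  simp only [h]
  rw [Finset.sum_sub_distrib, key, t1, t2]
  ext w
  change Complex.I * _ - -(Complex.I * _) = 2 * Complex.I * _
  ring

/-- Both sides are `-tr D`, since `Λ (Alt D) = 2i tr D` and `(i/2) · 2i = -1`. Besides its use for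
harmonicity, this expresses `δ_κ φ` by operators that preserve basic forms. -/
theorem deltaKappa_eq_kahlerContract (hJ : IsTransverseKahler F g J) (hκ : IsBasic F κB)
    {φ : Form N M ℂ (k + 1)} (hφ : IsBasic F φ) (hc : ∀ x, IsComplexLinear (J x) (φ x)) :
    deltaKappa F g κB φ = (Complex.I / 2) • kahlerContract F g J (dKappa κB φ) := by
  funext x
  have h := contract_alternatize hJ (twistedCovDeriv_isComplexLinear (κB := κB) hJ hφ hc x)
    (twistedCovDeriv_J_J hJ hκ hφ x)
  rw [← dKappa_eq_alternatize] at h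
  have h1 : kahlerContract F g J (dKappa κB φ) x = _ := h
  rw [Pi.smul_apply, h1, deltaKappa_eq_traceWith hκ]
  ext w
  change -_ = Complex.I / 2 * (2 * Complex.I * _)
  linear_combination (-(traceWith (cometric F g x) (curryOf (twistedCovDeriv F g κB φ x)) w)) *
    Complex.I_sq

end KahlerIdentity

/-! ### Derivative of a tensor product `ξ ⊗ a` -/

section Tensor

variable {E F : Type*} [NormedAddCommGroup E] [NormedSpace ℝ E] [NormedAddCommGroup F]
  [NormedSpace ℝ F]

theorem HasFDerivAt.clm_map {G K : Type*} [NormedAddCommGroup G] [NormedSpace ℝ G]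
    [NormedAddCommGroup K] [NormedSpace ℝ K] {L : E → G} (Φ : G →L[ℝ] K) {L' : E →L[ℝ] G} {y : E}
    (h : HasFDerivAt L L' y) : HasFDerivAt (fun y => Φ (L y)) (Φ ∘L L') y :=
  Φ.hasFDerivAt.comp y h

/-- The derivative of `y ↦ ξ_y ⊗ a_y`, where `b` and `D` are the derivatives of `ξ` and `a`. -/
def tensorDeriv (ξ : E →L[ℝ] ℝ) (b : E →L[ℝ] E →L[ℝ] ℝ) (a : F) (D : E →L[ℝ] F) :
    E →L[ℝ] E →L[ℝ] F :=
  (ContinuousLinearMap.smulRightL ℝ E F ξ) ∘L D +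
    ((ContinuousLinearMap.smulRightL ℝ E F).flip a) ∘L b

theorem hasFDerivAt_smulRight {ξ : E → E →L[ℝ] ℝ} {b : E →L[ℝ] E →L[ℝ] ℝ} {a : E → F}
    {D : E →L[ℝ] F} {y : E} (hξ : HasFDerivAt ξ b y) (ha : HasFDerivAt a D y) :
    HasFDerivAt (fun y => (ξ y).smulRight (a y)) (tensorDeriv (ξ y) b (a y) D) y :=
  (ContinuousLinearMap.smulRightL ℝ E F).hasFDerivAt_of_bilinear hξ ha

theorem contDiffOn_smulRight {ξ : E → E →L[ℝ] ℝ} {a : E → F} {s : Set E}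
    (hξ : ContDiffOn ℝ ∞ ξ s) (ha : ContDiffOn ℝ ∞ a s) :
    ContDiffOn ℝ ∞ (fun y => (ξ y).smulRight (a y)) s :=
  hξ.smulRight ha

/-- `tensorDeriv ξ b a D + ξ ⊗ (D - ½ ξ ⊗ a)`. -/
def tensorDerivSum (ξ : E →L[ℝ] ℝ) (b : E →L[ℝ] E →L[ℝ] ℝ) (a : F) (D : E →L[ℝ] F) :
    E →L[ℝ] E →L[ℝ] F :=
  tensorDeriv ξ b a D + ξ.smulRight (D - (1 / 2 : ℝ) • ξ.smulRight a)

/-- The terms are `ξ(v) D u + ξ(u) D v`, `b(u, v) a` and `-½ ξ(u) ξ(v) a`, each symmetric in `u` and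
`v`. Double alternation annihilates such a tensor, which gives `d_κ² = 0` without a Leibniz rule for
the wedge product. -/
theorem tensorDerivSum_symm {ξ : E →L[ℝ] ℝ} {b : E →L[ℝ] E →L[ℝ] ℝ} (hb : ∀ u v, b u v = b v u)
    (a : F) (D : E →L[ℝ] F) (u v : E) :
    tensorDerivSum ξ b a D u v = tensorDerivSum ξ b a D v u := by
  have h : ∀ u v, tensorDerivSum ξ b a D u v = ξ v • D u + b u v • a +
      ξ u • (D v - (1 / 2 : ℝ) • ξ v • a) := fun u v => rfl
  rw [h, h, hb u v]
  module

end Tensor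

/-! ### Linear operations on forms -/

section FormOperations

variable {N p k : ℕ} {M : Type*} [TopologicalSpace M] [T2Space M] [ChartedSpace (Coord N) M]
  [IsManifold (𝓡 N) ∞ M] {F : Foliation N p M} {V W : Type*} [NormedAddCommGroup V]
  [NormedSpace ℝ V] [NormedAddCommGroup W] [NormedSpace ℝ W]

/-- The form obtained by applying a linear map to the values of a form. -/
def mapForm (L : V →L[ℝ] W) (φ : Form N M V k) : Form N M W k := fun x =>
  ContinuousLinearMap.compContinuousAlternatingMapCLM ℝ (Coord N) V W (Fin k) L (φ x)

theorem mapForm_apply (L : V →L[ℝ] W) (φ : Form N M V k) (x : M) (w : Fin k → Coord N) :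
    mapForm L φ x w = L (φ x w) := rfl

theorem coordForm_mapForm (L : V →L[ℝ] W) (φ : Form N M V k) (z : M) :
    coordForm z (mapForm L φ) = fun y =>
      ContinuousLinearMap.compContinuousAlternatingMapCLM ℝ (Coord N) V W (Fin k) L
        (coordForm z φ y) := rfl

theorem IsSmoothForm.mapForm (L : V →L[ℝ] W) {φ : Form N M V k} (hφ : IsSmoothForm φ) :
    IsSmoothForm (mapForm L φ) := fun z => by
  rw [coordForm_mapForm]
  exact (ContinuousLinearMap.compContinuousAlternatingMapCLM ℝ (Coord N) V W (Fin k)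
    L).contDiff.comp_contDiffOn (hφ z)

theorem extD_mapForm (L : V →L[ℝ] W) {φ : Form N M V k} (hφ : IsSmoothForm φ) :
    TransverseKahler.extD (mapForm L φ) = mapForm L (TransverseKahler.extD φ) := by
  funext x
  have h : HasFDerivAt (coordForm x (TransverseKahler.mapForm L φ))
      ((ContinuousLinearMap.compContinuousAlternatingMapCLM ℝ (Coord N) V W (Fin k) L) ∘L
        fderiv ℝ (coordForm x φ) (extChartAt (𝓡 N) x x)) (extChartAt (𝓡 N) x x) :=
    (ContinuousLinearMap.compContinuousAlternatingMapCLM ℝ (Coord N) V W (Fin k)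
      L).hasFDerivAt.comp (extChartAt (𝓡 N) x x)
        (hφ.differentiableAt (base_mem_target (N := N) x)).hasFDerivAt
  rw [TransverseKahler.extD, extDeriv, h.fderiv]
  ext w
  rw [mapForm_apply, TransverseKahler.extD, extDeriv,
    ContinuousAlternatingMap.alternatizeUncurryFin_apply,
    ContinuousAlternatingMap.alternatizeUncurryFin_apply, map_sum]
  refine Finset.sum_congr rfl fun i _ => ?_
  rw [map_zsmul]
  rfl

theorem IsBasic.mapForm (L : V →L[ℝ] W) {φ : Form N M V k} (hφ : IsBasic F φ) :
    IsBasic F (mapForm L φ) where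
  smooth := hφ.smooth.mapForm L
  horizontal := fun x w hw => by rw [mapForm_apply, hφ.horizontal x w hw, map_zero]
  horizontal_extD := fun x w hw => by
    rw [extD_mapForm L hφ.smooth, mapForm_apply, hφ.horizontal_extD x w hw, map_zero]

theorem IsSmoothForm.sub {φ ψ : Form N M V k} (hφ : IsSmoothForm φ) (hψ : IsSmoothForm ψ) :
    IsSmoothForm (φ - ψ) := fun z => (hφ z).sub (hψ z)

theorem IsSmoothForm.add {φ ψ : Form N M V k} (hφ : IsSmoothForm φ) (hψ : IsSmoothForm ψ) :
    IsSmoothForm (φ + ψ) := fun z => (hφ z).add (hψ z)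

theorem IsSmoothForm.real_smul (c : ℝ) {φ : Form N M V k} (hφ : IsSmoothForm φ) :
    IsSmoothForm (c • φ) := fun z => (hφ z).const_smul c

theorem extD_add {φ ψ : Form N M V k} (hφ : IsSmoothForm φ) (hψ : IsSmoothForm ψ) :
    extD (φ + ψ) = extD φ + extD ψ :=
  funext fun x => extDeriv_add (hφ.differentiableAt (base_mem_target x))
    (hψ.differentiableAt (base_mem_target x))

theorem extD_real_smul (c : ℝ) (φ : Form N M V k) : extD (c • φ) = c • extD φ :=
  funext fun x => extDeriv_smul c (coordForm x φ)

theorem extD_sub {φ ψ : Form N M V k} (hφ : IsSmoothForm φ) (hψ : IsSmoothForm ψ) :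
    extD (φ - ψ) = extD φ - extD ψ := by
  have h : φ - ψ = φ + (-1 : ℝ) • ψ := by rw [neg_one_smul, sub_eq_add_neg]
  rw [h, extD_add hφ (hψ.real_smul _), extD_real_smul, neg_one_smul, sub_eq_add_neg]

theorem IsBasic.add {φ ψ : Form N M V k} (hφ : IsBasic F φ) (hψ : IsBasic F ψ) :
    IsBasic F (φ + ψ) where
  smooth := hφ.smooth.add hψ.smooth
  horizontal := fun x w hw => by
    rw [Pi.add_apply, ContinuousAlternatingMap.add_apply, hφ.horizontal x w hw,
      hψ.horizontal x w hw, add_zero]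
  horizontal_extD := fun x w hw => by
    rw [extD_add hφ.smooth hψ.smooth, Pi.add_apply, ContinuousAlternatingMap.add_apply,
      hφ.horizontal_extD x w hw, hψ.horizontal_extD x w hw, add_zero]

theorem IsBasic.real_smul (c : ℝ) {φ : Form N M V k} (hφ : IsBasic F φ) :
    IsBasic F (c • φ) where
  smooth := hφ.smooth.real_smul c
  horizontal := fun x w hw => by
    rw [Pi.smul_apply, ContinuousAlternatingMap.smul_apply, hφ.horizontal x w hw, smul_zero]
  horizontal_extD := fun x w hw => by
    rw [extD_real_smul, Pi.smul_apply, ContinuousAlternatingMap.smul_apply,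
      hφ.horizontal_extD x w hw, smul_zero]

theorem IsBasic.complex_smul (c : ℂ) {φ : Form N M ℂ k} (hφ : IsBasic F φ) :
    IsBasic F (c • φ) :=
  hφ.mapForm ((ContinuousLinearMap.mul ℝ ℂ) c)

end FormOperations

/-! ### The twisted complex, and holomorphic forms are harmonic -/

section TwistedComplex

variable {N p k : ℕ} {M : Type*} [TopologicalSpace M] [T2Space M] [ChartedSpace (Coord N) M]
  [IsManifold (𝓡 N) ∞ M] {F : Foliation N p M} {g : Metric N M}
  {J : M → Coord N →L[ℝ] Coord N} {κB : Form N M ℝ 1} {φ : Form N M ℂ k}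

/-- The wedge product of a real one-form and a complex form. -/
def wedgeForm (κB : Form N M ℝ 1) (φ : Form N M ℂ k) : Form N M ℂ (k + 1) := fun x =>
  ContinuousAlternatingMap.alternatizeUncurryFin ((covector κB x).smulRight (φ x))

theorem dKappa_eq (κB : Form N M ℝ 1) (φ : Form N M ℂ k) :
    dKappa κB φ = extD φ - (1 / 2 : ℝ) • wedgeForm κB φ := by
  funext x
  rw [dKappa, wedge_ofReal]
  rfl

theorem coordForm_wedgeForm (κB : Form N M ℝ 1) (φ : Form N M ℂ k) (z : M) (y : Coord N) :
    coordForm z (wedgeForm κB φ) y = ContinuousAlternatingMap.alternatizeUncurryFinCLM ℝ _ _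
      (((ContinuousAlternatingMap.ofSubsingletonLIE (𝕜 := ℝ) (E := Coord N) (F := ℝ)
          (0 : Fin 1)).symm (coordForm z κB y)).smulRight (coordForm z φ y)) := by
  ext w
  rw [coordForm_apply, wedgeForm, ContinuousAlternatingMap.alternatizeUncurryFinCLM_apply,
    ContinuousAlternatingMap.alternatizeUncurryFin_apply,
    ContinuousAlternatingMap.alternatizeUncurryFin_apply]
  rfl

theorem IsSmoothForm.contDiffOn_covector (hκ : IsSmoothForm κB) (z : M) :
    ContDiffOn ℝ ∞ (fun y => (ContinuousAlternatingMap.ofSubsingletonLIE (𝕜 := ℝ) (E := Coord N)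
      (F := ℝ) (0 : Fin 1)).symm (coordForm z κB y)) (extChartAt (𝓡 N) z).target :=
  (ContinuousAlternatingMap.ofSubsingletonLIE (𝕜 := ℝ) (E := Coord N)
      (F := ℝ) (0 : Fin 1)).symm.toContinuousLinearEquiv.contDiff.comp_contDiffOn (hκ z)

theorem IsSmoothForm.wedgeForm (hκ : IsSmoothForm κB) (hφ : IsSmoothForm φ) :
    IsSmoothForm (wedgeForm κB φ) := fun z => by
  have h := contDiffOn_smulRight (hκ.contDiffOn_covector z) (hφ z)
  have h1 := (ContinuousAlternatingMap.alternatizeUncurryFinCLM ℝ (Coord N)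
    ℂ).contDiff.comp_contDiffOn (E := Coord N) (F := Coord N →L[ℝ] (Coord N [⋀^Fin k]→L[ℝ] ℂ))
      (G := Coord N [⋀^Fin (k + 1)]→L[ℝ] ℂ) h
  exact h1.congr fun y _ => coordForm_wedgeForm κB φ z y

/-- The coordinate derivative of a real one-form, as a bilinear form. -/
def covectorDeriv (κB : Form N M ℝ 1) (x : M) : Coord N →L[ℝ] Coord N →L[ℝ] ℝ :=
  (ContinuousAlternatingMap.ofSubsingletonLIE (𝕜 := ℝ) (E := Coord N)
      (F := ℝ) (0 : Fin 1)).symm.toContinuousLinearEquiv.toContinuousLinearMap ∘L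
    fderiv ℝ (coordForm x κB) (extChartAt (𝓡 N) x x)

theorem extD_apply_covectorDeriv (κB : Form N M ℝ 1) (x : M) (u v : Coord N) :
    extD κB x ![u, v] = covectorDeriv κB x u v - covectorDeriv κB x v u := by
  rw [extD, extDeriv, ContinuousAlternatingMap.alternatizeUncurryFin_apply, Fin.sum_univ_two]
  have h : ∀ (u v : Coord N), covectorDeriv κB x u v =
    fderiv ℝ (coordForm x κB) (extChartAt (𝓡 N) x x) u fun _ => v := fun u v => rfl
  have h0 : (0 : Fin 2).removeNth ![u, v] = fun _ : Fin 1 => v := by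
    funext i
    rw [Subsingleton.elim i 0]
    rfl
  have h1 : (1 : Fin 2).removeNth ![u, v] = fun _ : Fin 1 => u := by
    funext i
    rw [Subsingleton.elim i 0]
    rfl
  rw [h, h, h0, h1]
  simp [sub_eq_add_neg]

theorem covectorDeriv_symm (h : extD κB = 0) (x : M) (u v : Coord N) :
    covectorDeriv κB x u v = covectorDeriv κB x v u := by
  have h1 := extD_apply_covectorDeriv κB x u v
  rw [h] at h1
  exact (sub_eq_zero.1 h1.symm)

theorem extD_wedgeForm (hκ : IsSmoothForm κB) (hφ : IsSmoothForm φ) (x : M) :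
    extD (wedgeForm κB φ) x = ContinuousAlternatingMap.alternatizeUncurryFin
      (ContinuousAlternatingMap.alternatizeUncurryFinCLM ℝ _ _ ∘L
        tensorDeriv (covector κB x) (covectorDeriv κB x) (φ x)
          (fderiv ℝ (coordForm x φ) (extChartAt (𝓡 N) x x))) := by
  have h1 : HasFDerivAt (fun y => (ContinuousAlternatingMap.ofSubsingletonLIE (𝕜 := ℝ)
      (E := Coord N) (F := ℝ) (0 : Fin 1)).symm (coordForm x κB y)) (covectorDeriv κB x)
      (extChartAt (𝓡 N) x x) :=
    (ContinuousAlternatingMap.ofSubsingletonLIE (𝕜 := ℝ) (E := Coord N) (F := ℝ)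
      (0 : Fin 1)).symm.toContinuousLinearEquiv.toContinuousLinearMap.hasFDerivAt.comp
        (extChartAt (𝓡 N) x x) (hκ.differentiableAt (base_mem_target (N := N) x)).hasFDerivAt
  have h2 := (hφ.differentiableAt (base_mem_target (N := N) x)).hasFDerivAt
  have h3 := hasFDerivAt_smulRight h1 h2
  have h4 := HasFDerivAt.clm_map (G := Coord N →L[ℝ] (Coord N [⋀^Fin k]→L[ℝ] ℂ))
    (K := Coord N [⋀^Fin (k + 1)]→L[ℝ] ℂ)
    (ContinuousAlternatingMap.alternatizeUncurryFinCLM ℝ (Coord N) ℂ) h3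
  have h5 : coordForm x (wedgeForm κB φ) = _ := funext (coordForm_wedgeForm κB φ x)
  rw [extD, extDeriv, h5]
  refine (congrArg _ h4.fderiv).trans ?_
  rw [coordForm_base, coordForm_base]
  rfl

/-- By `d² = 0` the square is `-½ (d(κB ∧ φ) + κB ∧ d_κ φ)`. The bracket is the double alternation
of `tensorDerivSum`, which is symmetric because `dκB = 0` makes the coordinate derivative of `κB`
symmetric. -/
theorem dKappa_dKappa (hκ : IsSmoothForm κB) (hd : extD κB = 0) (hφ : IsSmoothForm φ) :
    dKappa κB (dKappa κB φ) = 0 := by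
  funext x
  set D := fderiv ℝ (coordForm x φ) (extChartAt (𝓡 N) x x) with hD
  set ξ := covector κB x with hξ
  have hw := hκ.wedgeForm hφ
  have h1 : extD (dKappa κB φ) x = -((1 / 2 : ℝ) • extD (wedgeForm κB φ) x) := by
    rw [dKappa_eq, extD_sub hφ.extD (hw.real_smul _), extD_extD hφ, extD_real_smul, zero_sub]
    rfl
  have h2 : wedgeForm κB (dKappa κB φ) x = ContinuousAlternatingMap.alternatizeUncurryFin
      (ContinuousAlternatingMap.alternatizeUncurryFinCLM ℝ _ _ ∘L
        ξ.smulRight (D - (1 / 2 : ℝ) • ξ.smulRight (φ x))) := by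
    rw [wedgeForm]
    congr 1
    ext1 u
    change ξ u • dKappa κB φ x = ContinuousAlternatingMap.alternatizeUncurryFinCLM ℝ (Coord N) ℂ
      (ξ u • (D - (1 / 2 : ℝ) • ξ.smulRight (φ x)))
    rw [map_smul, map_sub, map_smul, dKappa_eq]
    rfl
  have h3 : ContinuousAlternatingMap.alternatizeUncurryFin
        (ContinuousAlternatingMap.alternatizeUncurryFinCLM ℝ (Coord N) ℂ ∘L
          tensorDerivSum ξ (covectorDeriv κB x) (φ x) D) =
      extD (wedgeForm κB φ) x + wedgeForm κB (dKappa κB φ) x := by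
    rw [h2, extD_wedgeForm hκ hφ, ← ContinuousAlternatingMap.alternatizeUncurryFinCLM_apply,
      ← ContinuousAlternatingMap.alternatizeUncurryFinCLM_apply,
      ← ContinuousAlternatingMap.alternatizeUncurryFinCLM_apply, ← map_add]
    congr 1
    ext1 u
    exact map_add (ContinuousAlternatingMap.alternatizeUncurryFinCLM ℝ (Coord N) ℂ) _ _
  rw [ContinuousAlternatingMap.alternatizeUncurryFin_alternatizeUncurryFinCLM_comp_of_symmetric
    (tensorDerivSum_symm (covectorDeriv_symm hd x) (φ x) D)] at h3
  rw [dKappa_eq, Pi.sub_apply, Pi.smul_apply, h1, eq_neg_of_add_eq_zero_right h3.symm]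
  rw [smul_neg, sub_neg_eq_add, neg_add_cancel]
  rfl

theorem dKappa_vanishesOn (hg : IsBundleLike F g) (hκ : IsBasic F κB) (hφ : IsBasic F φ) (x : M) :
    VanishesOn (F.tangent x) (dKappa κB φ x) := by
  rw [dKappa_eq_alternatize F g]
  exact VanishesOn.alternatize (twistedCovDeriv_vanishesOn hg hφ x)
    fun u hu => twistedCovDeriv_tangent hg hκ hφ hu

/-- Since `d_κ² = 0`, the form `d (d_κ φ)` equals `½ κB ∧ d_κ φ`, which is horizontal. -/
theorem IsBasic.dKappa (hg : IsBundleLike F g) (hκ : IsBasic F κB)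
    (hd : TransverseKahler.extD κB = 0) (hφ : IsBasic F φ) : IsBasic F (dKappa κB φ) where
  smooth := by
    rw [dKappa_eq]
    exact hφ.smooth.extD.sub ((hκ.smooth.wedgeForm hφ.smooth).real_smul _)
  horizontal := dKappa_vanishesOn hg hκ hφ
  horizontal_extD := fun x w hw => by
    have h1 : TransverseKahler.extD (TransverseKahler.dKappa κB φ) =
        (1 / 2 : ℝ) • wedgeForm κB (TransverseKahler.dKappa κB φ) := by
      rw [← sub_eq_zero, ← dKappa_eq, dKappa_dKappa hκ.smooth hd hφ.smooth]
    have h2 : VanishesOn (F.tangent x) (wedgeForm κB (TransverseKahler.dKappa κB φ) x) :=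
      VanishesOn.alternatize (fun u => (dKappa_vanishesOn hg hκ hφ x).real_smul _)
        fun u hu => by
          rw [ContinuousLinearMap.smulRight_apply, hκ.covector_tangent hu, zero_smul]
    rw [h1, Pi.smul_apply, ContinuousAlternatingMap.smul_apply, h2 w hw, smul_zero]

/-- A `∂̄_κ`-holomorphic form is co-closed and its twisted derivative is holomorphic. -/
theorem isKappaHarmonic_of_isKappaHolomorphic (hJ : IsTransverseKahler F g J) (hκ : IsBasic F κB)
    (hd : extD κB = 0) {r : ℕ} {φ : Form N M ℂ r} (hφ : IsBasic F φ)
    (hc : ∀ x, IsComplexLinear (J x) (φ x)) (h : IsKappaHolomorphic J κB r 0 φ) :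
    IsKappaHarmonic F g κB φ := by
  have h1 := (isKappaHolomorphic_iff hJ hκ hφ hc).1 h
  have hdφ : IsBasic F (dKappa κB φ) := IsBasic.dKappa hJ.bundleLike hκ hd hφ
  -- Holomorphy makes the direction slot complex linear as well, so `d_κ φ` is complex linear in all
  -- `r + 1` slots and the Kähler identity applies to it.
  have h2 : ∀ x, IsComplexLinear (J x) (dKappa κB φ x) := fun x => by
    rw [dKappa_eq_alternatize F g]
    exact alternatize_isComplexLinear (twistedCovDeriv_isComplexLinear hJ hφ hc x) (h1 x)
  have h3 : deltaKappa F g κB (dKappa κB φ) = 0 := by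
    rw [deltaKappa_eq_kahlerContract hJ hκ hdφ h2, dKappa_dKappa hκ.smooth hd hφ.smooth]
    funext x
    have : kahlerContract F g J (0 : Form N M ℂ (r + 2)) x = 0 :=
      Finset.sum_eq_zero fun i _ => rfl
    rw [Pi.smul_apply, this]
    exact smul_zero _
  cases r with
  | zero => exact h3
  | succ r =>
    -- The trace is invariant under replacing `E_a` by `J E_a`, but both slots contribute a factor
    -- `i`; hence it equals its own negative.
    have h4 : deltaKappa F g κB φ = 0 := by
      funext x
      have h5 := hJ.traceWith_J x (curryOf (twistedCovDeriv F g κB φ x))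
      have h6 : ∀ i, curryOf (twistedCovDeriv F g κB φ x) (J x (cometric F g x (stdCovec i)))
          (J x (stdVec i)) = -curryOf (twistedCovDeriv F g κB φ x)
            (cometric F g x (stdCovec i)) (stdVec i) := fun i => by
        rw [curryOf_apply, curryOf_apply,
          (twistedCovDeriv_isComplexLinear hJ hφ hc x _).curryLeft_map, h1]
        ext w
        change Complex.I * (Complex.I * _) = -_
        rw [← mul_assoc, Complex.I_mul_I, neg_one_mul]
        rfl
      simp only [h6] at h5
      rw [Finset.sum_neg_distrib, ← traceWith] at h5
      rw [deltaKappa_eq_traceWith hκ]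
      ext w
      have h7 := DFunLike.congr_fun h5 w
      exact neg_eq_zero.2 (self_eq_neg.1 h7.symm)
    change dKappa κB (deltaKappa F g κB φ) + deltaKappa F g κB (dKappa κB φ) = 0
    rw [h3, h4, add_zero, dKappa_eq]
    have h5 : extD (0 : Form N M ℂ r) = 0 := by
      have := extD_real_smul (0 : ℝ) (0 : Form N M ℂ r)
      rwa [zero_smul, zero_smul] at this
    have h6 : wedgeForm κB (0 : Form N M ℂ r) = 0 := by
      funext x
      have : (covector κB x).smulRight (0 : Coord N [⋀^Fin r]→L[ℝ] ℂ) = 0 := by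
        ext u w
        exact smul_zero (covector κB x u)
      rw [wedgeForm, Pi.zero_apply, this,
        ← ContinuousAlternatingMap.alternatizeUncurryFinCLM_apply, map_zero]
      rfl
    rw [h5, h6, smul_zero, sub_zero]

end TwistedComplex

/-! ### Gram determinants and Jacobi's formula -/

section GramDeterminant

variable {N : ℕ}

/-- The determinant of the Gram matrix of a bilinear form on `ℝᴺ`. -/
def gramDet (B : Coord N →L[ℝ] Coord N →L[ℝ] ℝ) : ℝ :=
  Matrix.det (Matrix.of fun i j => B (stdVec i) (stdVec j))

/-- A continuous bilinear form as an algebraic bilinear map. -/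
def bilinMap (B : Coord N →L[ℝ] Coord N →L[ℝ] ℝ) : Coord N →ₗ[ℝ] Coord N →ₗ[ℝ] ℝ :=
  LinearMap.mk₂ ℝ (fun u v => B u v) (by simp) (by simp) (by simp) (by simp)

theorem bilinMap_apply (B : Coord N →L[ℝ] Coord N →L[ℝ] ℝ) (u v : Coord N) :
    bilinMap B u v = B u v := rfl

theorem gramDet_bilinearComp (B : Coord N →L[ℝ] Coord N →L[ℝ] ℝ) (S : Coord N →L[ℝ] Coord N) :
    gramDet (B.bilinearComp S S) = S.det ^ 2 * gramDet B := by
  set A : Matrix (Fin N) (Fin N) ℝ := Matrix.of fun i j => stdCovec i (S (stdVec j)) with hA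
  have hdet : A.det = S.det := by
    rw [ContinuousLinearMap.det, ← LinearMap.det_toMatrix (EuclideanSpace.basisFun (Fin N) ℝ).toBasis]
    congr 1
  have hG : (Matrix.of fun i j => (B.bilinearComp S S) (stdVec i) (stdVec j)) =
      A.transpose * (Matrix.of fun i j => B (stdVec i) (stdVec j)) * A := by
    ext i j
    rw [Matrix.mul_apply, Matrix.of_apply, ContinuousLinearMap.bilinearComp_apply]
    have h : ∀ l, (A.transpose * (Matrix.of fun i j => B (stdVec i) (stdVec j))) i l =
        B (S (stdVec i)) (stdVec l) := fun l => by
      rw [Matrix.mul_apply]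
      conv_rhs => rw [← sum_stdCovec_smul (S (stdVec i))]
      simp [hA]
    simp only [h]
    conv_lhs => rw [← sum_stdCovec_smul (S (stdVec j))]
    simp [hA, mul_comm]
  rw [gramDet, hG, Matrix.det_mul, Matrix.det_mul, Matrix.det_transpose, hdet, gramDet]
  ring

theorem gramDet_pos {B : Coord N →L[ℝ] Coord N →L[ℝ] ℝ} (hs : ∀ u v, B u v = B v u)
    (hp : ∀ v, v ≠ 0 → 0 < B v v) : 0 < gramDet B := by
  refine Matrix.PosDef.det_pos (Matrix.PosDef.of_dotProduct_mulVec_pos ?_ fun w hw => ?_)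
  · ext i j
    exact hs _ _
  · set v : Coord N := ∑ i, w i • stdVec i with hv
    have h0 : v ≠ 0 := fun h => hw (by
      funext i
      have := congrArg (stdCovec i) (hv.symm.trans h)
      rw [map_sum, map_zero] at this
      simpa [stdCovec_apply, stdVec, Pi.single_apply] using this)
    have h1 := hp v h0
    have h2 : B v v = star w ⬝ᵥ (Matrix.of fun i j => B (stdVec i) (stdVec j)).mulVec w := by
      rw [hv]
      simp [dotProduct, Matrix.mulVec, Finset.mul_sum, mul_comm]
      refine Finset.sum_congr rfl fun i _ => Finset.sum_congr rfl fun j _ => ?_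
      rw [hs]
    rwa [h2] at h1

theorem differentiable_det :
    Differentiable ℝ fun A : Fin N → Fin N → ℝ => Matrix.det (Matrix.of A) := by
  simp only [Matrix.det_apply, Matrix.of_apply]
  fun_prop

/-- Jacobi's formula. -/
theorem hasFDerivAt_det {A : Fin N → Fin N → ℝ} (hA : IsUnit (Matrix.of A).det)
    (H : Fin N → Fin N → ℝ) :
    fderiv ℝ (fun A : Fin N → Fin N → ℝ => Matrix.det (Matrix.of A)) A H =
      (Matrix.of A).det * ((Matrix.of A)⁻¹ * Matrix.of H).trace := by
  have h1 : HasDerivAt (fun t : ℝ => A + t • H) H 0 := by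
    simpa using ((hasDerivAt_id (0 : ℝ)).smul_const H).const_add A
  have h0 : HasFDerivAt (fun A : Fin N → Fin N → ℝ => Matrix.det (Matrix.of A))
      (fderiv ℝ (fun A : Fin N → Fin N → ℝ => Matrix.det (Matrix.of A)) A) (A + (0 : ℝ) • H) := by
    rw [zero_smul, add_zero]
    exact (differentiable_det A).hasFDerivAt
  have h2 := h0.comp_hasDerivAt (0 : ℝ) h1
  -- `P` is the remainder in `det (1 + t K) = 1 + t tr K + t² P(t)`; it plays no role at `t = 0`.
  set P := (Matrix.det (1 + (Polynomial.X : Polynomial ℝ) •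
    ((Matrix.of A)⁻¹ * Matrix.of H).map Polynomial.C)).divX.divX with hP
  have h3 : ((fun A : Fin N → Fin N → ℝ => Matrix.det (Matrix.of A)) ∘ fun t : ℝ => A + t • H) =
      fun t => (Matrix.of A).det *
        (1 + ((Matrix.of A)⁻¹ * Matrix.of H).trace * t + P.eval t * t ^ 2) := by
    funext t
    have h4 : Matrix.of (A + t • H) =
        Matrix.of A * (1 + t • ((Matrix.of A)⁻¹ * Matrix.of H)) := by
      rw [mul_add, mul_one, Matrix.mul_smul, ← mul_assoc, Matrix.mul_nonsing_inv _ hA, one_mul]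
      rfl
    rw [Function.comp_apply, h4, Matrix.det_mul, Matrix.det_one_add_smul]
  rw [h3] at h2
  have h5 : HasDerivAt (fun t : ℝ => (Matrix.of A).det *
      (1 + ((Matrix.of A)⁻¹ * Matrix.of H).trace * t + P.eval t * t ^ 2))
      ((Matrix.of A).det * ((Matrix.of A)⁻¹ * Matrix.of H).trace) 0 := by
    have h6 := (((hasDerivAt_id (0 : ℝ)).const_mul
      ((Matrix.of A)⁻¹ * Matrix.of H).trace).const_add 1).add
        ((P.hasDerivAt 0).mul ((hasDerivAt_id (0 : ℝ)).pow 2))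
    have h7 := h6.const_mul (Matrix.of A).det
    refine (h7.congr_deriv ?_)
    simp
  exact h2.unique h5

/-- The inverse Gram matrix is the matrix of `B⁻¹` in the dual basis. This rewrites Jacobi's formula
as a trace against the inverse metric. -/
theorem traceWith_inverse {B : Coord N →L[ℝ] Coord N →L[ℝ] ℝ} (hs : ∀ u v, B u v = B v u)
    (hB : B.IsInvertible) (C : Coord N →L[ℝ] Coord N →L[ℝ] ℝ) :
    ((Matrix.of fun i j => B (stdVec i) (stdVec j))⁻¹ *
      Matrix.of fun i j => C (stdVec i) (stdVec j)).trace =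
      traceWith B.inverse (bilinMap C) := by
  have h1 : ∀ ξ v, B (B.inverse ξ) v = ξ v := fun ξ v => by
    obtain ⟨e, rfl⟩ := hB
    rw [ContinuousLinearMap.inverse_equiv]
    exact DFunLike.congr_fun (e.apply_symm_apply ξ) v
  set W : Matrix (Fin N) (Fin N) ℝ :=
    Matrix.of fun i j => stdCovec j (B.inverse (stdCovec i)) with hW
  have h2 : W * (Matrix.of fun i j => B (stdVec i) (stdVec j)) = 1 := by
    ext i j
    rw [Matrix.mul_apply]
    have h3 := h1 (stdCovec i) (stdVec j)
    conv_lhs at h3 => rw [← sum_stdCovec_smul (B.inverse (stdCovec i))]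
    rw [map_sum, _root_.sum_apply] at h3
    simp only [map_smul, smul_apply, smul_eq_mul] at h3
    simp only [hW, Matrix.of_apply]
    rw [h3]
    simp [stdCovec_apply, stdVec, Matrix.one_apply]
  rw [Matrix.inv_eq_left_inv h2, Matrix.trace, traceWith]
  refine Finset.sum_congr rfl fun i _ => ?_
  rw [Matrix.diag_apply, Matrix.mul_apply, bilinMap_apply]
  conv_rhs => rw [← sum_stdCovec_smul (B.inverse (stdCovec i))]
  rw [map_sum, _root_.sum_apply]
  simp [hW]

theorem hasFDerivAt_gramDet {E : Type*} [NormedAddCommGroup E] [NormedSpace ℝ E]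
    {B : E → Coord N →L[ℝ] Coord N →L[ℝ] ℝ} {B' : E →L[ℝ] Coord N →L[ℝ] Coord N →L[ℝ] ℝ} {y : E}
    (h : HasFDerivAt B B' y) (hs : ∀ u v, B y u v = B y v u) (hB : (B y).IsInvertible)
    (hp : gramDet (B y) ≠ 0) :
    ∃ D : E →L[ℝ] ℝ, HasFDerivAt (fun y => gramDet (B y)) D y ∧
      ∀ u, D u = gramDet (B y) * traceWith (B y).inverse (bilinMap (B' u)) := by
  have h1 : ∀ i, HasFDerivAt (fun y => B y (stdVec i))
      ((ContinuousLinearMap.apply ℝ (Coord N →L[ℝ] ℝ) (stdVec i)) ∘L B') y := fun i =>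
    HasFDerivAt.clm_map (G := Coord N →L[ℝ] Coord N →L[ℝ] ℝ) (K := Coord N →L[ℝ] ℝ)
      (ContinuousLinearMap.apply ℝ (Coord N →L[ℝ] ℝ) (stdVec i)) h
  have h2 : ∀ i j, HasFDerivAt (fun y => B y (stdVec i) (stdVec j))
      ((ContinuousLinearMap.apply ℝ ℝ (stdVec j)) ∘L
        (ContinuousLinearMap.apply ℝ (Coord N →L[ℝ] ℝ) (stdVec i)) ∘L B') y := fun i j =>
    HasFDerivAt.clm_map (G := Coord N →L[ℝ] ℝ) (K := ℝ)
      (ContinuousLinearMap.apply ℝ ℝ (stdVec j)) (h1 i)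
  have h3 : HasFDerivAt (fun y i j => B y (stdVec i) (stdVec j))
      (ContinuousLinearMap.pi fun i => ContinuousLinearMap.pi fun j =>
        (ContinuousLinearMap.apply ℝ ℝ (stdVec j)) ∘L
          (ContinuousLinearMap.apply ℝ (Coord N →L[ℝ] ℝ) (stdVec i)) ∘L B') y :=
    hasFDerivAt_pi.2 fun i => hasFDerivAt_pi.2 fun j => h2 i j
  have hd := (differentiable_det (N := N) fun i j => B y (stdVec i) (stdVec j)).hasFDerivAt
  have h4 := HasFDerivAt.comp (F := Fin N → Fin N → ℝ) (G := ℝ)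
    (g := fun A : Fin N → Fin N → ℝ => Matrix.det (Matrix.of A))
    (f := fun y i j => B y (stdVec i) (stdVec j)) y hd h3
  refine ⟨_, h4, fun u => ?_⟩
  rw [← traceWith_inverse hs hB]
  exact hasFDerivAt_det (isUnit_iff_ne_zero.2 hp) fun i j => B' u (stdVec i) (stdVec j)

theorem contDiff_gramDet : ContDiff ℝ ∞ (gramDet (N := N)) := by
  have : gramDet (N := N) = fun B => ∑ σ : Equiv.Perm (Fin N),
      Equiv.Perm.sign σ • ∏ i, B (stdVec (σ i)) (stdVec i) := by
    funext B
    rw [gramDet, Matrix.det_apply]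
    rfl
  rw [this]
  refine ContDiff.sum fun σ _ => ContDiff.const_smul _ (contDiff_prod fun i _ => ?_)
  exact (contDiff_id.clm_apply contDiff_const).clm_apply contDiff_const

end GramDeterminant

/-! ### Integrals of derivatives on `ℝᴺ` -/

section CompactlySupported

variable {N : ℕ}

/-- Integration by parts against the constant function `1`. -/
theorem integral_fderiv_eq_zero {f : Coord N → ℝ} (hf : ContDiff ℝ 1 f)
    (hc : HasCompactSupport f) (v : Coord N) : ∫ y, fderiv ℝ f y v = 0 := by
  have h1 : Integrable (fun y => fderiv ℝ f y v) := by
    refine Continuous.integrable_of_hasCompactSupport ?_ ?_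
    · exact (hf.continuous_fderiv one_ne_zero).clm_apply continuous_const
    · exact (hc.fderiv ℝ).comp_left (g := fun L : Coord N →L[ℝ] ℝ => L v) rfl
  have h := integral_mul_fderiv_eq_neg_fderiv_mul_of_integrable (μ := volume)
    (f := fun _ : Coord N => (1 : ℝ)) (g := f) (v := v) (by simp)
    (by simpa using h1) (by simpa using hf.continuous.integrable_of_hasCompactSupport hc)
    (fun _ _ => differentiableAt_const _) (fun y _ => hf.differentiable one_ne_zero y)
  simpa using h

end CompactlySupported

/-! ### The Riemannian measure -/

section Volume

variable {N : ℕ} {M : Type*} [TopologicalSpace M] [ChartedSpace (Coord N) M]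
  [IsManifold (𝓡 N) ∞ M]

/-- The density `√ det g_ij` of the Riemannian measure in the chart at `z`. -/
def chartDensity (g : Metric N M) (z : M) (y : Coord N) : ℝ :=
  Real.sqrt (gramDet (coordBilin z (Metric.bilin g) y))

theorem chartSymmDeriv_injective {z : M} {y : Coord N} (hy : y ∈ (extChartAt (𝓡 N) z).target)
    {v : Coord N} (hv : v ≠ 0) : chartSymmDeriv z y v ≠ 0 := fun h => hv (by
  rw [← chartDeriv_chartSymmDeriv hy v, h, map_zero])

theorem gramDet_coordBilin_pos (g : Metric N M) {z : M} {y : Coord N}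
    (hy : y ∈ (extChartAt (𝓡 N) z).target) : 0 < gramDet (coordBilin z (Metric.bilin g) y) :=
  gramDet_pos (coordBilin_metric_symm g z y)
    fun _ hv => Metric.bilin_pos g _ _ (chartSymmDeriv_injective hy hv)

theorem chartDensity_pos (g : Metric N M) {z : M} {y : Coord N}
    (hy : y ∈ (extChartAt (𝓡 N) z).target) : 0 < chartDensity g z y :=
  Real.sqrt_pos.2 (gramDet_coordBilin_pos g hy)

theorem contDiffOn_chartDensity (g : Metric N M) (z : M) :
    ContDiffOn ℝ ∞ (chartDensity g z) (extChartAt (𝓡 N) z).target :=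
  (contDiff_gramDet.comp_contDiffOn (contDiffOn_coordBilin_metric g z)).sqrt
    fun _ hy => (gramDet_coordBilin_pos g hy).ne'

theorem symm_transition {z w : M} {y : Coord N}
    (hw : (extChartAt (𝓡 N) z).symm y ∈ (extChartAt (𝓡 N) w).source) :
    (extChartAt (𝓡 N) w).symm (transition z w y) = (extChartAt (𝓡 N) z).symm y :=
  (extChartAt (𝓡 N) w).left_inv hw

theorem coordBilin_transition (B : M → Coord N →L[ℝ] Coord N →L[ℝ] ℝ) {z w : M} {y : Coord N}
    (hy : y ∈ (extChartAt (𝓡 N) z).target)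
    (hw : (extChartAt (𝓡 N) z).symm y ∈ (extChartAt (𝓡 N) w).source) :
    coordBilin z B y = (coordBilin w B (transition z w y)).bilinearComp
      (fderiv ℝ (transition z w) y) (fderiv ℝ (transition z w) y) := by
  ext1 u
  ext1 v
  rw [coordBilin_apply, ContinuousLinearMap.bilinearComp_apply, coordBilin_apply,
    symm_transition hw, chartSymmDeriv_eq_comp hy hw]
  rfl

theorem chartDensity_transition (g : Metric N M) {z w : M} {y : Coord N}
    (hy : y ∈ (extChartAt (𝓡 N) z).target)
    (hw : (extChartAt (𝓡 N) z).symm y ∈ (extChartAt (𝓡 N) w).source) :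
    chartDensity g z y =
      |(fderiv ℝ (transition z w) y).det| * chartDensity g w (transition z w y) := by
  rw [chartDensity, coordBilin_transition _ hy hw, gramDet_bilinearComp,
    Real.sqrt_mul (sq_nonneg _), Real.sqrt_sq_eq_abs, chartDensity]

variable [MeasurableSpace M] [BorelSpace M]

/-- The Riemannian measure of the domain of the chart at `z`. -/
def chartMeasure (g : Metric N M) (z : M) : Measure M :=
  Measure.map (extChartAt (𝓡 N) z).symm
    (((volume : Measure (Coord N)).restrict (extChartAt (𝓡 N) z).target).withDensity fun y =>
      ENNReal.ofReal (chartDensity g z y))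

theorem volumeMeasure_eq (g : Metric N M) : volumeMeasure g = ⨆ z, chartMeasure g z := rfl

theorem aemeasurable_symm (g : Metric N M) (z : M) : AEMeasurable (extChartAt (𝓡 N) z).symm
    (((volume : Measure (Coord N)).restrict (extChartAt (𝓡 N) z).target).withDensity fun y =>
      ENNReal.ofReal (chartDensity g z y)) :=
  ((continuousOn_extChartAt_symm z).aemeasurable (isOpen_target z).measurableSet).mono_ac
    (withDensity_absolutelyContinuous _ _)

theorem chartMeasure_apply (g : Metric N M) (z : M) {s : Set M} (hs : MeasurableSet s) :
    chartMeasure g z s = ∫⁻ y in (extChartAt (𝓡 N) z).symm ⁻¹' s ∩ (extChartAt (𝓡 N) z).target,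
      ENNReal.ofReal (chartDensity g z y) := by
  rw [chartMeasure, Measure.map_apply_of_aemeasurable (aemeasurable_symm g z) hs,
    withDensity_apply', Measure.restrict_restrict' (isOpen_target z).measurableSet]

theorem measurableSet_source (z : M) : MeasurableSet (extChartAt (𝓡 N) z).source :=
  (isOpen_extChartAt_source z).measurableSet

theorem chartMeasure_inter_source (g : Metric N M) (z : M) {s : Set M} (hs : MeasurableSet s) :
    chartMeasure g z (s ∩ (extChartAt (𝓡 N) z).source) = chartMeasure g z s := by
  rw [chartMeasure_apply g z (hs.inter (measurableSet_source z)), chartMeasure_apply g z hs]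
  congr 2
  ext y
  constructor
  · rintro ⟨⟨h1, -⟩, h2⟩
    exact ⟨h1, h2⟩
  · rintro ⟨h1, h2⟩
    exact ⟨⟨h1, (extChartAt (𝓡 N) z).map_target h2⟩, h2⟩

theorem measurableSet_preimage_symm (z : M) {s : Set M} (hs : MeasurableSet s) :
    MeasurableSet ((extChartAt (𝓡 N) z).symm ⁻¹' s ∩ (extChartAt (𝓡 N) z).target) := by
  have h1 : Measurable ((extChartAt (𝓡 N) z).target.domRestrict (extChartAt (𝓡 N) z).symm) :=
    (continuousOn_extChartAt_symm (I := 𝓡 N) z).domRestrict.measurable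
  have h2 := (isOpen_target (N := N) z).measurableSet.subtype_image (h1 hs)
  convert h2 using 1
  ext y
  simp only [Set.mem_inter_iff, Set.mem_preimage, Set.mem_image, Subtype.exists]
  constructor
  · rintro ⟨h3, h4⟩
    exact ⟨y, h4, h3, rfl⟩
  · rintro ⟨y', h4, h3, rfl⟩
    exact ⟨h3, h4⟩

/-- Change of variables: the Jacobian of the transition map is exactly the factor by which the
densities differ. -/
theorem chartMeasure_eq (g : Metric N M) (z w : M) {s : Set M} (hs : MeasurableSet s)
    (hz : s ⊆ (extChartAt (𝓡 N) z).source) (hw : s ⊆ (extChartAt (𝓡 N) w).source) :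
    chartMeasure g z s = chartMeasure g w s := by
  set U := (extChartAt (𝓡 N) z).symm ⁻¹' s ∩ (extChartAt (𝓡 N) z).target with hU
  have himage : transition z w '' U =
      (extChartAt (𝓡 N) w).symm ⁻¹' s ∩ (extChartAt (𝓡 N) w).target := by
    ext y
    constructor
    · rintro ⟨y, ⟨h1, h2⟩, rfl⟩
      refine ⟨?_, (extChartAt (𝓡 N) w).map_source (hw h1)⟩
      rw [Set.mem_preimage, symm_transition (hw h1)]
      exact h1
    · rintro ⟨h1, h2⟩
      refine ⟨extChartAt (𝓡 N) z ((extChartAt (𝓡 N) w).symm y),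
        ⟨?_, (extChartAt (𝓡 N) z).map_source (hz h1)⟩, ?_⟩
      · rw [Set.mem_preimage, (extChartAt (𝓡 N) z).left_inv (hz h1)]
        exact h1
      · rw [transition, Function.comp_apply, (extChartAt (𝓡 N) z).left_inv (hz h1),
          (extChartAt (𝓡 N) w).right_inv h2]
  have hinj : Set.InjOn (transition (N := N) z w) U := fun y hy y' hy' h =>
    (extChartAt (𝓡 N) z).symm.injOn hy.2 hy'.2
      ((extChartAt (𝓡 N) w).injOn (hw hy.1) (hw hy'.1) h)
  rw [chartMeasure_apply g z hs, chartMeasure_apply g w hs, ← himage,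
    lintegral_image_eq_lintegral_abs_det_fderiv_mul volume (measurableSet_preimage_symm z hs)
      (fun y hy => ((contDiffAt_transition hy.2 (hw hy.1)).differentiableAt
        (by simp)).hasFDerivAt.hasFDerivWithinAt) hinj]
  refine setLIntegral_congr_fun (measurableSet_preimage_symm z hs) fun y hy => ?_
  rw [← ENNReal.ofReal_mul (abs_nonneg _), ← chartDensity_transition g hy.2 (hw hy.1)]

/-- The supremum of the chart measures adds nothing inside a chart domain, because any two of them
agree on the overlap of their domains. Integrals of functions supported in one chart can thus be
computed there. -/
theorem volumeMeasure_restrict (g : Metric N M) (z : M) :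
    (volumeMeasure g).restrict (extChartAt (𝓡 N) z).source = chartMeasure g z := by
  have hm := measurableSet_source (N := N) z
  refine le_antisymm ?_ ?_
  -- A supremum of measures is bounded by any common upper bound; infinite mass outside the chart
  -- domain makes this one trivially dominate every other chart measure there.
  · have h1 : volumeMeasure g ≤
        chartMeasure g z + (⊤ : Measure M).restrict (extChartAt (𝓡 N) z).sourceᶜ := by
      rw [volumeMeasure_eq]
      refine iSup_le fun w => Measure.le_iff.2 fun s hs => ?_
      rw [← measure_inter_add_sdiff s hm, Measure.add_apply, Measure.restrict_apply hs]
      refine add_le_add ?_ ((le_top : chartMeasure g w ≤ ⊤) _)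
      rw [← chartMeasure_inter_source g w (hs.inter hm), chartMeasure_eq g w z
        ((hs.inter hm).inter (measurableSet_source w)) Set.inter_subset_right
        (Set.inter_subset_left.trans Set.inter_subset_right)]
      exact measure_mono (Set.inter_subset_left.trans Set.inter_subset_left)
    refine (Measure.restrict_mono_measure h1 _).trans ?_
    rw [Measure.restrict_add, Measure.restrict_restrict hm, Set.inter_compl_self,
      Measure.restrict_empty, add_zero]
    exact Measure.restrict_le_self
  · have h1 : (chartMeasure g z).restrict (extChartAt (𝓡 N) z).source = chartMeasure g z := by
      ext s hs
      rw [Measure.restrict_apply hs, chartMeasure_inter_source g z hs]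
    rw [← h1]
    exact Measure.restrict_mono_measure (le_iSup (fun z => chartMeasure g z) z) _

theorem integral_eq_chart (g : Metric N M) (z : M) {f : M → ℝ} (hf : Continuous f)
    (h : ∀ x, x ∉ (extChartAt (𝓡 N) z).source → f x = 0) :
    ∫ x, f x ∂(volumeMeasure g) = ∫ y in (extChartAt (𝓡 N) z).target,
      chartDensity g z y * f ((extChartAt (𝓡 N) z).symm y) := by
  rw [← setIntegral_eq_integral_of_forall_compl_eq_zero h, volumeMeasure_restrict, chartMeasure,
    integral_map (aemeasurable_symm g z) hf.aestronglyMeasurable,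
    integral_withDensity_eq_integral_toReal_smul₀]
  · refine setIntegral_congr_fun (isOpen_target z).measurableSet fun y hy => ?_
    simp only [ENNReal.toReal_ofReal (chartDensity_pos g hy).le, smul_eq_mul]
  · exact ((contDiffOn_chartDensity g z).continuousOn.aemeasurable
      (isOpen_target z).measurableSet).ennreal_ofReal
  · exact Filter.Eventually.of_forall fun y => ENNReal.ofReal_lt_top

instance isLocallyFiniteMeasure_volumeMeasure (g : Metric N M) :
    IsLocallyFiniteMeasure (volumeMeasure g) where
  finiteAtNhds x := by
    have hb := base_mem_target (N := N) x
    have hc : ContinuousAt (chartDensity g x) (extChartAt (𝓡 N) x x) :=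
      (contDiffOn_chartDensity g x).continuousOn.continuousAt (target_mem_nhds hb)
    have h1 : ∀ᶠ y in 𝓝 (extChartAt (𝓡 N) x x), y ∈ (extChartAt (𝓡 N) x).target ∧
        chartDensity g x y < chartDensity g x (extChartAt (𝓡 N) x x) + 1 :=
      Filter.Eventually.and (target_mem_nhds hb) (hc.eventually_lt_const (lt_add_one _))
    obtain ⟨ε, hε, h2⟩ := Metric.eventually_nhds_iff_ball.1 h1
    have ho : IsOpen ((extChartAt (𝓡 N) x).source ∩
        extChartAt (𝓡 N) x ⁻¹' Metric.ball (extChartAt (𝓡 N) x x) ε) :=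
      (continuousOn_extChartAt x).isOpen_inter_preimage (isOpen_extChartAt_source x)
        Metric.isOpen_ball
    refine ⟨_, ho.mem_nhds ⟨mem_extChartAt_source x, Metric.mem_ball_self hε⟩, ?_⟩
    have h3 := Measure.restrict_apply (μ := volumeMeasure g)
      (s := (extChartAt (𝓡 N) x).source) ho.measurableSet
    rw [Set.inter_eq_left.2 Set.inter_subset_left, volumeMeasure_restrict,
      chartMeasure_apply g x ho.measurableSet] at h3
    rw [← h3]
    have h4 : (extChartAt (𝓡 N) x).symm ⁻¹' ((extChartAt (𝓡 N) x).source ∩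
        extChartAt (𝓡 N) x ⁻¹' Metric.ball (extChartAt (𝓡 N) x x) ε) ∩
        (extChartAt (𝓡 N) x).target ⊆ Metric.ball (extChartAt (𝓡 N) x x) ε := by
      rintro y ⟨⟨-, h5⟩, h6⟩
      rw [Set.mem_preimage, (extChartAt (𝓡 N) x).right_inv h6] at h5
      exact h5
    refine (lintegral_mono_set h4).trans_lt ?_
    refine (setLIntegral_mono measurable_const (g := fun _ => ENNReal.ofReal
      (chartDensity g x (extChartAt (𝓡 N) x x) + 1)) fun y hy =>
        ENNReal.ofReal_le_ofReal (h2 y hy).2.le).trans_lt ?_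
    rw [setLIntegral_const]
    exact ENNReal.mul_lt_top ENNReal.ofReal_lt_top measure_ball_lt_top

instance isOpenPosMeasure_volumeMeasure (g : Metric N M) :
    (volumeMeasure g).IsOpenPosMeasure where
  open_pos U hU := by
    rintro ⟨x, hx⟩ h0
    have hb := base_mem_target (N := N) x
    have hc : ContinuousAt (chartDensity g x) (extChartAt (𝓡 N) x x) :=
      (contDiffOn_chartDensity g x).continuousOn.continuousAt (target_mem_nhds hb)
    have hρ := chartDensity_pos g hb
    have hU' : (extChartAt (𝓡 N) x).symm ⁻¹' U ∈ 𝓝 (extChartAt (𝓡 N) x x) :=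
      (mdifferentiableAt_symm hb).continuousAt.preimage_mem_nhds
        (by rw [symm_base]; exact hU.mem_nhds hx)
    -- Near `x` the density exceeds half its positive value at `x`, so a small coordinate ball
    -- inside `U` has positive measure.
    have h1 : ∀ᶠ y in 𝓝 (extChartAt (𝓡 N) x x), (y ∈ (extChartAt (𝓡 N) x).symm ⁻¹' U ∧
        y ∈ (extChartAt (𝓡 N) x).target) ∧
        chartDensity g x (extChartAt (𝓡 N) x x) / 2 < chartDensity g x y :=
      ((Filter.Eventually.and hU' (target_mem_nhds hb))).and
        (hc.eventually_const_lt (half_lt_self hρ))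
    obtain ⟨ε, hε, h2⟩ := Metric.eventually_nhds_iff_ball.1 h1
    have h3 : chartMeasure g x U = 0 :=
      le_antisymm ((le_iSup (fun z => chartMeasure g z) x U).trans h0.le) bot_le
    rw [chartMeasure_apply g x hU.measurableSet] at h3
    have h4 : ∫⁻ _ in Metric.ball (extChartAt (𝓡 N) x x) ε,
        ENNReal.ofReal (chartDensity g x (extChartAt (𝓡 N) x x) / 2) ≤ 0 := by
      rw [← h3]
      refine (setLIntegral_mono' measurableSet_ball fun y hy =>
        ENNReal.ofReal_le_ofReal (h2 y hy).2.le).trans (lintegral_mono_set fun y hy => (h2 y hy).1)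
    rw [setLIntegral_const, nonpos_iff_eq_zero, mul_eq_zero] at h4
    rcases h4 with h4 | h4
    · exact (half_pos hρ).not_ge (ENNReal.ofReal_eq_zero.1 h4)
    · exact (Metric.measure_ball_pos volume _ hε).ne' h4

theorem eq_zero_of_integral_eq_zero [CompactSpace M] (g : Metric N M) {f : M → ℝ}
    (hf : Continuous f) (h0 : ∀ x, 0 ≤ f x) (h : ∫ x, f x ∂(volumeMeasure g) = 0) : f = 0 := by
  have hi : Integrable f (volumeMeasure g) :=
    hf.integrable_of_hasCompactSupport (HasCompactSupport.of_compactSpace f)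
  exact Measure.eq_of_ae_eq ((integral_eq_zero_iff_of_nonneg h0 hi).1 h) hf continuous_const

end Volume

theorem HasFDerivAt.bilin_comp {E F G : Type*} [NormedAddCommGroup E] [NormedSpace ℝ E]
    [NormedAddCommGroup F] [NormedSpace ℝ F] [NormedAddCommGroup G] [NormedSpace ℝ G]
    {T : E → F} {T' : E →L[ℝ] F} {B : F → G →L[ℝ] G →L[ℝ] ℝ} {B' : F →L[ℝ] G →L[ℝ] G →L[ℝ] ℝ}
    {a b : E → G} {a' b' : E →L[ℝ] G} {y : E} (hB : HasFDerivAt B B' (T y))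
    (hT : HasFDerivAt T T' y) (ha : HasFDerivAt a a' y) (hb : HasFDerivAt b b' y) :
    ∃ D : E →L[ℝ] ℝ, HasFDerivAt (fun y => B (T y) (a y) (b y)) D y ∧
      ∀ u, D u = B' (T' u) (a y) (b y) + B (T y) (a' u) (b y) + B (T y) (a y) (b' u) := by
  refine ⟨_, ((hB.comp y hT).clm_apply ha).clm_apply hb, fun u => ?_⟩
  simp only [_root_.add_apply, ContinuousLinearMap.comp_apply, ContinuousLinearMap.flip_apply]
  ring

theorem ContDiffOn.continuousOn_fderiv_apply {E F : Type*} [NormedAddCommGroup E] [NormedSpace ℝ E]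
    [NormedAddCommGroup F] [NormedSpace ℝ F] {f : E → F} {s : Set E} (hf : ContDiffOn ℝ ∞ f s)
    (hs : IsOpen s) {v : E → E} (hv : ContinuousOn v s) :
    ContinuousOn (fun y => fderiv ℝ f y (v y)) s :=
  (hf.continuousOn_fderiv_of_isOpen hs (by simp)).clm_apply hv

section Trace

variable {N : ℕ}

/-- The trace of an endomorphism of `ℝᴺ`. -/
def trace (D : Coord N →L[ℝ] Coord N) : ℝ := ∑ i, stdCovec i (D (stdVec i))

theorem trace_comp_comm (S D : Coord N →L[ℝ] Coord N) : trace (S ∘L D) = trace (D ∘L S) :=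
  sum_stdCovec_comp (LinearMap.mk₂ ℝ (fun (ξ : Coord N →L[ℝ] ℝ) v => ξ (D v)) (by simp) (by simp)
    (by simp) (by simp)) S

theorem trace_sub (D E : Coord N →L[ℝ] Coord N) : trace (D - E) = trace D - trace E := by
  simp [trace]

theorem trace_add (D E : Coord N →L[ℝ] Coord N) : trace (D + E) = trace D + trace E := by
  simp [trace, Finset.sum_add_distrib]

theorem traceWith_symm {V : Type*} [NormedAddCommGroup V] [NormedSpace ℝ V]
    {A : (Coord N →L[ℝ] ℝ) →L[ℝ] Coord N} (hA : ∀ ξ η : Coord N →L[ℝ] ℝ, η (A ξ) = ξ (A η))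
    (B : Coord N →ₗ[ℝ] Coord N →ₗ[ℝ] V) :
    ∑ i, B (stdVec i) (A (stdCovec i)) = traceWith A B := by
  have h1 : ∀ i, B (stdVec i) (A (stdCovec i)) =
      ∑ j, stdCovec j (A (stdCovec i)) • B (stdVec i) (stdVec j) := fun i => by
    conv_lhs => rw [← sum_stdCovec_smul (A (stdCovec i)), map_sum]
    simp
  have h2 : ∀ i, B (A (stdCovec i)) (stdVec i) =
      ∑ j, stdCovec j (A (stdCovec i)) • B (stdVec j) (stdVec i) := fun i => by
    conv_lhs => rw [← sum_stdCovec_smul (A (stdCovec i)), map_sum, LinearMap.sum_apply]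
    simp
  rw [traceWith]
  simp only [h1, h2]
  rw [Finset.sum_comm]
  refine Finset.sum_congr rfl fun i _ => Finset.sum_congr rfl fun j _ => ?_
  rw [hA]

end Trace

/-! ### The divergence of a vector field -/

section Divergence

variable {N : ℕ} {M : Type*} [TopologicalSpace M] [ChartedSpace (Coord N) M]
  [IsManifold (𝓡 N) ∞ M] {g : Metric N M} {X : M → Coord N}

/-- Smoothness of a vector field, in terms of its coordinate expressions. -/
def IsSmoothVec (X : M → Coord N) : Prop :=
  ∀ z, ContDiffOn ℝ ∞ (coordVec z X) (extChartAt (𝓡 N) z).target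

theorem IsSmoothVec.differentiableAt (hX : IsSmoothVec X) {z : M} {y : Coord N}
    (hy : y ∈ (extChartAt (𝓡 N) z).target) : DifferentiableAt ℝ (coordVec z X) y :=
  ((hX z).contDiffAt (target_mem_nhds hy)).differentiableAt (by simp)

theorem differentiableAt_coordBilin_metric (g : Metric N M) {z : M} {y : Coord N}
    (hy : y ∈ (extChartAt (𝓡 N) z).target) :
    DifferentiableAt ℝ (coordBilin z (Metric.bilin g)) y :=
  ((contDiffOn_coordBilin_metric g z).contDiffAt (target_mem_nhds hy)).differentiableAt (by simp)

/-- The divergence of a vector field, computed in the chart at `z`. -/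
def chartDiv (g : Metric N M) (z : M) (X : M → Coord N) (y : Coord N) : ℝ :=
  trace (fderiv ℝ (coordVec z X) y) +
    1 / 2 * traceWith (coordBilin z (Metric.bilin g) y).inverse
      (bilinMap (fderiv ℝ (coordBilin z (Metric.bilin g)) y (coordVec z X y)))

/-- The divergence of a vector field. -/
def divergence (g : Metric N M) (X : M → Coord N) (x : M) : ℝ :=
  chartDiv g x X (extChartAt (𝓡 N) x x)

theorem fderiv_transition_chartDeriv {z w : M} {y : Coord N}
    (hy : y ∈ (extChartAt (𝓡 N) z).target)
    (hw : (extChartAt (𝓡 N) z).symm y ∈ (extChartAt (𝓡 N) w).source) (v : Coord N) :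
    fderiv ℝ (transition z w) y (chartDeriv z y v) = chartDeriv w (transition z w y) v := by
  have hT : transition z w y ∈ (extChartAt (𝓡 N) w).target := (extChartAt (𝓡 N) w).map_source hw
  have h1 := DFunLike.congr_fun (chartSymmDeriv_eq_comp hy hw) (chartDeriv z y v)
  rw [chartSymmDeriv_chartDeriv hy, ContinuousLinearMap.comp_apply] at h1
  conv_rhs => rw [h1]
  exact (chartDeriv_chartSymmDeriv hT _).symm

theorem coordVec_transition (X : M → Coord N) {z w : M} {y : Coord N}
    (hy : y ∈ (extChartAt (𝓡 N) z).target)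
    (hw : (extChartAt (𝓡 N) z).symm y ∈ (extChartAt (𝓡 N) w).source) :
    fderiv ℝ (transition z w) y (coordVec z X y) = coordVec w X (transition z w y) := by
  rw [coordVec, coordVec, fderiv_transition_chartDeriv hy hw, symm_transition hw]

theorem coordBilin_inverse_symm (g : Metric N M) {z : M} {y : Coord N}
    (hy : y ∈ (extChartAt (𝓡 N) z).target) (ξ η : Coord N →L[ℝ] ℝ) :
    η ((coordBilin z (Metric.bilin g) y).inverse ξ) =
      ξ ((coordBilin z (Metric.bilin g) y).inverse η) := by
  have h : ∀ ξ v, coordBilin z (Metric.bilin g) y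
      ((coordBilin z (Metric.bilin g) y).inverse ξ) v = ξ v := fun ξ v => by
    obtain ⟨e, he⟩ := coordBilin_metric_isInvertible g hy
    rw [← he, ContinuousLinearMap.inverse_equiv]
    exact DFunLike.congr_fun (e.apply_symm_apply ξ) v
  rw [← h η, coordBilin_metric_symm, h]

theorem coordBilin_inverse_transition (g : Metric N M) {z w : M} {y : Coord N}
    (hy : y ∈ (extChartAt (𝓡 N) z).target)
    (hw : (extChartAt (𝓡 N) z).symm y ∈ (extChartAt (𝓡 N) w).source) (ξ : Coord N →L[ℝ] ℝ) :
    (coordBilin w (Metric.bilin g) (transition z w y)).inverse ξ =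
      fderiv ℝ (transition z w) y ((coordBilin z (Metric.bilin g) y).inverse
        (ξ ∘L fderiv ℝ (transition z w) y)) := by
  have hT : transition z w y ∈ (extChartAt (𝓡 N) w).target := (extChartAt (𝓡 N) w).map_source hw
  have h : ξ ∘L chartDeriv w (transition z w y) =
      (ξ ∘L fderiv ℝ (transition z w) y) ∘L chartDeriv z y := by
    ext1 v
    rw [ContinuousLinearMap.comp_apply, ← fderiv_transition_chartDeriv hy hw]
    rfl
  rw [coordBilin_inverse_apply g hT, coordBilin_inverse_apply g hy,
    fderiv_transition_chartDeriv hy hw, symm_transition hw, h]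

/-- The divergence does not depend on the chart. -/
theorem chartDiv_transition (hX : IsSmoothVec X) {z w : M} {y : Coord N}
    (hy : y ∈ (extChartAt (𝓡 N) z).target)
    (hw : (extChartAt (𝓡 N) z).symm y ∈ (extChartAt (𝓡 N) w).source) :
    chartDiv g z X y = chartDiv g w X (transition z w y) := by
  have hT : transition z w y ∈ (extChartAt (𝓡 N) w).target := (extChartAt (𝓡 N) w).map_source hw
  have hTs := contDiffAt_transition hy hw
  set S := fderiv ℝ (transition (N := N) z w) y with hS
  set R := chartDeriv z y ∘L chartSymmDeriv w (transition z w y) with hR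
  set D2 := fderiv ℝ (fderiv ℝ (transition (N := N) z w)) y with hD2
  set V := coordVec z X y with hV
  have hRS : R ∘L S = ContinuousLinearMap.id ℝ (Coord N) := by
    rw [hR, ContinuousLinearMap.comp_assoc, ← chartSymmDeriv_eq_comp hy hw,
      chartDeriv_comp_chartSymmDeriv hy]
  have hSR : ∀ v, S (R v) = v := fun v => by
    rw [hR, ContinuousLinearMap.comp_apply, hS, fderiv_transition_chartDeriv hy hw,
      chartDeriv_chartSymmDeriv hT]
  have hsymm : ∀ u v, D2 u v = D2 v u := fun u v =>
    (hTs.isSymmSndFDerivAt minSmoothness_two_le).eq u v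
  have hdT : HasFDerivAt (transition (N := N) z w) S y :=
    (hTs.differentiableAt (by simp)).hasFDerivAt
  have hdT2 : HasFDerivAt (fderiv ℝ (transition (N := N) z w)) D2 y :=
    ((hTs.fderiv_right (m := ∞) (by simp)).differentiableAt (by simp)).hasFDerivAt
  have hdV := (hX.differentiableAt hy).hasFDerivAt
  have hdW := (hX.differentiableAt hT).hasFDerivAt
  have e1 : ∀ u, D2 u V + S (fderiv ℝ (coordVec z X) y u) =
      fderiv ℝ (coordVec w X) (transition z w y) (S u) := fun u => by
    have h1 := hdT2.clm_apply hdV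
    have h2 := hdW.comp y hdT
    have h3 : (fun y => fderiv ℝ (transition z w) y (coordVec z X y)) =ᶠ[𝓝 y]
        coordVec w X ∘ transition (N := N) z w := by
      filter_upwards [eventually_mem_source hy hw] with y' hy'
        using coordVec_transition X hy'.1 hy'.2
    have h4 := DFunLike.congr_fun ((h1.congr_of_eventuallyEq h3.symm).unique h2) u
    rw [add_comm]
    exact h4
  -- The coordinate trace is not invariant: the second derivative `D2` of the transition map
  -- contributes `-tr (R ∘ D2 V)`.
  have t1 : trace (fderiv ℝ (coordVec z X) y) =
      trace (fderiv ℝ (coordVec w X) (transition z w y)) - trace (R ∘L D2 V) := by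
    have h1 : fderiv ℝ (coordVec z X) y =
        (R ∘L fderiv ℝ (coordVec w X) (transition z w y)) ∘L S - R ∘L D2 V := by
      ext1 u
      have h2 := DFunLike.congr_fun hRS (fderiv ℝ (coordVec z X) y u)
      change R (S (fderiv ℝ (coordVec z X) y u)) = fderiv ℝ (coordVec z X) y u at h2
      change fderiv ℝ (coordVec z X) y u =
        R (fderiv ℝ (coordVec w X) (transition z w y) (S u)) - R (D2 V u)
      rw [← e1, map_add, h2, hsymm V]
      abel
    rw [h1, trace_sub, ← trace_comp_comm, ← ContinuousLinearMap.comp_assoc]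
    congr 2
    ext1 u
    exact hSR _
  set Gz := coordBilin z (Metric.bilin g) with hGz
  set Gw := coordBilin w (Metric.bilin g) with hGw
  have e2 : ∀ u v, fderiv ℝ Gz y V u v =
      fderiv ℝ Gw (transition z w y) (S V) (S u) (S v) +
        (Gz y (R (D2 V u)) v + Gz y u (R (D2 V v))) := fun u v => by
    obtain ⟨D1, h1, h1'⟩ := HasFDerivAt.bilin_comp
      (differentiableAt_coordBilin_metric g hT).hasFDerivAt hdT
      (hdT2.clm_apply (hasFDerivAt_const u y)) (hdT2.clm_apply (hasFDerivAt_const v y))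
    obtain ⟨D2', h2, h2'⟩ := HasFDerivAt.bilin_comp
      (T := id) (differentiableAt_coordBilin_metric g hy).hasFDerivAt (hasFDerivAt_id y)
      (hasFDerivAt_const u y) (hasFDerivAt_const v y)
    have h3 : (fun y' => Gz y' u v) =ᶠ[𝓝 y] fun y' => Gw (transition z w y')
        (fderiv ℝ (transition z w) y' u) (fderiv ℝ (transition z w) y' v) := by
      filter_upwards [eventually_mem_source hy hw] with y' hy'
      rw [hGz, coordBilin_transition _ hy'.1 hy'.2]
      rfl
    have h4 := DFunLike.congr_fun (h2.unique (h1.congr_of_eventuallyEq h3)) V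
    rw [h1', h2'] at h4
    have h5 : ∀ a b, Gz y a b = Gw (transition z w y) (S a) (S b) := fun a b => by
      rw [hGz, coordBilin_transition _ hy hw]
      rfl
    rw [h5, h5, hSR, hSR]
    simp only [_root_.add_apply, ContinuousLinearMap.comp_apply, ContinuousLinearMap.flip_apply,
      _root_.zero_apply, map_zero, zero_add, add_zero, id_eq, ContinuousLinearMap.id_apply] at h4
    rw [add_assoc] at h4
    exact h4
  -- The metric term changes by `2 tr (R ∘ D2 V)`, one copy from each argument of the metric; with
  -- its factor `½` this cancels the defect in `t1`.
  have t2 : traceWith (Gz y).inverse (bilinMap (fderiv ℝ Gz y V)) =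
      traceWith (Gw (transition z w y)).inverse
        (bilinMap (fderiv ℝ Gw (transition z w y) (coordVec w X (transition z w y)))) +
      2 * trace (R ∘L D2 V) := by
    have hinv : ∀ ξ v, Gz y ((Gz y).inverse ξ) v = ξ v := fun ξ v => by
      obtain ⟨e, he⟩ := coordBilin_metric_isInvertible g hy
      rw [hGz, ← he, ContinuousLinearMap.inverse_equiv]
      exact DFunLike.congr_fun (e.apply_symm_apply ξ) v
    have h3 : ∑ i, Gz y ((Gz y).inverse (stdCovec i)) (R (D2 V (stdVec i))) =
        trace (R ∘L D2 V) :=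
      Finset.sum_congr rfl fun i _ => hinv _ _
    have h2 : ∑ i, Gz y (R (D2 V ((Gz y).inverse (stdCovec i)))) (stdVec i) =
        trace (R ∘L D2 V) := by
      rw [← h3]
      have h4 := traceWith_symm (coordBilin_inverse_symm g hy)
        ((bilinMap (Gz y)).compl₁₂ LinearMap.id (R ∘L D2 V).toLinearMap)
      refine Eq.trans (Finset.sum_congr rfl fun i _ => ?_) h4
      exact coordBilin_metric_symm g z y _ _
    rw [traceWith_pullback (coordBilin_inverse_transition g hy hw), ← coordVec_transition X hy hw,
      traceWith]
    simp only [bilinMap_apply, e2, Finset.sum_add_distrib]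
    rw [h2, h3]
    ring
  rw [chartDiv, chartDiv, t1, t2]
  ring

theorem divergence_symm (hX : IsSmoothVec X) {z : M} {y : Coord N}
    (hy : y ∈ (extChartAt (𝓡 N) z).target) :
    divergence g X ((extChartAt (𝓡 N) z).symm y) = chartDiv g z X y :=
  (chartDiv_transition hX hy (mem_extChartAt_source _)).symm

theorem continuousOn_chartDiv (g : Metric N M) (hX : IsSmoothVec X) (z : M) :
    ContinuousOn (chartDiv g z X) (extChartAt (𝓡 N) z).target := by
  have h1 : ContinuousOn (fderiv ℝ (coordVec z X)) (extChartAt (𝓡 N) z).target :=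
    (hX z).continuousOn_fderiv_of_isOpen (isOpen_target z) (by simp)
  have h2 : ContinuousOn (fun y => fderiv ℝ (coordBilin z (Metric.bilin g)) y (coordVec z X y))
      (extChartAt (𝓡 N) z).target :=
    ContDiffOn.continuousOn_fderiv_apply (contDiffOn_coordBilin_metric g z) (isOpen_target z)
      (hX z).continuousOn
  have h3 := (contDiffOn_coordBilin_inverse g z).continuousOn
  refine ContinuousOn.add ?_ (continuousOn_const.mul ?_)
  · refine continuousOn_finsetSum _ fun i _ => ?_
    exact (stdCovec i).continuous.comp_continuousOn (h1.clm_apply continuousOn_const)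
  · refine continuousOn_finsetSum _ fun i _ => ?_
    exact (h2.clm_apply
      (h3.clm_apply continuousOn_const)).clm_apply continuousOn_const

theorem continuous_of_continuousOn_symm {Y : Type*} [TopologicalSpace Y] {f : M → Y}
    (h : ∀ z : M, ContinuousOn (f ∘ (extChartAt (𝓡 N) z).symm) (extChartAt (𝓡 N) z).target) :
    Continuous f := by
  refine continuous_iff_continuousAt.2 fun x => ?_
  have h1 := (h x).continuousAt (target_mem_nhds (base_mem_target (N := N) x))
  have h2 := ContinuousAt.comp h1 (continuousAt_extChartAt (I := 𝓡 N) x)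
  refine h2.congr ?_
  filter_upwards [extChartAt_source_mem_nhds (I := 𝓡 N) x] with x' hx'
  simp only [Function.comp_apply]
  rw [(extChartAt (𝓡 N) x).left_inv hx']

theorem continuous_divergence (hX : IsSmoothVec X) : Continuous (divergence g X) :=
  continuous_of_continuousOn_symm (N := N) fun z =>
    (continuousOn_chartDiv g hX z).congr fun _ hy => divergence_symm hX hy

/-- The divergence is the coordinate divergence with respect to the Riemannian density. -/
theorem sum_fderiv_density_mul (hX : IsSmoothVec X) {z : M} {y : Coord N}
    (hy : y ∈ (extChartAt (𝓡 N) z).target) :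
    ∑ i, fderiv ℝ (fun y => chartDensity g z y * stdCovec i (coordVec z X y)) y (stdVec i) =
      chartDensity g z y * chartDiv g z X y := by
  obtain ⟨D, hD, hD'⟩ := hasFDerivAt_gramDet
    (differentiableAt_coordBilin_metric g hy).hasFDerivAt (coordBilin_metric_symm g z y)
    (coordBilin_metric_isInvertible g hy) (gramDet_coordBilin_pos g hy).ne'
  have hpos := chartDensity_pos g hy
  have hsq : chartDensity g z y ^ 2 = gramDet (coordBilin z (Metric.bilin g) y) :=
    Real.sq_sqrt (gramDet_coordBilin_pos g hy).le
  -- The density is `√ det g`. With Jacobi's formula its logarithmic derivative is `½ tr (g⁻¹ ∂g)`,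
  -- the second term of `chartDiv`.
  have hr : HasFDerivAt (chartDensity g z) ((1 / (2 * chartDensity g z y)) • D) y :=
    hD.sqrt (gramDet_coordBilin_pos g hy).ne'
  have hV := (hX.differentiableAt hy).hasFDerivAt
  have h1 : ∀ i, fderiv ℝ (fun y => chartDensity g z y * stdCovec i (coordVec z X y)) y
      (stdVec i) = chartDensity g z y * stdCovec i (fderiv ℝ (coordVec z X) y (stdVec i)) +
        stdCovec i (coordVec z X y) • (1 / (2 * chartDensity g z y) * D (stdVec i)) := fun i => by
    have h2 := hr.mul ((stdCovec i).hasFDerivAt.comp y hV)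
    exact DFunLike.congr_fun h2.fderiv (stdVec i)
  simp only [h1]
  have h3 : ∑ i, stdCovec i (coordVec z X y) • D (stdVec i) = D (coordVec z X y) := by
    conv_rhs => rw [← sum_stdCovec_smul (coordVec z X y), map_sum]
    simp
  have h4 : ∑ i, stdCovec i (coordVec z X y) • (1 / (2 * chartDensity g z y) * D (stdVec i)) =
      1 / (2 * chartDensity g z y) * D (coordVec z X y) := by
    rw [← h3, Finset.mul_sum]
    refine Finset.sum_congr rfl fun i _ => ?_
    rw [smul_eq_mul, smul_eq_mul]
    ring
  rw [Finset.sum_add_distrib, h4, hD', ← Finset.mul_sum, ← hsq, chartDiv, trace]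
  field_simp

end Divergence

/-! ### The divergence theorem -/

section DivergenceTheorem

variable {N : ℕ} {M : Type*} [TopologicalSpace M] [ChartedSpace (Coord N) M]
  [IsManifold (𝓡 N) ∞ M] {g : Metric N M} {X Y : M → Coord N}

theorem coordVec_add (z : M) (X Y : M → Coord N) :
    coordVec z (X + Y) = coordVec z X + coordVec z Y := by
  funext y
  exact map_add (chartDeriv z y) _ _

theorem IsSmoothVec.add (hX : IsSmoothVec X) (hY : IsSmoothVec Y) : IsSmoothVec (X + Y) :=
  fun z => by
    rw [coordVec_add]
    exact (hX z).add (hY z)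

theorem coordVec_zero (z : M) : coordVec z (0 : M → Coord N) = 0 := by
  funext y
  exact map_zero (chartDeriv z y)

theorem isSmoothVec_zero : IsSmoothVec (0 : M → Coord N) := fun z => by
  rw [coordVec_zero]
  exact contDiffOn_const

theorem divergence_add (hX : IsSmoothVec X) (hY : IsSmoothVec Y) :
    divergence g (X + Y) = divergence g X + divergence g Y := by
  funext x
  have hb := base_mem_target (N := N) x
  have h1 : fderiv ℝ (coordVec x X + coordVec x Y) (extChartAt (𝓡 N) x x) =
      fderiv ℝ (coordVec x X) (extChartAt (𝓡 N) x x) +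
        fderiv ℝ (coordVec x Y) (extChartAt (𝓡 N) x x) :=
    fderiv_add (hX.differentiableAt hb) (hY.differentiableAt hb)
  rw [Pi.add_apply, divergence, divergence, divergence, chartDiv, chartDiv, chartDiv, coordVec_add,
    h1, trace_add, Pi.add_apply, map_add]
  simp only [traceWith, bilinMap_apply, _root_.add_apply, Finset.sum_add_distrib]
  ring

theorem chartDiv_of_eventuallyEq_zero {z : M} {y : Coord N} (h : coordVec z X =ᶠ[𝓝 y] 0) :
    chartDiv g z X y = 0 := by
  have h1 : fderiv ℝ (coordVec z X) y = 0 := by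
    rw [h.fderiv_eq]
    exact fderiv_const_apply 0
  rw [chartDiv, h1, h.eq_of_nhds, Pi.zero_apply, map_zero]
  simp [trace, traceWith, bilinMap_apply]

theorem divergence_zero : divergence g (0 : M → Coord N) = 0 := by
  funext x
  refine chartDiv_of_eventuallyEq_zero ?_
  rw [coordVec_zero]

theorem isSmoothVec_sum {ι : Type*} (s : Finset ι) {X : ι → M → Coord N}
    (h : ∀ i ∈ s, IsSmoothVec (X i)) : IsSmoothVec (∑ i ∈ s, X i) :=
  Finset.sum_induction X IsSmoothVec (fun _ _ => IsSmoothVec.add) isSmoothVec_zero h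

theorem divergence_sum {ι : Type*} (s : Finset ι) {X : ι → M → Coord N}
    (h : ∀ i ∈ s, IsSmoothVec (X i)) :
    divergence g (∑ i ∈ s, X i) = ∑ i ∈ s, divergence g (X i) := by
  classical
  induction s using Finset.induction_on with
  | empty => simpa using divergence_zero
  | insert i s hi ih =>
    rw [Finset.sum_insert hi, Finset.sum_insert hi, divergence_add
      (h i (Finset.mem_insert_self i s))
      (isSmoothVec_sum s fun j hj => h j (Finset.mem_insert_of_mem hj)),
      ih fun j hj => h j (Finset.mem_insert_of_mem hj)]

theorem coordVec_smul (z : M) (ρ : M → ℝ) (X : M → Coord N) (y : Coord N) :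
    coordVec z (fun x => ρ x • X x) y = ρ ((extChartAt (𝓡 N) z).symm y) • coordVec z X y :=
  map_smul (chartDeriv z y) _ _

theorem IsSmoothVec.smul {ρ : M → ℝ} (hρ : ContMDiff (𝓡 N) 𝓘(ℝ, ℝ) ∞ ρ) (hX : IsSmoothVec X) :
    IsSmoothVec fun x => ρ x • X x := fun z => by
  have h1 : ContMDiffOn 𝓘(ℝ, Coord N) 𝓘(ℝ, ℝ) ∞ (ρ ∘ (extChartAt (𝓡 N) z).symm)
      (extChartAt (𝓡 N) z).target :=
    hρ.comp_contMDiffOn (contMDiffOn_extChartAt_symm z)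
  exact (h1.contDiffOn.smul (hX z)).congr fun y _ => coordVec_smul z ρ X y

variable [MeasurableSpace M] [BorelSpace M]

/-- The divergence theorem for vector fields that are supported in a chart domain. -/
theorem integral_divergence_of_support [CompactSpace M] (hX : IsSmoothVec X) (z : M) {C : Set M}
    (hC : IsClosed C) (hCz : C ⊆ (extChartAt (𝓡 N) z).source) (h0 : ∀ x, x ∉ C → X x = 0) :
    ∫ x, divergence g X x ∂(volumeMeasure g) = 0 := by
  set K := extChartAt (𝓡 N) z '' C with hK
  set T := (extChartAt (𝓡 N) z).target with hT
  have hKc : IsCompact K := hC.isCompact.image_of_continuousOn ((continuousOn_extChartAt z).mono hCz)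
  have hKT : K ⊆ T := by
    rintro _ ⟨x, hx, rfl⟩
    exact (extChartAt (𝓡 N) z).map_source (hCz hx)
  -- Extending `√det g · Xⁱ` by zero outside the chart target gives a smooth function on `ℝᴺ`,
  -- because the support of `X` corresponds to a compact subset of the target.
  let w : Fin N → Coord N → ℝ := fun i =>
    T.indicator fun y => chartDensity g z y * stdCovec i (coordVec z X y)
  have hw0 : ∀ i y, y ∉ K → w i y = 0 := fun i y hy => by
    by_cases hyT : y ∈ T
    · have h1 : X ((extChartAt (𝓡 N) z).symm y) = 0 := h0 _ fun h =>
        hy ⟨_, h, (extChartAt (𝓡 N) z).right_inv hyT⟩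
      simp only [w, Set.indicator_of_mem hyT, coordVec, h1, map_zero, mul_zero]
    · exact Set.indicator_of_notMem hyT _
  have hwc : ∀ i, HasCompactSupport (w i) := fun i => HasCompactSupport.intro hKc fun y hy => hw0 i y hy
  have hwT : ∀ i, ∀ y ∈ T,
      w i =ᶠ[𝓝 y] fun y => chartDensity g z y * stdCovec i (coordVec z X y) := fun i y hy => by
    filter_upwards [target_mem_nhds hy] with y' hy'
    exact Set.indicator_of_mem hy' _
  have hwd : ∀ i, ContDiff ℝ ∞ (w i) := fun i => contDiff_iff_contDiffAt.2 fun y => by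
    by_cases hy : y ∈ T
    · refine ContDiffAt.congr_of_eventuallyEq ?_ (hwT i y hy)
      exact ((contDiffOn_chartDensity g z).mul
        ((stdCovec i).contDiff.comp_contDiffOn (hX z))).contDiffAt (target_mem_nhds hy)
    · refine (contDiffAt_const (c := (0 : ℝ))).congr_of_eventuallyEq ?_
      filter_upwards [hKc.isClosed.isOpen_compl.mem_nhds fun h => hy (hKT h)] with y' hy'
      exact hw0 i y' hy'
  have hdiv0 : ∀ x, x ∉ C → divergence g X x = 0 := fun x hx => by
    refine chartDiv_of_eventuallyEq_zero ?_
    have h1 : (extChartAt (𝓡 N) x).symm ⁻¹' Cᶜ ∈ 𝓝 (extChartAt (𝓡 N) x x) :=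
      (mdifferentiableAt_symm (base_mem_target (N := N) x)).continuousAt.preimage_mem_nhds
        (by rw [symm_base]; exact hC.isOpen_compl.mem_nhds hx)
    filter_upwards [h1] with y hy
    rw [coordVec, h0 _ hy, map_zero]
    rfl
  rw [integral_eq_chart g z (continuous_divergence hX) fun x hx => hdiv0 x fun h => hx (hCz h)]
  have h1 : ∫ y in T, chartDensity g z y * divergence g X ((extChartAt (𝓡 N) z).symm y) =
      ∫ y in T, ∑ i, fderiv ℝ (w i) y (stdVec i) := by
    refine setIntegral_congr_fun (isOpen_target z).measurableSet fun y hy => ?_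
    rw [divergence_symm hX hy, ← sum_fderiv_density_mul hX hy]
    refine Finset.sum_congr rfl fun i _ => ?_
    rw [(hwT i y hy).fderiv_eq]
  rw [h1, setIntegral_eq_integral_of_forall_compl_eq_zero, integral_finsetSum]
  · exact Finset.sum_eq_zero fun i _ =>
      integral_fderiv_eq_zero ((hwd i).of_le (by simp)) (hwc i) (stdVec i)
  · refine fun i _ => Continuous.integrable_of_hasCompactSupport ?_ ?_
    · exact ((hwd i).continuous_fderiv (by simp)).clm_apply continuous_const
    · exact ((hwc i).fderiv ℝ).comp_left (g := fun L : Coord N →L[ℝ] ℝ => L (stdVec i)) rfl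
  · refine fun y hy => Finset.sum_eq_zero fun i _ => ?_
    have h2 : w i =ᶠ[𝓝 y] fun _ => 0 := by
      filter_upwards [hKc.isClosed.isOpen_compl.mem_nhds fun h => hy (hKT h)] with y' hy'
      exact hw0 i y' hy'
    rw [h2.fderiv_eq, fderiv_const_apply]
    rfl

/-- The divergence theorem on a compact manifold. -/
theorem integral_divergence_eq_zero [T2Space M] [CompactSpace M] (hX : IsSmoothVec X) :
    ∫ x, divergence g X x ∂(volumeMeasure g) = 0 := by
  obtain ⟨ρ, hρ⟩ := SmoothPartitionOfUnity.exists_isSubordinate_chartAt_source (𝓡 N) M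
  have hfin := ρ.locallyFinite.finite_nonempty_of_compact
  set s := hfin.toFinset with hs
  -- By compactness only finitely many functions of the partition of unity are nonzero, so `X` is a
  -- finite sum of fields supported in charts.
  have hsum : X = ∑ i ∈ s, fun x => ρ i x • X x := by
    funext x
    rw [Finset.sum_apply, ← Finset.sum_smul]
    have h1 := ρ.sum_eq_one (Set.mem_univ x)
    rw [finsum_eq_sum_of_support_subset (s := s)] at h1
    · rw [h1, one_smul]
    · intro i hi
      rw [Finset.mem_coe, hs, Set.Finite.mem_toFinset]
      exact ⟨x, hi⟩
  have hsm : ∀ i ∈ s, IsSmoothVec fun x => ρ i x • X x := fun i _ =>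
    hX.smul (ρ i).contMDiff
  have hint : ∀ i ∈ s, Integrable (divergence g fun x => ρ i x • X x) (volumeMeasure g) :=
    fun i hi => (continuous_divergence (hsm i hi)).integrable_of_hasCompactSupport
      (HasCompactSupport.of_compactSpace _)
  rw [hsum, divergence_sum s hsm]
  simp only [Finset.sum_apply]
  rw [integral_finsetSum s hint]
  refine Finset.sum_eq_zero fun i hi => integral_divergence_of_support (hsm i hi) i
    (isClosed_tsupport (ρ i)) ?_ fun x hx => ?_
  · rw [extChartAt_source]
    exact hρ i
  · rw [image_eq_zero_of_notMem_tsupport hx, zero_smul]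

end DivergenceTheorem

/-! ### Splitting traces into normal and leafwise parts -/

section TraceDecomposition

variable {N p : ℕ} {M : Type*} [TopologicalSpace M] [ChartedSpace (Coord N) M]
  [IsManifold (𝓡 N) ∞ M] [T2Space M]

theorem traceWith_eq_sum {V ι : Type*} [NormedAddCommGroup V] [NormedSpace ℝ V] [Fintype ι]
    {A : (Coord N →L[ℝ] ℝ) →L[ℝ] Coord N} (E : ι → Coord N)
    (h : ∀ ξ : Coord N →L[ℝ] ℝ, A ξ = ∑ a, ξ (E a) • E a) (B : Coord N →ₗ[ℝ] Coord N →ₗ[ℝ] V) :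
    traceWith A B = ∑ a, B (E a) (E a) := by
  simp only [traceWith, h, map_sum, LinearMap.sum_apply, map_smul, LinearMap.smul_apply]
  rw [Finset.sum_comm]
  refine Finset.sum_congr rfl fun a _ => ?_
  conv_rhs => rw [← sum_stdCovec_smul (E a), map_sum, sum_stdCovec_smul (E a)]
  simp only [map_smul]

theorem sharp_eq_sum_onb (F : Foliation N p M) (g : Metric N M) (x : M) (ξ : Coord N →L[ℝ] ℝ) :
    sharp g x ξ = ∑ a, ξ (onb g x (normal F g x) a) • (onb g x (normal F g x) a : Coord N) +
      ∑ j, ξ (onb g x (F.tangent x) j) • (onb g x (F.tangent x) j : Coord N) := by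
  rw [← cometric_eq_sum_onb]
  have h1 := sum_bilin_onb g x (F.tangent x) (sub_proj_mem_tangent F g x (sharp g x ξ))
  have h2 : ∀ j, Metric.bilin g x (sharp g x ξ - proj F g x (sharp g x ξ))
      (onb g x (F.tangent x) j) = ξ (onb g x (F.tangent x) j) := fun j => by
    rw [map_sub, _root_.sub_apply, bilin_sharp, Metric.bilin_symm g x (proj F g x _),
      bilin_tangent_normal F g x (onb g x (F.tangent x) j).2 (proj_mem_normal F g x _), sub_zero]
  simp only [h2] at h1
  rw [h1, cometric, ContinuousLinearMap.comp_apply]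
  abel

theorem traceWith_sharp {V : Type*} [NormedAddCommGroup V] [NormedSpace ℝ V] (F : Foliation N p M)
    (g : Metric N M) (x : M) (B : Coord N →ₗ[ℝ] Coord N →ₗ[ℝ] V) :
    traceWith (sharp g x) B =
      ∑ a, B (onb g x (normal F g x) a) (onb g x (normal F g x) a) +
        ∑ j, B (onb g x (F.tangent x) j) (onb g x (F.tangent x) j) := by
  rw [traceWith_eq_sum (Sum.elim (fun a => (onb g x (normal F g x) a : Coord N))
    (fun j => (onb g x (F.tangent x) j : Coord N))), Fintype.sum_sum_type]
  · rfl
  · intro ξ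
    rw [sharp_eq_sum_onb F, Fintype.sum_sum_type]
    rfl

theorem trace_eq_sum_onb (F : Foliation N p M) (g : Metric N M) (x : M)
    (T : Coord N →L[ℝ] Coord N) :
    trace T =
      ∑ a, Metric.bilin g x (T (onb g x (normal F g x) a)) (onb g x (normal F g x) a) +
        ∑ j, Metric.bilin g x (T (onb g x (F.tangent x) j)) (onb g x (F.tangent x) j) := by
  have h := traceWith_sharp F g x ((bilinMap (Metric.bilin g x)).flip.compl₂ T.toLinearMap).flip.flip
  refine Eq.trans ?_ (h.trans rfl)
  refine Finset.sum_congr rfl fun i _ => ?_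
  change stdCovec i (T (stdVec i)) = Metric.bilin g x (T (stdVec i)) (sharp g x (stdCovec i))
  rw [Metric.bilin_symm, bilin_sharp]

end TraceDecomposition

/-! ### Mean curvature and the divergence of dual vector fields -/

section FirstOrder

variable {N p : ℕ} {M : Type*} [TopologicalSpace M] [ChartedSpace (Coord N) M]
  [IsManifold (𝓡 N) ∞ M] [T2Space M] (F : Foliation N p M) (g : Metric N M) (x : M)

/-- The coordinate derivative of the metric, in the chart at `x`. -/
def metricDeriv (g : Metric N M) (x : M) : Coord N →L[ℝ] Coord N →L[ℝ] Coord N →L[ℝ] ℝ :=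
  fderiv ℝ (coordBilin x (Metric.bilin g)) (extChartAt (𝓡 N) x x)

theorem fderiv_transMetric_eq_metricDeriv (u v w : Coord N) :
    fderiv ℝ (coordBilin x (transMetric F g)) (extChartAt (𝓡 N) x x) u v w =
      metricDeriv g x u (proj F g x v) (proj F g x w) +
        Metric.bilin g x (projDeriv F g x u v) (proj F g x w) +
        Metric.bilin g x (proj F g x v) (projDeriv F g x u w) := by
  have hP := (differentiableAt_coordEnd_proj F g x).hasFDerivAt
  obtain ⟨D, hD, hD'⟩ := HasFDerivAt.bilin_comp (T := id)
    (differentiableAt_coordBilin_metric g (base_mem_target x)).hasFDerivAt (hasFDerivAt_id _)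
    (hP.clm_apply (hasFDerivAt_const v _)) (hP.clm_apply (hasFDerivAt_const w _))
  obtain ⟨D', hd, hd'⟩ := HasFDerivAt.bilin_comp (T := id)
    (differentiableAt_coordBilin_transMetric F g x).hasFDerivAt (hasFDerivAt_id _)
    (hasFDerivAt_const v _) (hasFDerivAt_const w _)
  have h0 : (fun y => coordBilin x (transMetric F g) (id y) v w) =ᶠ[𝓝 (extChartAt (𝓡 N) x x)]
      fun y => coordBilin x (Metric.bilin g) (id y) (coordEnd x (proj F g) y v)
        (coordEnd x (proj F g) y w) := by
    filter_upwards [target_mem_nhds (base_mem_target (N := N) x)] with y hy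
    rw [id, coordBilin_transMetric F g x hy]
    rfl
  have h1 := DFunLike.congr_fun (hd.unique (hD.congr_of_eventuallyEq h0)) u
  rw [hD', hd'] at h1
  simp only [_root_.add_apply, ContinuousLinearMap.comp_apply, ContinuousLinearMap.flip_apply,
    _root_.zero_apply, map_zero, zero_add, add_zero, id_eq, ContinuousLinearMap.id_apply,
    coordEnd_base, coordBilin_base] at h1
  exact h1

/-- Differentiate the self-adjointness `g(u, π w) = g(π u, w)`. -/
theorem bilin_projDeriv (z u w : Coord N) :
    metricDeriv g x z u (proj F g x w) + Metric.bilin g x u (projDeriv F g x z w) =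
      metricDeriv g x z (proj F g x u) w + Metric.bilin g x (projDeriv F g x z u) w := by
  have hP := (differentiableAt_coordEnd_proj F g x).hasFDerivAt
  obtain ⟨D, hD, hD'⟩ := HasFDerivAt.bilin_comp (T := id)
    (differentiableAt_coordBilin_metric g (base_mem_target x)).hasFDerivAt (hasFDerivAt_id _)
    (hasFDerivAt_const u _) (hP.clm_apply (hasFDerivAt_const w _))
  obtain ⟨D', hd, hd'⟩ := HasFDerivAt.bilin_comp (T := id)
    (differentiableAt_coordBilin_metric g (base_mem_target x)).hasFDerivAt (hasFDerivAt_id _)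
    (hP.clm_apply (hasFDerivAt_const u _)) (hasFDerivAt_const w _)
  have h0 : (fun y => coordBilin x (Metric.bilin g) (id y) u (coordEnd x (proj F g) y w))
      =ᶠ[𝓝 (extChartAt (𝓡 N) x x)]
      fun y => coordBilin x (Metric.bilin g) (id y) (coordEnd x (proj F g) y u) w := by
    filter_upwards [target_mem_nhds (base_mem_target (N := N) x)] with y hy
    rw [id, coordBilin_apply, coordBilin_apply, coordEnd_apply, coordEnd_apply,
      chartSymmDeriv_chartDeriv hy, chartSymmDeriv_chartDeriv hy, bilin_proj_right, bilin_proj_left]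
  have h1 := DFunLike.congr_fun (hD.unique (hd.congr_of_eventuallyEq h0)) z
  rw [hD', hd'] at h1
  simp only [_root_.add_apply, ContinuousLinearMap.comp_apply, ContinuousLinearMap.flip_apply,
    _root_.zero_apply, map_zero, zero_add, add_zero, id_eq, ContinuousLinearMap.id_apply,
    coordEnd_base, coordBilin_base] at h1
  exact h1

/-- The derivative of a projection maps its image into its kernel, here the leaf directions. -/
theorem bilin_projDeriv_normal (u : Coord N) {v w : Coord N} (hv : v ∈ normal F g x)
    (hw : w ∈ normal F g x) : Metric.bilin g x (projDeriv F g x u v) w = 0 := by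
  have h1 := proj_projDeriv_proj F g x u v
  rw [proj_of_mem_normal F g x hv] at h1
  rw [← proj_of_mem_normal F g x hw, bilin_proj_right, ← transMetric_proj_left, h1, map_zero,
    _root_.zero_apply]

/-- The mean curvature form, in terms of the coordinate derivatives of the metric and of the
projection. -/
theorem meanCurvatureForm_apply {X : Coord N} (hX : X ∈ normal F g x) :
    meanCurvatureForm F g x X = -∑ j, (Metric.bilin g x
        (projDeriv F g x (onb g x (F.tangent x) j) X) (onb g x (F.tangent x) j : Coord N) +
      1 / 2 * metricDeriv g x X (onb g x (F.tangent x) j : Coord N)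
        (onb g x (F.tangent x) j : Coord N)) := by
  rw [meanCurvatureForm, ContinuousLinearMap.comp_apply, proj_of_mem_normal F g x hX,
    meanCurvatureVector, map_sum, _root_.sum_apply, ← Finset.sum_neg_distrib]
  refine Finset.sum_congr rfl fun j _ => ?_
  set f : Coord N := (onb g x (F.tangent x) j).1 with hf
  have hft : f ∈ F.tangent x := (onb g x (F.tangent x) j).2
  have hP := (differentiableAt_coordEnd_proj F g x).hasFDerivAt.clm_apply
    (hasFDerivAt_const f (extChartAt (𝓡 N) x x))
  -- The leafwise extension of `f` is not constant in coordinates; its derivative combines with the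
  -- Christoffel term so that `∂_f g(f, X)` cancels below.
  have h1 : fderiv ℝ (fun y => f - coordEnd x (proj F g) y f) (extChartAt (𝓡 N) x x) f =
      -projDeriv F g x f f := by
    rw [(hP.const_sub f).fderiv]
    simp [projDeriv]
  have h2 : Metric.bilin g x (leviCivita g x f f) X =
      metricDeriv g x f f X - 1 / 2 * metricDeriv g x X f f := by
    rw [leviCivita, ContinuousLinearMap.comp_apply, bilin_sharp, koszul_apply]
    change 1 / 2 * (metricDeriv g x f f X + metricDeriv g x f f X - metricDeriv g x X f f) = _
    ring
  have h3 := bilin_projDeriv F g x f f X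
  rw [proj_of_mem_normal F g x hX, proj_of_mem_tangent F g x hft, map_zero, _root_.zero_apply,
    zero_add] at h3
  rw [h1, bilin_proj_left, ← bilin_proj_right, proj_of_mem_normal F g x hX, map_add,
    _root_.add_apply, h2, map_neg, _root_.neg_apply,
    Metric.bilin_symm g x (projDeriv F g x f X)]
  linarith

theorem apply_cometric_comm (ξ η : Coord N →L[ℝ] ℝ) :
    η (cometric F g x ξ) = ξ (cometric F g x η) := by
  have h1 := transMetric_cometric F g x ξ (cometric F g x η)
  have h2 := transMetric_cometric F g x η (cometric F g x ξ)
  rw [proj_cometric] at h1 h2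
  rw [← h1, ← h2, transMetric_symm]

/-- The vector field that is dual to a basic one-form. -/
def dualField (ψ : Form N M ℝ 1) : M → Coord N := fun x => cometric F g x (covector ψ x)

variable {F g x} {ψ : Form N M ℝ 1}

theorem coordVec_dualField (F : Foliation N p M) (g : Metric N M) (ψ : Form N M ℝ 1) {z : M}
    {y : Coord N} (hy : y ∈ (extChartAt (𝓡 N) z).target) :
    coordVec z (dualField F g ψ) y = coordCometric F g z y
      ((ContinuousAlternatingMap.ofSubsingletonLIE (𝕜 := ℝ) (E := Coord N) (F := ℝ)
        (0 : Fin 1)).symm (coordForm z ψ y)) := by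
  rw [coordCometric_apply F g hy, coordVec, dualField]
  congr 2
  ext1 v
  change ψ _ (fun _ => v) = coordForm z ψ y (fun _ => chartDeriv z y v)
  rw [coordForm_apply]
  congr 1
  funext i
  exact (chartSymmDeriv_chartDeriv hy v).symm

theorem isSmoothVec_dualField (hψ : IsSmoothForm ψ) : IsSmoothVec (dualField F g ψ) := fun z =>
  ((contDiffOn_coordCometric F g z).clm_apply (hψ.contDiffOn_covector z)).congr
    fun _ hy => coordVec_dualField F g ψ hy

/-- Leibniz rule for the cometric applied to `ψ`, the cometric being parallel. -/
theorem fderiv_coordVec_dualField (hg : IsBundleLike F g) (hψ : IsSmoothForm ψ) (u : Coord N) :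
    fderiv ℝ (coordVec x (dualField F g ψ)) (extChartAt (𝓡 N) x x) u =
      -adaptedConn F g x u (dualField F g ψ x) +
        cometric F g x (covectorDeriv ψ x u - covector ψ x ∘L adaptedConn F g x u) := by
  have h1 : HasFDerivAt (fun y => (ContinuousAlternatingMap.ofSubsingletonLIE (𝕜 := ℝ)
      (E := Coord N) (F := ℝ) (0 : Fin 1)).symm (coordForm x ψ y)) (covectorDeriv ψ x)
      (extChartAt (𝓡 N) x x) :=
    (ContinuousAlternatingMap.ofSubsingletonLIE (𝕜 := ℝ) (E := Coord N) (F := ℝ)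
      (0 : Fin 1)).symm.toContinuousLinearEquiv.toContinuousLinearMap.hasFDerivAt.comp
        (extChartAt (𝓡 N) x x) (hψ.differentiableAt (base_mem_target (N := N) x)).hasFDerivAt
  have h2 := (differentiableAt_coordCometric F g x).hasFDerivAt.clm_apply h1
  have h3 : coordVec x (dualField F g ψ) =ᶠ[𝓝 (extChartAt (𝓡 N) x x)] fun y =>
      coordCometric F g x y ((ContinuousAlternatingMap.ofSubsingletonLIE (𝕜 := ℝ)
      (E := Coord N) (F := ℝ) (0 : Fin 1)).symm (coordForm x ψ y)) := by
    filter_upwards [target_mem_nhds (base_mem_target (N := N) x)] with y hy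
    exact coordVec_dualField F g ψ hy
  have h4 := DFunLike.congr_fun (h2.congr_of_eventuallyEq h3).fderiv u
  have h5 := fderiv_coordCometric_eq hg x u (covector ψ x)
  rw [h4, map_sub]
  simp only [_root_.add_apply, ContinuousLinearMap.comp_apply, ContinuousLinearMap.flip_apply,
    coordCometric_base]
  rw [coordForm_base]
  change cometric F g x _ + fderiv ℝ (coordCometric F g x) (extChartAt (𝓡 N) x x) u
    (covector ψ x) = _
  rw [h5, dualField]
  abel

/-- The covariant derivative of a real one-form. -/
def covectorCovDeriv (F : Foliation N p M) (g : Metric N M) (ψ : Form N M ℝ 1) (x : M) :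
    Coord N →L[ℝ] Coord N →L[ℝ] ℝ :=
  covectorDeriv ψ x -
    (ContinuousLinearMap.compL ℝ (Coord N) (Coord N) ℝ (covector ψ x)) ∘L transConnL F g x

theorem covectorCovDeriv_apply (u v : Coord N) :
    covectorCovDeriv F g ψ x u v = covectorDeriv ψ x u v - covector ψ x (transConn F g x u v) := rfl

/-- The divergence of the vector field that is dual to a basic one-form. -/
theorem divergence_dualField (hg : IsBundleLike F g) (hψ : IsBasic F ψ) (x : M) :
    divergence g (dualField F g ψ) x =
      traceWith (cometric F g x) (bilinMap (covectorCovDeriv F g ψ x)) -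
      meanCurvatureForm F g x (dualField F g ψ x) := by
  set X := dualField F g ψ x with hX
  have hXn : X ∈ normal F g x := by
    rw [hX, dualField, ← proj_cometric]
    exact proj_mem_normal F g x _
  have hXP : proj F g x X = X := proj_of_mem_normal F g x hXn
  let TP : Coord N →L[ℝ] Coord N :=
    (fderiv ℝ (coordEnd x (proj F g)) (extChartAt (𝓡 N) x x)).flip X
  have e1 : ∀ u, fderiv ℝ (coordVec x (dualField F g ψ)) (extChartAt (𝓡 N) x x) u =
      TP u - transConn F g x X u +
        cometric F g x (covectorCovDeriv F g ψ x u) := fun u => by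
    have h1 : covector ψ x ∘L adaptedConn F g x u = covector ψ x ∘L transConn F g x u := by
      ext1 v
      rw [ContinuousLinearMap.comp_apply, ContinuousLinearMap.comp_apply,
        ← hψ.covector_proj g, proj_adaptedConn]
    rw [fderiv_coordVec_dualField hg hψ.smooth, h1, adaptedConn_apply, ← hX, hXP,
      transConn_symm F g x X u]
    change -(_ - TP u) + cometric F g x (covectorCovDeriv F g ψ x u) = _
    abel
  have e2 : trace (fderiv ℝ (coordVec x (dualField F g ψ)) (extChartAt (𝓡 N) x x)) =
      trace TP - trace (transConn F g x X) +
        traceWith (cometric F g x) (bilinMap (covectorCovDeriv F g ψ x)) := by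
    rw [← traceWith_flip]
    simp only [trace, e1, map_add, map_sub, Finset.sum_add_distrib, Finset.sum_sub_distrib]
    congr 1
    refine Finset.sum_congr rfl fun i _ => ?_
    rw [apply_cometric_comm, bilinMap_apply]
  -- Normal diagonal entries vanish, since the derivative of the projection sends normal vectors to
  -- leaf vectors.
  have e3 : trace TP = ∑ j, Metric.bilin g x
      (projDeriv F g x (onb g x (F.tangent x) j) X) (onb g x (F.tangent x) j : Coord N) := by
    rw [trace_eq_sum_onb F g x, Finset.sum_eq_zero, zero_add]
    · rfl
    · exact fun a _ => bilin_projDeriv_normal F g x _ hXn (onb g x (normal F g x) a).2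
  -- This cancels the normal half of `½ tr (g⁻¹ ∂_X g)`. The leafwise half, together with `e3`, is
  -- `-κ(X)`.
  have e4 : trace (transConn F g x X) = ∑ a, 1 / 2 * metricDeriv g x X
      (onb g x (normal F g x) a : Coord N) (onb g x (normal F g x) a : Coord N) := by
    rw [trace_eq_sum_onb F g x, Finset.sum_eq_zero (f := fun j => Metric.bilin g x
      (transConn F g x X (onb g x (F.tangent x) j)) (onb g x (F.tangent x) j : Coord N)), add_zero]
    · refine Finset.sum_congr rfl fun a _ => ?_
      set E : Coord N := (onb g x (normal F g x) a).1 with hE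
      have hEn : E ∈ normal F g x := (onb g x (normal F g x) a).2
      rw [← proj_transConn, bilin_proj_left, transMetric_transConn hg, koszul_apply,
        fderiv_transMetric_eq_metricDeriv F g x X, proj_of_mem_normal F g x hEn,
        Metric.bilin_symm g x E, bilin_projDeriv_normal F g x X hEn hEn]
      ring
    · intro j _
      rw [← proj_transConn, Metric.bilin_symm]
      exact bilin_tangent_normal F g x (onb g x (F.tangent x) j).2 (proj_mem_normal F g x _)
  have e5 : traceWith (sharp g x) (bilinMap (metricDeriv g x X)) = _ := traceWith_sharp F g x _
  rw [divergence, chartDiv, e2, coordBilin_base, coordVec_base, ← hX, e3, e4]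
  change _ + 1 / 2 * traceWith (sharp g x) (bilinMap (metricDeriv g x X)) = _
  rw [e5, meanCurvatureForm_apply F g x hXn]
  simp only [bilinMap_apply, Finset.sum_add_distrib, ← Finset.mul_sum]
  ring

end FirstOrder

/-! ### Alternations in low degree -/

section LowDegree

variable {N : ℕ} {V : Type*} [NormedAddCommGroup V] [NormedSpace ℝ V]

theorem alternatize_apply_one (L : Coord N →L[ℝ] Coord N [⋀^Fin 0]→L[ℝ] V) (u : Coord N) :
    ContinuousAlternatingMap.alternatizeUncurryFin L ![u] = L u ![] := by
  rw [ContinuousAlternatingMap.alternatizeUncurryFin_apply, Fin.sum_univ_one]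
  simp only [Fin.val_zero, pow_zero, one_smul]
  exact congrArg _ (Subsingleton.elim _ _)

theorem alternatize_apply_two (L : Coord N →L[ℝ] Coord N [⋀^Fin 1]→L[ℝ] V) (u v : Coord N) :
    ContinuousAlternatingMap.alternatizeUncurryFin L ![u, v] = L u ![v] - L v ![u] := by
  rw [ContinuousAlternatingMap.alternatizeUncurryFin_apply, Fin.sum_univ_two]
  have h1 : (1 : Fin 2).removeNth ![u, v] = ![u] := by
    funext i
    fin_cases i
    rfl
  have h0 : (0 : Fin 2).removeNth ![u, v] = ![v] := rfl
  rw [h0, h1]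
  simp [sub_eq_add_neg]

theorem alternatize_apply_three (L : Coord N →L[ℝ] Coord N [⋀^Fin 2]→L[ℝ] V) (u v w : Coord N) :
    ContinuousAlternatingMap.alternatizeUncurryFin L ![u, v, w] =
      L u ![v, w] - L v ![u, w] + L w ![u, v] := by
  rw [ContinuousAlternatingMap.alternatizeUncurryFin_apply, Fin.sum_univ_three]
  have h0 : (0 : Fin 3).removeNth ![u, v, w] = ![v, w] := rfl
  have h1 : (1 : Fin 3).removeNth ![u, v, w] = ![u, w] := by
    funext i
    fin_cases i <;> rfl
  have h2 : (2 : Fin 3).removeNth ![u, v, w] = ![u, v] := by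
    funext i
    fin_cases i <;> rfl
  rw [h0, h1, h2]
  simp [sub_eq_add_neg]

theorem alternatize_apply_four (L : Coord N →L[ℝ] Coord N [⋀^Fin 3]→L[ℝ] V) (u v w z : Coord N) :
    ContinuousAlternatingMap.alternatizeUncurryFin L ![u, v, w, z] =
      L u ![v, w, z] - L v ![u, w, z] + L w ![u, v, z] - L z ![u, v, w] := by
  rw [ContinuousAlternatingMap.alternatizeUncurryFin_apply, Fin.sum_univ_four]
  have h0 : (0 : Fin 4).removeNth ![u, v, w, z] = ![v, w, z] := rfl
  have h1 : (1 : Fin 4).removeNth ![u, v, w, z] = ![u, w, z] := by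
    funext i
    fin_cases i <;> rfl
  have h2 : (2 : Fin 4).removeNth ![u, v, w, z] = ![u, v, z] := by
    funext i
    fin_cases i <;> rfl
  have h3 : (3 : Fin 4).removeNth ![u, v, w, z] = ![u, v, w] := by
    funext i
    fin_cases i <;> rfl
  rw [h0, h1, h2, h3]
  simp [sub_eq_add_neg, pow_succ]

theorem form_swap_two (α : Coord N [⋀^Fin 2]→L[ℝ] V) (u v : Coord N) :
    α ![v, u] = -α ![u, v] := by
  have h := α.toAlternatingMap.map_swap ![u, v] (i := 0) (j := 1) (by decide)
  have h1 : ![u, v] ∘ Equiv.swap (0 : Fin 2) 1 = ![v, u] := by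
    funext i
    fin_cases i <;> rfl
  rw [h1] at h
  exact h

theorem form_rotate_three (α : Coord N [⋀^Fin 3]→L[ℝ] V) (u v w : Coord N) :
    α ![u, v, w] = α ![v, w, u] := by
  have h := α.toAlternatingMap.map_swap ![u, v, w] (i := 0) (j := 1) (by decide)
  have h1 : ![u, v, w] ∘ Equiv.swap (0 : Fin 3) 1 = ![v, u, w] := by
    funext i
    fin_cases i <;> rfl
  have h' := α.toAlternatingMap.map_swap ![v, u, w] (i := 1) (j := 2) (by decide)
  have h2 : ![v, u, w] ∘ Equiv.swap (1 : Fin 3) 2 = ![v, w, u] := by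
    funext i
    fin_cases i <;> rfl
  rw [h1] at h
  rw [h2, h, neg_neg] at h'
  exact h'.symm

theorem comp_vecEmpty (T : Coord N →L[ℝ] Coord N) : T ∘ (![] : Fin 0 → Coord N) = ![] :=
  Subsingleton.elim _ _

theorem comp_vecSingle (T : Coord N →L[ℝ] Coord N) (u : Coord N) : T ∘ ![u] = ![T u] := by
  funext i
  rw [Subsingleton.elim i 0]
  rfl

end LowDegree

/-! ### Kähler identities for `δ_T` and the vanishing of `δ_T δ_T` -/

section Contraction

variable {N p k : ℕ} {M : Type*} [TopologicalSpace M] [ChartedSpace (Coord N) M]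
  [IsManifold (𝓡 N) ∞ M] [T2Space M] {F : Foliation N p M} {g : Metric N M}
  {J : M → Coord N →L[ℝ] Coord N}

theorem sum_curryLeft_J (F : Foliation N p M) (g : Metric N M) (J : M → Coord N →L[ℝ] Coord N)
    (x : M) (α : Coord N [⋀^Fin (k + 2)]→L[ℝ] ℂ) (w : Fin k → Coord N) :
    (∑ i, (α.curryLeft (cometric F g x (stdCovec i))).curryLeft (J x (stdVec i))) w =
      ∑ a, α (Matrix.vecCons (onb g x (normal F g x) a : Coord N)
        (Matrix.vecCons (J x (onb g x (normal F g x) a)) w)) := by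
  have h := DFunLike.congr_fun
    (traceWith_cometric F g x ((curryCurry α).compl₂ (J x).toLinearMap)) w
  rw [ContinuousAlternatingMap.sum_apply] at h
  exact h

theorem kahlerContract_apply (η : Form N M ℂ (k + 2)) (x : M) (w : Fin k → Coord N) :
    kahlerContract F g J η x w =
      ∑ a, η x (Matrix.vecCons (onb g x (normal F g x) a : Coord N)
        (Matrix.vecCons (J x (onb g x (normal F g x) a)) w)) :=
  sum_curryLeft_J F g J x (η x) w

theorem covDeriv_kahlerContract_apply (hJ : IsTransverseKahler F g J) {η : Form N M ℂ (k + 2)}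
    (hη : IsBasic F η) (x : M) (u : Coord N) (w : Fin k → Coord N) :
    covDeriv F g (kahlerContract F g J η) x u w =
      ∑ a, covDeriv F g η x u (Matrix.vecCons (onb g x (normal F g x) a : Coord N)
        (Matrix.vecCons (J x (onb g x (normal F g x) a)) w)) := by
  rw [covDeriv_kahlerContract hJ hη.smooth hη.vanishesOn]
  exact sum_curryLeft_J F g J x _ w

theorem deltaT_apply (F : Foliation N p M) (g : Metric N M) (φ : Form N M ℂ (k + 1)) (x : M)
    (w : Fin k → Coord N) : deltaT F g φ x w = -∑ a, covDeriv F g φ x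
      (onb g x (normal F g x) a) (Matrix.vecCons (onb g x (normal F g x) a : Coord N) w) := by
  rw [deltaT, ContinuousAlternatingMap.neg_apply, ContinuousAlternatingMap.sum_apply]
  rfl

theorem sum_covDeriv_J (hJ : IsTransverseKahler F g J) (φ : Form N M ℂ (k + 1)) (x : M)
    (w : Fin k → Coord N) :
    ∑ a, covDeriv F g φ x (J x (onb g x (normal F g x) a))
      (Matrix.vecCons (J x (onb g x (normal F g x) a)) w) = -deltaT F g φ x w := by
  have h := hJ.traceWith_J x (curryOf (covDerivL F g φ x))
  have h1 := traceWith_cometric F g x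
    ((curryOf (covDerivL F g φ x)).compl₁₂ (J x).toLinearMap (J x).toLinearMap)
  have h2 := DFunLike.congr_fun (h1.symm.trans h) w
  rw [ContinuousAlternatingMap.sum_apply] at h2
  simp only [LinearMap.compl₁₂_apply, curryOf_apply, covDerivL_apply] at h2
  refine Eq.trans h2 ?_
  rw [deltaT_eq_traceWith, ContinuousAlternatingMap.neg_apply, neg_neg]

theorem IsTransverseKahler.J_J_onb (hJ : IsTransverseKahler F g J) (x : M)
    (a : Fin (Module.finrank ℝ (normal F g x))) :
    J x (J x (onb g x (normal F g x) a)) = -(onb g x (normal F g x) a : Coord N) := by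
  rw [hJ.sq, proj_of_mem_normal F g x (onb g x (normal F g x) a).2]

theorem compContinuousLinearMap_vecCons {V : Type*} [NormedAddCommGroup V] [NormedSpace ℝ V]
    (α : Coord N [⋀^Fin (k + 1)]→L[ℝ] V) (T : Coord N →L[ℝ] Coord N) (u : Coord N)
    (w : Fin k → Coord N) : α.compContinuousLinearMap T (Matrix.vecCons u w) =
      α (Matrix.vecCons (T u) (T ∘ w)) := by
  rw [ContinuousAlternatingMap.compContinuousLinearMap_apply]
  congr 1
  funext i
  refine Fin.cases rfl (fun i => rfl) i

theorem map_vecCons_neg {V : Type*} [NormedAddCommGroup V] [NormedSpace ℝ V]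
    (α : Coord N [⋀^Fin (k + 1)]→L[ℝ] V) (u : Coord N) (w : Fin k → Coord N) :
    α (Matrix.vecCons (-u) w) = -α (Matrix.vecCons u w) :=
  DFunLike.congr_fun (map_neg α.curryLeft u) w

/-- On basic one-forms `δ_T ψ = ½ Λ d (J ψ)`. -/
theorem deltaT_one_form (hJ : IsTransverseKahler F g J) {ψ : Form N M ℂ 1} (hψ : IsBasic F ψ) :
    deltaT F g ψ = (1 / 2 : ℝ) • kahlerContract F g J (extD (pullbackJ J ψ)) := by
  funext x
  ext w
  have hw : w = ![] := Subsingleton.elim _ _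
  subst hw
  rw [Pi.smul_apply, ContinuousAlternatingMap.smul_apply, kahlerContract_apply,
    extD_eq_alternatize F g]
  -- By `J² = -1` on `Q`, both terms of `d (Jψ) (E_a, J E_a)` become divergence terms. Each sums to
  -- `δ_T ψ`, the second by `J`-invariance of the trace; hence the factor `½`.
  have h1 : ∀ a, ContinuousAlternatingMap.alternatizeUncurryFin (covDerivL F g (pullbackJ J ψ) x)
      ![(onb g x (normal F g x) a : Coord N), J x (onb g x (normal F g x) a)] =
      -covDeriv F g ψ x (onb g x (normal F g x) a) ![(onb g x (normal F g x) a : Coord N)] -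
        covDeriv F g ψ x (J x (onb g x (normal F g x) a)) ![J x (onb g x (normal F g x) a)] :=
    fun a => by
      rw [alternatize_apply_two, covDerivL_apply, covDerivL_apply,
        covDeriv_pullbackJ hJ hψ.smooth hψ.vanishesOn,
        covDeriv_pullbackJ hJ hψ.smooth hψ.vanishesOn, compContinuousLinearMap_vecCons,
        compContinuousLinearMap_vecCons, hJ.J_J_onb, map_vecCons_neg, comp_vecEmpty]
  rw [Finset.sum_congr rfl fun a _ => h1 a, Finset.sum_sub_distrib, sum_covDeriv_J hJ,
    Finset.sum_neg_distrib, ← deltaT_apply, Complex.real_smul]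
  push_cast
  ring

/-- On basic two-forms `J (δ_T α) = ½ (Λ d (J α) - d (Λ α))`. -/
theorem pullbackJ_deltaT (hJ : IsTransverseKahler F g J) {α : Form N M ℂ 2} (hα : IsBasic F α) :
    pullbackJ J (deltaT F g α) = (1 / 2 : ℝ) •
      (kahlerContract F g J (extD (pullbackJ J α)) - extD (kahlerContract F g J α)) := by
  funext x
  ext w
  obtain ⟨v, rfl⟩ : ∃ v, w = ![v] := ⟨w 0, by funext i; rw [Subsingleton.elim i 0]; rfl⟩
  rw [Pi.smul_apply, ContinuousAlternatingMap.smul_apply, Pi.sub_apply,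
    ContinuousAlternatingMap.sub_apply, kahlerContract_apply,
    extD_eq_alternatize F g, extD_eq_alternatize F g, alternatize_apply_one, covDerivL_apply,
    covDeriv_kahlerContract_apply hJ hα, pullbackJ, compContinuousLinearMap_vecCons,
    comp_vecEmpty]
  have h1 : ∀ a, ContinuousAlternatingMap.alternatizeUncurryFin (covDerivL F g (pullbackJ J α) x)
      ![(onb g x (normal F g x) a : Coord N), J x (onb g x (normal F g x) a), v] =
      -covDeriv F g α x (onb g x (normal F g x) a)
          ![(onb g x (normal F g x) a : Coord N), J x v] -
        covDeriv F g α x (J x (onb g x (normal F g x) a))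
          ![J x (onb g x (normal F g x) a), J x v] +
        covDeriv F g α x v ![(onb g x (normal F g x) a : Coord N),
          J x (onb g x (normal F g x) a)] :=
    fun a => by
      rw [alternatize_apply_three, covDerivL_apply, covDerivL_apply, covDerivL_apply,
        covDeriv_pullbackJ hJ hα.smooth hα.vanishesOn,
        covDeriv_pullbackJ hJ hα.smooth hα.vanishesOn,
        covDeriv_pullbackJ hJ hα.smooth hα.vanishesOn, compContinuousLinearMap_vecCons,
        compContinuousLinearMap_vecCons, compContinuousLinearMap_vecCons, comp_vecSingle,
        comp_vecSingle, hJ.J_J_onb, map_vecCons_neg, form_swap_two (covDeriv F g α x v),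
        map_vecCons_neg, neg_neg]
  rw [Finset.sum_congr rfl fun a _ => h1 a, Finset.sum_add_distrib, Finset.sum_sub_distrib,
    sum_covDeriv_J hJ, Finset.sum_neg_distrib, ← deltaT_apply, Complex.real_smul]
  push_cast
  ring

/-- `Λ d Λ γ = 0` for a closed basic three-form. -/
theorem kahlerContract_extD_kahlerContract (hJ : IsTransverseKahler F g J) {γ : Form N M ℂ 3}
    (hγ : IsBasic F γ) (hd : extD γ = 0) :
    kahlerContract F g J (extD (kahlerContract F g J γ)) = 0 := by
  funext x
  ext w
  have hw : w = ![] := Subsingleton.elim _ _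
  subst hw
  let E : Fin (Module.finrank ℝ (normal F g x)) → Coord N := fun a => (onb g x (normal F g x) a).1
  have h1 : kahlerContract F g J (extD (kahlerContract F g J γ)) x ![] =
      ∑ a, ∑ b, (covDeriv F g γ x (E a) ![E b, J x (E b), J x (E a)] -
        covDeriv F g γ x (J x (E a)) ![E b, J x (E b), E a]) := by
    rw [kahlerContract_apply, extD_eq_alternatize F g]
    refine Finset.sum_congr rfl fun a _ => ?_
    rw [alternatize_apply_two, covDerivL_apply, covDerivL_apply,
      covDeriv_kahlerContract_apply hJ hγ, covDeriv_kahlerContract_apply hJ hγ,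
      ← Finset.sum_sub_distrib]
  -- `dγ = 0` evaluated on `E_a, J E_a, E_b, J E_b`. The terms differentiated in the directions `a`
  -- sum to `Λ d Λ γ`, and so do those in the directions `b` after exchanging indices, giving `2 Λ d
  -- Λ γ = 0`.
  have h2 : ∀ a b, covDeriv F g γ x (E a) ![J x (E a), E b, J x (E b)] -
      covDeriv F g γ x (J x (E a)) ![E a, E b, J x (E b)] +
      covDeriv F g γ x (E b) ![E a, J x (E a), J x (E b)] -
      covDeriv F g γ x (J x (E b)) ![E a, J x (E a), E b] = 0 := fun a b => by
    have h := alternatize_apply_four (covDerivL F g γ x) (E a) (J x (E a)) (E b) (J x (E b))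
    rw [← extD_eq_alternatize, hd] at h
    simp only [covDerivL_apply] at h
    exact h.symm
  have h3 : ∑ a, ∑ b, (covDeriv F g γ x (E b) ![E a, J x (E a), J x (E b)] -
      covDeriv F g γ x (J x (E b)) ![E a, J x (E a), E b]) =
      kahlerContract F g J (extD (kahlerContract F g J γ)) x ![] := by
    rw [h1, Finset.sum_comm]
  have h4 : kahlerContract F g J (extD (kahlerContract F g J γ)) x ![] +
      kahlerContract F g J (extD (kahlerContract F g J γ)) x ![] = 0 := by
    conv_lhs => rw [← h3]
    conv_lhs => enter [2]; rw [h3, h1]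
    rw [← Finset.sum_add_distrib]
    refine Finset.sum_eq_zero fun a _ => ?_
    rw [← Finset.sum_add_distrib]
    refine Finset.sum_eq_zero fun b _ => ?_
    rw [← form_rotate_three _ (J x (E a)), ← form_rotate_three _ (E a) (E b)]
    linear_combination h2 a b
  exact add_self_eq_zero.1 h4

/-- `δ_T δ_T = 0` on closed basic two-forms. -/
theorem deltaT_deltaT (hJ : IsTransverseKahler F g J) {α : Form N M ℂ 2} (hα : IsBasic F α)
    (hα' : IsBasic F (deltaT F g α)) : deltaT F g (deltaT F g α) = 0 := by
  have h1 := hα.pullbackJ hJ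
  have h2 := h1.extD
  have h3 := h2.kahlerContract hJ
  have h4 := hα.kahlerContract hJ
  -- The term `d (Λ α)` disappears under `d`, leaving a multiple of `Λ d Λ γ` for the exact form `γ
  -- = d (J α)`.
  rw [deltaT_one_form hJ hα', pullbackJ_deltaT hJ hα, extD_real_smul,
    extD_sub h3.smooth h4.smooth.extD, extD_extD h4.smooth, sub_zero]
  have h5 := kahlerContract_extD_kahlerContract hJ h2 (extD_extD h1.smooth)
  funext x
  ext w
  have h6 := DFunLike.congr_fun (congrFun h5 x) w
  rw [kahlerContract_apply] at h6
  rw [Pi.smul_apply, ContinuousAlternatingMap.smul_apply, kahlerContract_apply]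
  have h7 : ∀ w, ((1 / 2 : ℝ) • extD (kahlerContract F g J (extD (pullbackJ J α)))) x w =
      (1 / 2 : ℝ) • extD (kahlerContract F g J (extD (pullbackJ J α))) x w := fun w => rfl
  simp only [h7]
  rw [← Finset.smul_sum, h6]
  simp

theorem pullbackJ_pullbackJ_one_form (hJ : IsTransverseKahler F g J) {ψ : Form N M ℂ 1}
    (hψ : ∀ x, VanishesOn (F.tangent x) (ψ x)) :
    (-1 : ℝ) • pullbackJ J (pullbackJ J ψ) = ψ := by
  funext x
  ext w
  obtain ⟨v, rfl⟩ : ∃ v, w = ![v] := ⟨w 0, by funext i; rw [Subsingleton.elim i 0]; rfl⟩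
  have h1 := DFunLike.congr_fun (map_sub (ψ x).curryLeft v (proj F g x v)) ![]
  rw [(hψ x).curryLeft_eq_zero (sub_proj_mem_tangent F g x v)] at h1
  rw [Pi.smul_apply, ContinuousAlternatingMap.smul_apply, pullbackJ, pullbackJ,
    compContinuousLinearMap_vecCons, compContinuousLinearMap_vecCons, hJ.sq, map_vecCons_neg,
    comp_vecEmpty, comp_vecEmpty]
  rw [neg_one_smul, neg_neg]
  exact (sub_eq_zero.1 h1.symm).symm

/-- `δ_T α = -J J δ_T α`, and `J δ_T α` is a combination of `Λ d J α` and `d Λ α`, built from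
operators that preserve basic forms. This also gives smoothness, which the frame-wise definition
does not show. -/
theorem IsBasic.deltaT (hJ : IsTransverseKahler F g J) {α : Form N M ℂ 2} (hα : IsBasic F α) :
    IsBasic F (deltaT F g α) := by
  have h : ∀ x, VanishesOn (F.tangent x) (TransverseKahler.deltaT F g α x) := by
    rintro x w ⟨i, hi⟩
    rw [deltaT_apply, Finset.sum_eq_zero, neg_zero]
    exact fun a _ => hα.covDeriv_vanishesOn hJ.bundleLike x _ _ ⟨i.succ, hi⟩
  rw [← pullbackJ_pullbackJ_one_form hJ h, pullbackJ_deltaT hJ hα]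
  have h1 := ((hα.pullbackJ hJ).extD).kahlerContract hJ
  have h2 := (hα.kahlerContract hJ).extD
  have h3 := (h1.add (h2.real_smul (-1))).real_smul (1 / 2)
  rw [neg_one_smul, ← sub_eq_add_neg] at h3
  exact (h3.pullbackJ hJ).real_smul (-1)

end Contraction

/-! ### Positivity of the pairing and the adjointness of `d_κ` and `δ_κ` -/

section Pairing

variable {N p k : ℕ} {M : Type*} [TopologicalSpace M] [ChartedSpace (Coord N) M]
  [IsManifold (𝓡 N) ∞ M] [T2Space M] {F : Foliation N p M} {g : Metric N M} {x : M}
  {κB : Form N M ℝ 1}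

/-- The pairing sums over all tuples of frame vectors, so in degree `k` it is `k!` times the usual
one; this is the origin of the factor `k + 1` here and in the adjointness formulas. The proof is by
induction, from `v ⌟ Alt L = L_v - Alt (v ⌟ L)`. -/
theorem pairing_alternatize (A : (Coord N →L[ℝ] ℝ) →L[ℝ] Coord N) :
    ∀ {k : ℕ} (L : Coord N →L[ℝ] Coord N [⋀^Fin k]→L[ℝ] ℂ) (β : Coord N [⋀^Fin (k + 1)]→L[ℝ] ℂ),
    pairing A (k + 1) (ContinuousAlternatingMap.alternatizeUncurryFin L) β =
      (k + 1) * ∑ i, pairing A k (L (A (stdCovec i))) (β.curryLeft (stdVec i))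
  | 0, L, β => by
    rw [pairing_succ]
    simp only [alternatize_curryLeft_zero]
    simp
  | k + 1, L, β => by
    have h1 : ∀ i, pairing A (k + 1) ((ContinuousAlternatingMap.alternatizeUncurryFin L).curryLeft
        (A (stdCovec i))) (β.curryLeft (stdVec i)) =
        pairing A (k + 1) (L (A (stdCovec i))) (β.curryLeft (stdVec i)) +
          (k + 1) * ∑ j, pairing A k ((L (A (stdCovec j))).curryLeft (A (stdCovec i)))
            ((β.curryLeft (stdVec j)).curryLeft (stdVec i)) := fun i => by
      have h2 : ∀ j, (β.curryLeft (stdVec i)).curryLeft (stdVec j) =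
          -(β.curryLeft (stdVec j)).curryLeft (stdVec i) := fun j =>
        curryCurry_swap β (stdVec i) (stdVec j)
      rw [alternatize_curryLeft, map_sub, LinearMap.sub_apply, pairing_alternatize A, sub_eq_add_neg,
        ← mul_neg, ← Finset.sum_neg_distrib]
      congr 2
      refine Finset.sum_congr rfl fun j _ => ?_
      rw [h2, map_neg, neg_neg]
      rfl
    rw [pairing_succ, Finset.sum_congr rfl fun i _ => h1 i, Finset.sum_add_distrib,
      ← Finset.mul_sum, Finset.sum_comm]
    simp only [← pairing_succ]
    push_cast
    ring

theorem pairing_eq_sum_onb (α β : Coord N [⋀^Fin (k + 1)]→L[ℝ] ℂ) :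
    pairing (cometric F g x) (k + 1) α β = ∑ a, pairing (cometric F g x) k
      (α.curryLeft (onb g x (normal F g x) a)) (β.curryLeft (onb g x (normal F g x) a)) := by
  rw [pairing_succ_eq_traceWith, traceWith_cometric]
  rfl

theorem pairing_conj_symm : ∀ {k : ℕ} (α β : Coord N [⋀^Fin k]→L[ℝ] ℂ),
    pairing (cometric F g x) k β α = (starRingEnd ℂ) (pairing (cometric F g x) k α β)
  | 0, α, β => by
    rw [pairing_zero, pairing_zero, map_mul, Complex.conj_conj, mul_comm]
  | k + 1, α, β => by
    rw [pairing_eq_sum_onb, pairing_eq_sum_onb, map_sum]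
    exact Finset.sum_congr rfl fun a _ => pairing_conj_symm _ _

theorem re_pairing_comm (α β : Coord N [⋀^Fin k]→L[ℝ] ℂ) :
    (pairing (cometric F g x) k β α).re = (pairing (cometric F g x) k α β).re := by
  rw [pairing_conj_symm, Complex.conj_re]

theorem re_pairing_self_nonneg : ∀ {k : ℕ} (α : Coord N [⋀^Fin k]→L[ℝ] ℂ),
    0 ≤ (pairing (cometric F g x) k α α).re
  | 0, α => by
    rw [pairing_zero, ← Complex.normSq_eq_conj_mul_self, Complex.ofReal_re]
    exact Complex.normSq_nonneg _
  | k + 1, α => by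
    rw [pairing_eq_sum_onb, Complex.re_sum]
    exact Finset.sum_nonneg fun a _ => re_pairing_self_nonneg _

theorem VanishesOn.eq_zero_of_curryLeft_onb {α : Coord N [⋀^Fin (k + 1)]→L[ℝ] ℂ}
    (hα : VanishesOn (F.tangent x) α)
    (h : ∀ a, α.curryLeft (onb g x (normal F g x) a) = 0) : α = 0 := by
  refine form_ext_curryLeft fun v => ?_
  have h1 : α.curryLeft v = α.curryLeft (proj F g x v) := by
    have h2 := hα.curryLeft_eq_zero (sub_proj_mem_tangent F g x v)
    rwa [map_sub, sub_eq_zero] at h2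
  rw [h1, ← sum_bilin_onb g x (normal F g x) (proj_mem_normal F g x v), map_sum]
  refine Finset.sum_eq_zero fun a _ => ?_
  rw [map_smul, h, smul_zero]

/-- The pairing is only semidefinite, since the cometric sees just the normal directions;
horizontality removes the degeneracy. -/
theorem eq_zero_of_re_pairing_self : ∀ {k : ℕ} {α : Coord N [⋀^Fin k]→L[ℝ] ℂ},
    VanishesOn (F.tangent x) α → (pairing (cometric F g x) k α α).re = 0 → α = 0
  | 0, α, _, h => by
    rw [pairing_zero, ← Complex.normSq_eq_conj_mul_self, Complex.ofReal_re,
      Complex.normSq_eq_zero] at h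
    ext w
    rw [Subsingleton.elim w ![], h]
    rfl
  | k + 1, α, hα, h => by
    rw [pairing_eq_sum_onb, Complex.re_sum,
      Finset.sum_eq_zero_iff_of_nonneg fun a _ => re_pairing_self_nonneg _] at h
    exact hα.eq_zero_of_curryLeft_onb (g := g) fun a =>
      eq_zero_of_re_pairing_self (hα.curryLeft _) (h a (Finset.mem_univ a))

theorem pairing_ofReal (ξ : Coord N [⋀^Fin 1]→L[ℝ] ℝ) (β : Coord N [⋀^Fin 1]→L[ℝ] ℂ) :
    pairing (cometric F g x) 1 (ContinuousLinearMap.compContinuousAlternatingMapCLM ℝ (Coord N) ℝ ℂ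
      (Fin 1) Complex.ofRealCLM ξ) β =
      β.curryLeft (cometric F g x
        ((ContinuousAlternatingMap.ofSubsingleton ℝ (Coord N) ℝ (0 : Fin 1)).symm ξ)) ![] := by
  rw [pairing_eq_sum_onb, cometric_eq_sum_onb, map_sum, ContinuousAlternatingMap.sum_apply]
  refine Finset.sum_congr rfl fun a _ => ?_
  rw [pairing_zero, map_smul, ContinuousAlternatingMap.smul_apply, Complex.real_smul]
  have h1 : ∀ v, ((ContinuousLinearMap.compContinuousAlternatingMapCLM ℝ (Coord N) ℝ ℂ
      (Fin 1) Complex.ofRealCLM ξ).curryLeft v) ![] = (((ContinuousAlternatingMap.ofSubsingleton ℝ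
        (Coord N) ℝ (0 : Fin 1)).symm ξ v : ℝ) : ℂ) := fun v => by
    change ((ξ ![v] : ℝ) : ℂ) = ((ξ (fun _ => v) : ℝ) : ℂ)
    congr 2
    funext i
    rw [Subsingleton.elim i 0]
    rfl
  rw [h1, Complex.conj_ofReal]

theorem continuous_pairing {α β : Form N M ℂ k} (hα : IsSmoothForm α) (hβ : IsSmoothForm β) :
    Continuous fun x => pairing (cometric F g x) k (α x) (β x) :=
  continuous_of_continuousOn_symm (N := N) fun z =>
    (contDiffOn_pairing (contDiffOn_coordCometric F g z) (hα z) (hβ z)).continuousOn.congr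
      fun _ hy => coordForm_pairing hy

theorem IsSmoothForm.continuous_apply {α : Form N M ℂ 0} (hα : IsSmoothForm α) :
    Continuous fun x => α x ![] :=
  continuous_of_continuousOn_symm (N := N) fun z => by
    have h1 := ((ContinuousAlternatingMap.apply ℝ (Coord N) ℂ
      ![]).contDiff.comp_contDiffOn (hα z)).continuousOn
    refine h1.congr fun y _ => ?_
    change _ = coordForm z α y ![]
    rw [coordForm_apply]
    exact congrArg (α _) (Subsingleton.elim _ _)

/-- Pointwise integration by parts: the divergence of `⟨α, · ⌟ β⟩` splits by Leibniz into a trace of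
`∇β`, which is `δ_T β`, and a trace of `∇α`, which is `dα` up to the factor of
`pairing_alternatize`. -/
theorem deltaT_pairingForm (hg : IsBundleLike F g) {α : Form N M ℂ k} {β : Form N M ℂ (k + 1)}
    (hα : IsBasic F α) (hβ : IsBasic F β) (x : M) :
    (k + 1) * deltaT F g (pairingForm F g α β) x ![] =
      (k + 1) * pairing (cometric F g x) k (α x) (deltaT F g β x) -
        pairing (cometric F g x) (k + 1) (extD α x) (β x) := by
  rw [extD_eq_alternatize F g, pairing_alternatize, deltaT_eq_traceWith, deltaT_eq_traceWith,
    ContinuousAlternatingMap.neg_apply, map_neg, traceWith, traceWith,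
    ContinuousAlternatingMap.sum_apply, map_sum, mul_neg, mul_neg, ← neg_add', ← mul_add,
    ← Finset.sum_add_distrib]
  congr 2
  refine Finset.sum_congr rfl fun i _ => ?_
  refine Eq.trans ?_ (add_comm _ _)
  simp only [curryOf_apply, covDerivL_apply]
  exact covDeriv_pairingForm hg hα.smooth hα.vanishesOn hβ.smooth hβ.vanishesOn x _
    (Matrix.vecCons (stdVec i) ![])

/-- The term `κB♯ ⌟` in `δ_B` is shared equally between the two factors, which turns `d` into `d_κ`
and `δ_T` into `δ_κ`. Thus `d_κ` and `δ_κ` are adjoint as soon as `δ_B` of a basic one-form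
integrates to zero. -/
theorem deltaB_pairingForm (hg : IsBundleLike F g) {α : Form N M ℂ k} {β : Form N M ℂ (k + 1)}
    (hκ : IsBasic F κB) (hα : IsBasic F α) (hβ : IsBasic F β) (x : M) :
    (k + 1) * deltaB F g κB (pairingForm F g α β) x ![] =
      (k + 1) * pairing (cometric F g x) k (α x) (deltaKappa F g κB β x) -
        pairing (cometric F g x) (k + 1) (dKappa κB α x) (β x) := by
  have h1 := deltaT_pairingForm hg hα hβ x
  have h2 : pairing (cometric F g x) (k + 1) (dKappa κB α x) (β x) =
      pairing (cometric F g x) (k + 1) (extD α x) (β x) - (k + 1) * (1 / 2 : ℝ) *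
        pairing (cometric F g x) k (α x) ((β x).curryLeft (cometric F g x (covector κB x))) := by
    rw [dKappa, wedge_ofReal, map_sub, LinearMap.sub_apply, map_smul, LinearMap.smul_apply,
      pairing_alternatize, Complex.real_smul]
    have h5 : ∑ i, pairing (cometric F g x) k
        ((covector κB x).smulRight (α x) (cometric F g x (stdCovec i)))
        ((β x).curryLeft (stdVec i)) =
        pairing (cometric F g x) k (α x) ((β x).curryLeft (cometric F g x (covector κB x))) := by
      conv_rhs => rw [← sum_stdCovec_smul (cometric F g x (covector κB x)), map_sum, map_sum]
      refine Finset.sum_congr rfl fun i _ => ?_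
      rw [ContinuousLinearMap.smulRight_apply, map_smul, map_smul, map_smul, LinearMap.smul_apply,
        apply_cometric_comm]
    rw [h5]
    ring
  have h3 : deltaKappa F g κB β x = deltaT F g β x + (1 / 2 : ℝ) •
      (β x).curryLeft (cometric F g x (covector κB x)) := by
    rw [deltaKappa, deltaB, interior, hκ.sharp_covector]
    module
  have h4 : deltaB F g κB (pairingForm F g α β) x ![] = deltaT F g (pairingForm F g α β) x ![] +
      pairing (cometric F g x) k (α x) ((β x).curryLeft (cometric F g x (covector κB x))) := by
    rw [deltaB, interior, hκ.sharp_covector]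
    rfl
  rw [h4, h2, h3, map_add, map_smul, Complex.real_smul]
  push_cast
  linear_combination h1

end Pairing

/-! ### Integration over a compact manifold, and harmonic forms are holomorphic -/

section Integration

variable {N p k : ℕ} {M : Type*} [TopologicalSpace M] [ChartedSpace (Coord N) M]
  [IsManifold (𝓡 N) ∞ M] [T2Space M] {F : Foliation N p M} {g : Metric N M}
  {J : M → Coord N →L[ℝ] Coord N} {κB : Form N M ℝ 1} {ψ : Form N M ℂ 1} {φ : Form N M ℂ k}

theorem vec_one_eq {E : Type*} (w : Fin 1 → E) : w = ![w 0] := by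
  funext i
  rw [Subsingleton.elim i 0]
  rfl

theorem re_covDeriv_one_form (hψ : IsSmoothForm ψ) (x : M) (u v : Coord N) :
    (covDeriv F g ψ x u ![v]).re = covectorCovDeriv F g (mapForm Complex.reCLM ψ) x u v := by
  have h : HasFDerivAt (coordForm x (mapForm Complex.reCLM ψ))
      ((ContinuousLinearMap.compContinuousAlternatingMapCLM ℝ (Coord N) ℂ ℝ (Fin 1)
        Complex.reCLM) ∘L fderiv ℝ (coordForm x ψ) (extChartAt (𝓡 N) x x))
      (extChartAt (𝓡 N) x x) :=
    (ContinuousLinearMap.compContinuousAlternatingMapCLM ℝ (Coord N) ℂ ℝ (Fin 1)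
      Complex.reCLM).hasFDerivAt.comp (extChartAt (𝓡 N) x x)
        (hψ.differentiableAt (base_mem_target (N := N) x)).hasFDerivAt
  have h1 : covectorDeriv (mapForm Complex.reCLM ψ) x u v =
      (fderiv ℝ (coordForm x ψ) (extChartAt (𝓡 N) x x) u ![v]).re := by
    change fderiv ℝ (coordForm x (mapForm Complex.reCLM ψ)) (extChartAt (𝓡 N) x x) u
      (fun _ => v) = _
    rw [h.fderiv, vec_one_eq fun _ => v]
    rfl
  have h2 : covector (mapForm Complex.reCLM ψ) x (transConn F g x u v) =
      (ψ x ![transConn F g x u v]).re := by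
    rw [covector_apply, mapForm_apply, vec_one_eq fun _ => transConn F g x u v]
    rfl
  rw [covectorCovDeriv_apply, h1, h2, covDeriv, ContinuousAlternatingMap.sub_apply, Complex.sub_re,
    derivationAct_apply, Fin.sum_univ_one, vec_one_eq (Function.update _ _ _)]
  rfl

theorem re_deltaT_one_form (hψ : IsSmoothForm ψ) (x : M) :
    (deltaT F g ψ x ![]).re = -traceWith (cometric F g x)
      (bilinMap (covectorCovDeriv F g (mapForm Complex.reCLM ψ) x)) := by
  rw [deltaT_apply, Complex.neg_re, Complex.re_sum, traceWith_cometric]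
  simp only [bilinMap_apply, re_covDeriv_one_form hψ]

/-- `δ_T ψ` misses `-div ψ♯` by `κ(ψ♯)`, while `δ_B` corrects only by `κB`. The discrepancy `κ - κB`
is what the definition of the basic part integrates to zero. -/
theorem re_deltaB_one_form (hg : IsBundleLike F g) (hκ : IsBasic F κB) (hψ : IsBasic F ψ) (x : M) :
    (deltaB F g κB ψ x ![]).re =
      -divergence g (dualField F g (mapForm Complex.reCLM ψ)) x -
        (meanCurvatureForm F g x - covector κB x)
          (sharp g x (covector (mapForm Complex.reCLM ψ) x)) := by
  have hψ' := hψ.mapForm Complex.reCLM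
  have h1 : (ψ x ![sharp g x (covector κB x)]).re =
      covector κB x (sharp g x (covector (mapForm Complex.reCLM ψ) x)) := by
    rw [hψ'.sharp_covector, apply_cometric_comm, covector_apply, mapForm_apply,
      ← hκ.sharp_covector, vec_one_eq fun _ => sharp g x (covector κB x)]
    rfl
  rw [divergence_dualField hg hψ', deltaB, ContinuousAlternatingMap.add_apply, Complex.add_re,
    re_deltaT_one_form hψ.smooth, _root_.sub_apply, ← h1, hψ'.sharp_covector, dualField]
  rw [interior, ContinuousAlternatingMap.curryLeft_apply_apply]
  ring

/-- The pointwise frames in `δ_T` show no continuity; writing `δ_T ψ = ½ Λ d J ψ` makes it the value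
of a smooth form. -/
theorem continuous_deltaB_one_form (hJ : IsTransverseKahler F g J) (hκ : IsBasic F κB)
    (hψ : IsBasic F ψ) : Continuous fun x => deltaB F g κB ψ x ![] := by
  have h1 : Continuous fun x => deltaT F g ψ x ![] := by
    rw [deltaT_one_form hJ hψ]
    exact (((hψ.pullbackJ hJ).extD.kahlerContract hJ).real_smul _).smooth.continuous_apply
  have h2 : Continuous fun x => pairing (cometric F g x) 1
      (TransverseKahler.mapForm Complex.ofRealCLM κB x) (ψ x) :=
    continuous_pairing (hκ.mapForm Complex.ofRealCLM).smooth hψ.smooth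
  refine (h1.add h2).congr fun x => ?_
  rw [deltaB, ContinuousAlternatingMap.add_apply, hκ.sharp_covector]
  exact congrArg (deltaT F g ψ x ![] + ·) (pairing_ofReal (F := F) (g := g) (κB x) (ψ x))

theorem re_deltaB_pairingForm (hg : IsBundleLike F g) {α : Form N M ℂ k} {β : Form N M ℂ (k + 1)}
    (hκ : IsBasic F κB) (hα : IsBasic F α) (hβ : IsBasic F β) (x : M) :
    (k + 1) * (deltaB F g κB (pairingForm F g α β) x ![]).re =
      (k + 1) * (pairing (cometric F g x) k (α x) (deltaKappa F g κB β x)).re -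
        (pairing (cometric F g x) (k + 1) (dKappa κB α x) (β x)).re := by
  have h := congrArg Complex.re (deltaB_pairingForm hg hκ hα hβ x)
  have hk : ((k : ℂ) + 1) = (((k : ℝ) + 1 : ℝ) : ℂ) := by push_cast; ring
  rwa [hk, Complex.re_ofReal_mul, Complex.sub_re, Complex.re_ofReal_mul] at h

variable [MeasurableSpace M] [BorelSpace M] [CompactSpace M]

theorem integrable_re_deltaB (hJ : IsTransverseKahler F g J) (hκ : IsBasic F κB)
    (hψ : IsBasic F ψ) : Integrable (fun x => (deltaB F g κB ψ x ![]).re) (volumeMeasure g) :=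
  (Complex.continuous_re.comp
    (continuous_deltaB_one_form hJ hκ hψ)).integrable_of_hasCompactSupport
      (HasCompactSupport.of_compactSpace _)

/-- The integral of `δ_B ψ` vanishes for basic one-forms `ψ` on a compact manifold. -/
theorem integral_re_deltaB (hJ : IsTransverseKahler F g J) (hκB : IsBasicPart F g κB)
    (hψ : IsBasic F ψ) : ∫ x, (deltaB F g κB ψ x ![]).re ∂(volumeMeasure g) = 0 := by
  have hψ' := hψ.mapForm Complex.reCLM
  have hX : IsSmoothVec (dualField F g (mapForm Complex.reCLM ψ)) := isSmoothVec_dualField hψ'.smooth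
  have hdc := continuous_divergence (g := g) hX
  have hi := integrable_re_deltaB hJ hκB.basic hψ
  have hdi := hdc.integrable_of_hasCompactSupport (μ := volumeMeasure g)
    (HasCompactSupport.of_compactSpace _)
  have h1 := hκB.orthogonal _ hψ' (HasCompactSupport.of_compactSpace _)
  have h2 : ∀ x, (meanCurvatureForm F g x - covector κB x)
      (sharp g x (covector (mapForm Complex.reCLM ψ) x)) =
      -(divergence g (dualField F g (mapForm Complex.reCLM ψ)) x +
        (deltaB F g κB ψ x ![]).re) := fun x => by
    rw [re_deltaB_one_form hJ.bundleLike hκB.basic hψ]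
    ring
  simp only [h2] at h1
  rw [integral_neg, integral_add hdi hi, integral_divergence_eq_zero hX, zero_add,
    neg_eq_zero] at h1
  exact h1

theorem eq_zero_of_integral_re_pairing {α : Form N M ℂ k} (hα : IsBasic F α)
    (h : ∫ x, (pairing (cometric F g x) k (α x) (α x)).re ∂(volumeMeasure g) = 0) : α = 0 := by
  have h1 := eq_zero_of_integral_eq_zero g
    (Complex.continuous_re.comp (continuous_pairing (F := F) (g := g) hα.smooth hα.smooth))
    (fun x => re_pairing_self_nonneg _) h
  funext x
  exact eq_zero_of_re_pairing_self (hα.vanishesOn x) (congrFun h1 x)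

/-- The basic part of the mean curvature form of a transverse Kähler foliation of a compact manifold
is closed. -/
theorem IsBasicPart.extD_eq_zero (hJ : IsTransverseKahler F g J) (hκB : IsBasicPart F g κB) :
    extD κB = 0 := by
  have hκ := hκB.basic
  have hc := hκ.mapForm Complex.ofRealCLM
  set κc := mapForm Complex.ofRealCLM κB with hκc
  have hη := hc.extD
  set η := extD κc with hη'
  have hδ := hη.deltaT hJ
  -- The contraction with `κB♯` contributes `η (κB♯, κB♯) = 0`; the `½` reflects the unnormalized
  -- pairing on two-forms.
  have e1 : ∀ x, deltaB F g κB (pairingForm F g κc η) x ![] =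
      pairing (cometric F g x) 1 (κc x) (deltaT F g η x) -
        1 / 2 * pairing (cometric F g x) 2 (η x) (η x) := fun x => by
    have h1 := deltaT_pairingForm hJ.bundleLike hc hη x
    have h2 : interior (sharp g x (covector κB x)) (pairingForm F g κc η x) ![] = 0 := by
      rw [hκ.sharp_covector]
      refine (pairing_ofReal (F := F) (g := g) (κB x)
        ((η x).curryLeft (cometric F g x (covector κB x)))).trans ?_
      exact (η x).map_eq_zero_of_eq _ (i := 0) (j := 1) rfl (by decide)
    rw [deltaB, ContinuousAlternatingMap.add_apply, h2, add_zero]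
    push_cast at h1
    linear_combination h1 / 2
  -- As `δ_T δ_T η = 0`, only the contraction with `κB♯` remains, and it equals the first term of
  -- `e1`.
  have e2 : ∀ x, deltaB F g κB (deltaT F g η) x ![] =
      pairing (cometric F g x) 1 (κc x) (deltaT F g η x) := fun x => by
    rw [deltaB, ContinuousAlternatingMap.add_apply, deltaT_deltaT hJ hη hδ, hκ.sharp_covector]
    refine Eq.trans ?_ (pairing_ofReal (F := F) (g := g) (κB x) (deltaT F g η x)).symm
    exact zero_add _
  have h1 := integral_re_deltaB hJ hκB (hc.pairingForm hJ.bundleLike hη)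
  have h2 := integral_re_deltaB hJ hκB hδ
  have hi := integrable_re_deltaB hJ hκ (hc.pairingForm hJ.bundleLike hη)
  have hi' := integrable_re_deltaB hJ hκ hδ
  have h3 : η = 0 := by
    refine eq_zero_of_integral_re_pairing (g := g) hη ?_
    have e3 : ∀ x, (pairing (cometric F g x) 2 (η x) (η x)).re = 2 *
        ((deltaB F g κB (deltaT F g η) x ![]).re -
          (deltaB F g κB (pairingForm F g κc η) x ![]).re) := fun x => by
      have h4 : pairing (cometric F g x) 2 (η x) (η x) =
          (2 : ℝ) • (deltaB F g κB (deltaT F g η) x ![] -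
            deltaB F g κB (pairingForm F g κc η) x ![]) := by
        rw [e1, e2, Complex.real_smul]
        push_cast
        ring
      rw [h4, Complex.smul_re, Complex.sub_re, smul_eq_mul]
    simp only [e3]
    rw [integral_const_mul, integral_sub hi' hi, h1, h2]
    ring
  rw [hη', hκc, extD_mapForm _ hκ.smooth] at h3
  funext x
  ext w
  have h4 := DFunLike.congr_fun (congrFun h3 x) w
  exact Complex.ofReal_eq_zero.1 h4

/-- The usual argument: pair `Δ_κ φ = 0` with `φ` and integrate, so that the norms of `d_κ φ` and
`δ_κ φ` both integrate to zero. -/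
theorem dKappa_eq_zero_of_isKappaHarmonic (hJ : IsTransverseKahler F g J)
    (hκB : IsBasicPart F g κB) (hφ : IsBasic F φ) (hc : ∀ x, IsComplexLinear (J x) (φ x))
    (h : IsKappaHarmonic F g κB φ) : dKappa κB φ = 0 := by
  have hκ := hκB.basic
  have hd := hκB.extD_eq_zero hJ
  have hφ' : IsBasic F (dKappa κB φ) := IsBasic.dKappa hJ.bundleLike hκ hd hφ
  have b1 := hφ.pairingForm hJ.bundleLike hφ'
  have h1 := integral_re_deltaB hJ hκB b1
  have i1 := integrable_re_deltaB hJ hκ b1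
  have p1 := re_deltaB_pairingForm hJ.bundleLike hκ hφ hφ'
  cases k with
  | zero =>
    refine eq_zero_of_integral_re_pairing (g := g) hφ' ?_
    have e1 : ∀ x, (pairing (cometric F g x) 1 (dKappa κB φ x) (dKappa κB φ x)).re =
        -(deltaB F g κB (pairingForm F g φ (dKappa κB φ)) x ![]).re := fun x => by
      have h2 : deltaKappa F g κB (dKappa κB φ) x = 0 := congrFun h x
      have h3 := p1 x
      rw [h2, map_zero, Complex.zero_re] at h3
      push_cast at h3
      linarith
    rw [integral_congr_ae (Filter.Eventually.of_forall e1), integral_neg, h1, neg_zero]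
  | succ k =>
    -- The Kähler identity exhibits `δ_κ φ` as a multiple of `Λ d_κ φ`, so it is basic and
    -- integration by parts applies to it.
    have hδ : IsBasic F (deltaKappa F g κB φ) := by
      rw [deltaKappa_eq_kahlerContract hJ hκ hφ hc]
      exact (hφ'.kahlerContract hJ).complex_smul _
    have b2 := hδ.pairingForm hJ.bundleLike hφ
    have h2 := integral_re_deltaB hJ hκB b2
    have i2 := integrable_re_deltaB hJ hκ b2
    have p2 := re_deltaB_pairingForm hJ.bundleLike hκ hδ hφ
    -- With `φ` of degree `k + 1`, the weights `k + 2` and `k + 1` are the normalization factors of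
    -- the two adjointness formulas; they make the cross terms `⟨φ, δ_κ d_κ φ⟩` and `⟨d_κ δ_κ φ, φ⟩`
    -- cancel.
    let f : M → ℝ := fun x =>
      (pairing (cometric F g x) (k + 2) (dKappa κB φ x) (dKappa κB φ x)).re + (k + 2) * (k + 1) *
        (pairing (cometric F g x) k (deltaKappa F g κB φ x) (deltaKappa F g κB φ x)).re
    have e1 : ∀ x, f x =
        (k + 2) * (k + 1) * (deltaB F g κB (pairingForm F g (deltaKappa F g κB φ) φ) x ![]).re -
        (k + 2) * (deltaB F g κB (pairingForm F g φ (dKappa κB φ)) x ![]).re := fun x => by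
      have h3 : dKappa κB (deltaKappa F g κB φ) x + deltaKappa F g κB (dKappa κB φ) x = 0 :=
        congrFun h x
      have h4 := p1 x
      have h5 := p2 x
      rw [eq_neg_of_add_eq_zero_left h3, map_neg, LinearMap.neg_apply, Complex.neg_re,
        re_pairing_comm (φ x) (deltaKappa F g κB (dKappa κB φ) x)] at h5
      push_cast at h4
      simp only [f]
      linear_combination h4 - ((k : ℝ) + 2) * h5
    have hf : ∫ x, f x ∂(volumeMeasure g) = 0 := by
      simp only [e1]
      rw [integral_sub (i2.const_mul _) (i1.const_mul _), integral_const_mul, integral_const_mul,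
        h1, h2]
      ring
    have hδ0 := fun x => re_pairing_self_nonneg (F := F) (g := g) (x := x) (deltaKappa F g κB φ x)
    have hd0 := fun x => re_pairing_self_nonneg (F := F) (g := g) (x := x) (dKappa κB φ x)
    have hf0 : f = 0 := by
      refine eq_zero_of_integral_eq_zero g ?_ (fun x => ?_) hf
      · exact (Complex.continuous_re.comp (continuous_pairing hφ'.smooth hφ'.smooth)).add
          (continuous_const.mul
            (Complex.continuous_re.comp (continuous_pairing hδ.smooth hδ.smooth)))
      · have := hδ0 x
        have := hd0 x
        positivity
    funext x
    refine eq_zero_of_re_pairing_self (g := g) (hφ'.vanishesOn x) (le_antisymm ?_ (hd0 x))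
    have h3 : f x = 0 := congrFun hf0 x
    have h4 : 0 ≤ ((k : ℝ) + 2) * (k + 1) *
        (pairing (cometric F g x) k (deltaKappa F g κB φ x) (deltaKappa F g κB φ x)).re := by
      have := hδ0 x
      positivity
    simp only [f] at h3
    linarith

/-- Since `Alt D φ = d_κ φ = 0` and alternation determines the antilinear part of a complex linear
family, `D_{Ju} φ = i D_u φ`. -/
theorem isKappaHolomorphic_of_isKappaHarmonic {r : ℕ} {φ : Form N M ℂ r}
    (hJ : IsTransverseKahler F g J) (hκB : IsBasicPart F g κB) (hφ : IsBasic F φ)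
    (hc : ∀ x, IsComplexLinear (J x) (φ x)) (h : IsKappaHarmonic F g κB φ) :
    IsKappaHolomorphic J κB r 0 φ := by
  rw [isKappaHolomorphic_iff hJ hκB.basic hφ hc]
  intro x u
  have h1 := congrFun (dKappa_eq_zero_of_isKappaHarmonic hJ hκB hφ hc h) x
  rw [dKappa_eq_alternatize F g] at h1
  have h2 := alternatize_curryLeft_map (twistedCovDeriv_isComplexLinear (κB := κB) hJ hφ hc x) u
  rw [h1] at h2
  refine sub_eq_zero.1 (h2.symm.trans ?_)
  ext w
  change (0 : ℂ) - Complex.I * 0 = 0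
  simp

end Integration

end TransverseKahler

end

theorem theorem3p8 {N p : ℕ} {M : Type*} [TopologicalSpace M]
    [ChartedSpace (EuclideanSpace ℝ (Fin N)) M] [IsManifold (𝓡 N) ∞ M]
    [T2Space M] [SecondCountableTopology M] [MeasurableSpace M] [BorelSpace M]
    (F : TransverseKahler.Foliation N p M) (g : TransverseKahler.Metric N M)
    (J : M → EuclideanSpace ℝ (Fin N) →L[ℝ] EuclideanSpace ℝ (Fin N))
    (hJ : TransverseKahler.IsTransverseKahler F g J)
    (κB : TransverseKahler.Form N M ℝ 1) (hκB : TransverseKahler.IsBasicPart F g κB)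
    (r : ℕ) (φ : TransverseKahler.Form N M ℂ r)
    (hφ : TransverseKahler.IsBasic F φ) (hφr : TransverseKahler.IsOfType F J r 0 φ) :
    ((CompactSpace M ∨ TransverseKahler.extD κB = 0) →
      TransverseKahler.IsKappaHolomorphic J κB r 0 φ →
      TransverseKahler.IsKappaHarmonic F g κB φ) ∧
    (CompactSpace M → TransverseKahler.IsKappaHarmonic F g κB φ →
      TransverseKahler.IsKappaHolomorphic J κB r 0 φ) := by
  have hc : ∀ x, TransverseKahler.IsComplexLinear (J x) (φ x) := fun x =>
    TransverseKahler.isComplexLinear_of_mem_typeSpace hJ (hφr x)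
  refine ⟨fun h h1 => ?_, fun _ h1 =>
    TransverseKahler.isKappaHolomorphic_of_isKappaHarmonic hJ hκB hφ hc h1⟩
  -- Compactness enters the first implication only through the closedness of `κB`.
  have hd : TransverseKahler.extD κB = 0 := by
    rcases h with h | h
    · exact hκB.extD_eq_zero hJ
    · exact h
  exact TransverseKahler.isKappaHarmonic_of_isKappaHolomorphic hJ hκB.basic hd hφ hc h1
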